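/- Let $(M,g)$ be a smooth Riemannian $7$-manifold with Levi-Civita connection $\nabla$ and a smooth $G_2$-structure $\varphi$ whose associated metric is $g$ (at each point $\varphi=e^{123}+e^{145}+e^{167}+e^{246}-e^{257}-e^{347}-e^{356}$ in some orthonormal frame, which also fixes the orientation and the Hodge star $*$). The full torsion tensor $T$ of a $G_2$-structure $\varphi$ is defined by $\nabla_a\varphi_{bcd}=2T_a{}^{e}(*\varphi)_{ebcd}$; it decomposes as $T=\tau_1 g+\tau_7\lrcorner\varphi+\tau_{14}+\tau_{27}$ into its $\mathbf 1,\mathbf 7,\mathbf{14},\mathbf{27}$ components, and its type is the sum of those representations whose component does not vanish identically on $M$. On $\mathbb OM=\mathbb R\oplus TM$ use the octonion product $(a,\alpha)(b,\beta)=(ab-\langle\alpha,\beta\rangle,\ a\beta+b\alpha+\alpha\times\beta)$ with $\langle\alpha\times\beta,\gamma\rangle=\varphi(\alpha,\beta,\gamma)$, the derivative $D_aA=\nabla_aA-A\,T_a$, and $\delta_a=(0,\partial_a)$. For a nowhere-vanishing section $A=(a,\alpha)$ let $$\varphi_A=|A|^{-2}\left((a^2-|\alpha|^2)\varphi-2a\,\alpha\lrcorner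 *\varphi+2\alpha\wedge(\alpha\lrcorner\varphi)\right),$$ a $G_2$-structure with the same metric and orientation. Let $\Delta$ be a smooth function, $G$ a $4$-form, $\lambda\in\mathbb C$, $\mu\in\mathbb R$ constants, and let $Z=X+iY$, with $X,Y$ smooth nowhere-vanishing sections of $\mathbb OM$, satisfy the Killing equations $$0=\lambda e^{-\Delta}Z^*+i\left(\mu e^{-4\Delta}+\tfrac12\partial_c\Delta\,\delta^c\right)Z+\tfrac1{144}G_{bcde}\,\delta^b(\delta^c(\delta^d(\delta^eZ))),$$ $$D_aZ=-\tfrac12\mu e^{-4\Delta}\delta_aZ-\tfrac{i}{144}G_{bcde}\,\delta_a(\delta^b(\delta^c(\delta^d(\delta^eZ))))-\tfrac{i}{12}G_{abcd}\,\delta^b(\delta^c(\delta^dZ)),$$ where $Z^*=X-iY$. Let $w$ be the imaginary part of $W=YX^{-1}$, and let $T^{(X)},T^{(Y)}$ be the torsions of $\varphi_X,\varphi_Y$. **Theorem.** Suppose $\lambda\neq0$ and that $\partial\Delta$ and $w$ are linearly independent at some point of $M$. 1. If $\mu=0$ and $\lambda$ is normalized to be real, then $T^{(X)}$ and $T^{(Y)}$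 both have type exactly $\mathbf 7\oplus\mathbf{14}\oplus\mathbf{27}$: the $\mathbf 1$-component vanishes identically and the other three components do not. 2. If $\mu\neq0$, then $T^{(X)}$ and $T^{(Y)}$ both have the generic type $\mathbf 1\oplus\mathbf 7\oplus\mathbf{14}\oplus\mathbf{27}$: moreover the $\mathbf 1$-component does not vanish identically either. -/

import Mathlib

open Bundle Manifold
open scoped ContDiff

namespace G2Flux

/-! ### Pointwise algebra on a 7-dimensional inner product space -/

/-- The coefficient of the basic 3-form `e^a ∧ e^b ∧ e^c` on the basis vectors `e_i, e_j, e_k`. -/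
def wedge3 (a b c i j k : Fin 7) : ℤ :=
  let d : Fin 7 → Fin 7 → ℤ := fun m n => if m = n then 1 else 0
  d a i * d b j * d c k + d a j * d b k * d c i + d a k * d b i * d c j
    - d a i * d b k * d c j - d a j * d b i * d c k - d a k * d b j * d c i

/-- The standard `G₂`-invariant 3-form on `ℝ⁷`,
`e¹²³ + e¹⁴⁵ + e¹⁶⁷ + e²⁴⁶ - e²⁵⁷ - e³⁴⁷ - e³⁵⁶` (indices shifted to `0, …, 6`). -/
def phi0 (i j k : Fin 7) : ℤ :=
  wedge3 0 1 2 i j k + wedge3 0 3 4 i j k + wedge3 0 5 6 i j k + wedge3 1 3 5 i j k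
    - wedge3 1 4 6 i j k - wedge3 2 3 6 i j k - wedge3 2 4 5 i j k

section Algebra

variable {V : Type*} [NormedAddCommGroup V] [InnerProductSpace ℝ V] [FiniteDimensional ℝ V]

/-- An orthonormal basis, used for metric contractions (which do not depend on its choice). -/
noncomputable def onb (V : Type*) [NormedAddCommGroup V] [InnerProductSpace ℝ V]
    [FiniteDimensional ℝ V] : OrthonormalBasis (Fin (Module.finrank ℝ V)) ℝ V :=
  stdOrthonormalBasis ℝ V

/-- Index raising: the vector `α^♯` with `⟪α^♯, v⟫ = α v` for a linear form `α`. -/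
noncomputable def sharp (α : V → ℝ) : V := ∑ i, α (onb V i) • onb V i

/-- The octonions `ℝ ⊕ V`, as pairs (real part, imaginary part). -/
abbrev Oct (V : Type*) := ℝ × V

/-- The imaginary octonion `v̂ = (0, v)`. -/
def imag (v : V) : Oct V := (0, v)

/-- The vector cross product of a 3-form: `⟪u × v, w⟫ = φ(u, v, w)`. -/
noncomputable def cross (φ : V → V → V → ℝ) (u v : V) : V := sharp (φ u v)

/-- The octonion product `(a, α)(b, β) = (ab - ⟪α, β⟫, aβ + bα + α × β)`. -/
noncomputable def omul (φ : V → V → V → ℝ) (A B : Oct V) : Oct V :=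
  (A.1 * B.1 - inner ℝ A.2 B.2, A.1 • B.2 + B.1 • A.2 + cross φ A.2 B.2)

/-- `|A|² = a² + |α|²`. -/
noncomputable def normSq (A : Oct V) : ℝ := A.1 ^ 2 + ‖A.2‖ ^ 2

/-- `A⁻¹ = Ā / |A|²`. -/
noncomputable def oinv (A : Oct V) : Oct V := (normSq A)⁻¹ • (A.1, -A.2)

/-- The Hodge dual 4-form of a 3-form,
`(∗φ)_{abcd} = (1/6) φ^{ijk} vol_{ijkabcd}`, for the volume form of the orientation `o`. -/
noncomputable def hodge [Fact (Module.finrank ℝ V = 7)] (o : Orientation ℝ V (Fin 7))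
    (φ : V → V → V → ℝ) (a b c d : V) : ℝ :=
  1 / 6 * ∑ i, ∑ j, ∑ k, φ (onb V i) (onb V j) (onb V k) *
    o.volumeForm ![onb V i, onb V j, onb V k, a, b, c, d]

/-- The isometric change of 3-form by a nonzero octonion `A = (a, α)`:
`σ_A(φ) = |A|⁻² ((a² - |α|²) φ - 2a α⌟(∗φ) + 2 α ∧ (α⌟φ))`. -/
noncomputable def sigma [Fact (Module.finrank ℝ V = 7)] (o : Orientation ℝ V (Fin 7))
    (φ : V → V → V → ℝ) (A : Oct V) (u v w : V) : ℝ :=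
  (normSq A)⁻¹ * ((A.1 ^ 2 - ‖A.2‖ ^ 2) * φ u v w - 2 * A.1 * hodge o φ A.2 u v w
    + 2 * (inner ℝ A.2 u * φ A.2 v w + inner ℝ A.2 v * φ A.2 w u + inner ℝ A.2 w * φ A.2 u v))

/-- Bioctonions `Z = X + iY`, as pairs `(X, Y)` of octonions. -/
abbrev BiOct (V : Type*) := Oct V × Oct V

/-- Multiplication of `Z = X + iY` by a complex number. -/
def csmul (z : ℂ) (Z : BiOct V) : BiOct V :=
  (z.re • Z.1 - z.im • Z.2, z.re • Z.2 + z.im • Z.1)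

/-- The complex conjugate `Z^* = X - iY`. -/
def cconj (Z : BiOct V) : BiOct V := (Z.1, -Z.2)

/-- Left multiplication `AZ` of a bioctonion by a real octonion. -/
noncomputable def lmul (φ : V → V → V → ℝ) (A : Oct V) (Z : BiOct V) : BiOct V :=
  (omul φ A Z.1, omul φ A Z.2)

/-- `G_{abcd} δ^b (δ^c (δ^d Z))`, with `u` in the slot of the free index `a`. -/
noncomputable def cliff3 (φ : V → V → V → ℝ) (G : V [⋀^Fin 4]→L[ℝ] ℝ) (u : V) (Z : BiOct V) :
    BiOct V :=
  ∑ b, ∑ c, ∑ d, G ![u, onb V b, onb V c, onb V d] •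
    lmul φ (imag (onb V b)) (lmul φ (imag (onb V c)) (lmul φ (imag (onb V d)) Z))

/-- `G_{bcde} δ^b (δ^c (δ^d (δ^e Z)))`. -/
noncomputable def cliff4 (φ : V → V → V → ℝ) (G : V [⋀^Fin 4]→L[ℝ] ℝ) (Z : BiOct V) :
    BiOct V :=
  ∑ b, lmul φ (imag (onb V b)) (cliff3 φ G (onb V b) Z)

/-- The **1**-component `τ₁` in `T = τ₁ g + τ₇⌟φ + τ₁₄ + τ₂₇`. -/
noncomputable def tau1 (T : V → V → ℝ) : ℝ := 1 / 7 * ∑ i, T (onb V i) (onb V i)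

/-- The **7**-component `τ₇` (as a vector): `(τ₇)^c = (1/6) T_{ab} φ^{cab}`. -/
noncomputable def tau7 (φ : V → V → V → ℝ) (T : V → V → ℝ) : V :=
  sharp fun u => 1 / 6 * ∑ i, ∑ j, φ u (onb V i) (onb V j) * T (onb V i) (onb V j)

/-- The **14**-component: the skew part of `T` without `τ₇⌟φ`. -/
noncomputable def tau14 (φ : V → V → V → ℝ) (T : V → V → ℝ) (u v : V) : ℝ :=
  (T u v - T v u) / 2 - φ (tau7 φ T) u v

/-- The **27**-component: the trace-free symmetric part of `T`. -/
noncomputable def tau27 (T : V → V → ℝ) (u v : V) : ℝ :=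
  (T u v + T v u) / 2 - tau1 T * inner ℝ u v

end Algebra

/-! ### Fields on a Riemannian 7-manifold -/

section Fields

variable {M : Type*} [TopologicalSpace M] [ChartedSpace (EuclideanSpace ℝ (Fin 7)) M]

/-- The tangent space of a 7-manifold. -/
abbrev T7 (p : M) : Type := TangentSpace (𝓡 7) p

instance instFiniteDimensionalT7 (p : M) : FiniteDimensional ℝ (T7 p) :=
  inferInstanceAs (FiniteDimensional ℝ (EuclideanSpace ℝ (Fin 7)))

instance instFactFinrankT7 (p : M) : Fact (Module.finrank ℝ (T7 p) = 7) :=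
  ⟨(finrank_euclideanSpace_fin : Module.finrank ℝ (EuclideanSpace ℝ (Fin 7)) = 7)⟩

/-- Smoothness of an octonion section `A = (a, α)`. -/
def SmoothOct [IsManifold (𝓡 7) ∞ M] (A : ∀ p : M, Oct (T7 p)) : Prop :=
  ContMDiff (𝓡 7) 𝓘(ℝ, ℝ) ∞ (fun p => (A p).1) ∧
    ContMDiff (𝓡 7) (𝓡 7).tangent ∞ (fun p => (⟨p, (A p).2⟩ : TangentBundle (𝓡 7) M))

variable [IsManifold (𝓡 7) ∞ M] [RiemannianBundle (fun p : M => T7 p)]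

/-- The covariant derivative `(∇_u Φ)(a, b, c)` at `p` of a field `Φ` of trilinear forms,
computed with vector fields extending `a, b, c`. -/
noncomputable def formDeriv
    (nabla : CovariantDerivative (𝓡 7) (EuclideanSpace ℝ (Fin 7)) (fun p : M => T7 p))
    (Φ : ∀ p : M, T7 p → T7 p → T7 p → ℝ) (p : M) (u a b c : T7 p) : ℝ :=
  let ext : T7 p → ∀ q : M, T7 q := fun v => FiberBundle.extend (EuclideanSpace ℝ (Fin 7)) v
  mvfderiv (𝓡 7) (fun q => Φ q (ext a q) (ext b q) (ext c q)) p u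
    - Φ p (nabla (ext a) p u) b c - Φ p a (nabla (ext b) p u) c - Φ p a b (nabla (ext c) p u)

/-- The full torsion tensor of the `G₂`-structure `Φ`, inverting `∇_a Φ_{bcd} = 2 T_a^e (∗Φ)_{ebcd}`:
`T_{am} = (1/48) (∇_a Φ_{bcd}) (∗Φ)_m^{bcd}`. -/
noncomputable def torsion
    (nabla : CovariantDerivative (𝓡 7) (EuclideanSpace ℝ (Fin 7)) (fun p : M => T7 p))
    (o : ∀ p : M, Orientation ℝ (T7 p) (Fin 7))
    (Φ : ∀ p : M, T7 p → T7 p → T7 p → ℝ) (p : M) (u v : T7 p) : ℝ :=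
  1 / 48 * ∑ i, ∑ j, ∑ k,
    formDeriv nabla Φ p u (onb (T7 p) i) (onb (T7 p) j) (onb (T7 p) k) *
      hodge (o p) (Φ p) v (onb (T7 p) i) (onb (T7 p) j) (onb (T7 p) k)

/-- The octonion covariant derivative `D_u A = ∇_u A - A T_u` of the `G₂`-structure `φ`. -/
noncomputable def octDeriv
    (nabla : CovariantDerivative (𝓡 7) (EuclideanSpace ℝ (Fin 7)) (fun p : M => T7 p))
    (o : ∀ p : M, Orientation ℝ (T7 p) (Fin 7))
    (φ : ∀ p : M, T7 p → T7 p → T7 p → ℝ) (A : ∀ p : M, Oct (T7 p)) (p : M) (u : T7 p) :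
    Oct (T7 p) :=
  (mvfderiv (𝓡 7) (fun q => (A q).1) p u, nabla (fun q => (A q).2) p u)
    - omul (φ p) (A p) (imag (sharp (torsion nabla o φ p u)))

/-- The gradient `∂Δ`. -/
noncomputable def grad (Δ : M → ℝ) (p : M) : T7 p := sharp fun u => mvfderiv (𝓡 7) Δ p u

/-- `Z = X + iY` solves the Killing equations
`0 = λ e^{-Δ} Z^* + i (μ e^{-4Δ} + ½ ∂Δ) Z + (1/144) G_{bcde} δ^b(δ^c(δ^d(δ^e Z)))` and
`D_a Z = -½ μ e^{-4Δ} δ_a Z - (i/144) G_{bcde} δ_a(δ^b(δ^c(δ^d(δ^e Z))))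
  - (i/12) G_{abcd} δ^b(δ^c(δ^d Z))`. -/
structure IsKilling
    (nabla : CovariantDerivative (𝓡 7) (EuclideanSpace ℝ (Fin 7)) (fun p : M => T7 p))
    (o : ∀ p : M, Orientation ℝ (T7 p) (Fin 7))
    (φ : ∀ p : M, T7 p → T7 p → T7 p → ℝ) (Δ : M → ℝ) (G : ∀ p : M, T7 p [⋀^Fin 4]→L[ℝ] ℝ)
    (lam : ℂ) (mu : ℝ) (X Y : ∀ p : M, Oct (T7 p)) : Prop where
  ext : ∀ p : M,
    (0 : BiOct (T7 p)) = csmul (lam * (Real.exp (-Δ p) : ℝ)) (cconj (X p, Y p))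
      + csmul Complex.I
          (lmul (φ p) (mu * Real.exp (-4 * Δ p), (1 / 2 : ℝ) • grad Δ p) (X p, Y p))
      + (1 / 144 : ℝ) • cliff4 (φ p) (G p) (X p, Y p)
  int : ∀ (p : M) (u : T7 p),
    ((octDeriv nabla o φ X p u, octDeriv nabla o φ Y p u) : BiOct (T7 p)) =
      -(1 / 2 * mu * Real.exp (-4 * Δ p)) • lmul (φ p) (imag u) (X p, Y p)
      - csmul (Complex.I / 144) (lmul (φ p) (imag u) (cliff4 (φ p) (G p) (X p, Y p)))
      - csmul (Complex.I / 12) (cliff3 (φ p) (G p) u (X p, Y p))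

/-- `φ` is a smooth `G₂`-structure with associated metric the given one and orientation `o`: a
smooth 3-form (smooth on all triples of smooth vector fields) such that at every point there is an
oriented orthonormal frame in which `φ` is the standard 3-form. -/
structure IsG2Structure (o : ∀ p : M, Orientation ℝ (T7 p) (Fin 7))
    (φ : ∀ p : M, T7 p →L[ℝ] T7 p →L[ℝ] T7 p →L[ℝ] ℝ) : Prop where
  smooth : ∀ (p : M) (u v w : ∀ q : M, T7 q),
    ContMDiffAt (𝓡 7) (𝓡 7).tangent ∞ (fun q => (⟨q, u q⟩ : TangentBundle (𝓡 7) M)) p →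
    ContMDiffAt (𝓡 7) (𝓡 7).tangent ∞ (fun q => (⟨q, v q⟩ : TangentBundle (𝓡 7) M)) p →
    ContMDiffAt (𝓡 7) (𝓡 7).tangent ∞ (fun q => (⟨q, w q⟩ : TangentBundle (𝓡 7) M)) p →
    ContMDiffAt (𝓡 7) 𝓘(ℝ, ℝ) ∞ (fun q => φ q (u q) (v q) (w q)) p
  adapted : ∀ p : M, ∃ e : OrthonormalBasis (Fin 7) ℝ (T7 p),
    e.toBasis.orientation = o p ∧ ∀ i j k, φ p (e i) (e j) (e k) = (phi0 i j k : ℝ)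

set_option synthInstance.maxHeartbeats 200000 in
/-- `nabla` is the Levi-Civita connection: torsion-free and compatible with the metric. -/
def IsLeviCivita
    [IsContMDiffRiemannianBundle (𝓡 7) ∞ (EuclideanSpace ℝ (Fin 7)) (fun p : M => T7 p)]
    (nabla : CovariantDerivative (𝓡 7) (EuclideanSpace ℝ (Fin 7)) (fun p : M => T7 p)) : Prop :=
  nabla.torsion = 0 ∧ nabla.IsMetricCompatible

/-- The four irreducible `G₂`-components of a torsion tensor. -/
inductive TorsionComponent
  | one
  | seven
  | fourteen
  | twentySeven

/-- The torsion type of a `G₂`-structure `Φ` with torsion tensor `T`: the set of those components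
of `T` which do not vanish identically on `M`. -/
def torsionType (Φ : ∀ p : M, T7 p → T7 p → T7 p → ℝ) (T : ∀ p : M, T7 p → T7 p → ℝ) :
    Set TorsionComponent :=
  {c | match c with
    | .one => ∃ p, tau1 (T p) ≠ 0
    | .seven => ∃ p, tau7 (Φ p) (T p) ≠ 0
    | .fourteen => ∃ p, tau14 (Φ p) (T p) ≠ 0
    | .twentySeven => ∃ p, tau27 (T p) ≠ 0}

end Fields

end G2Flux

/-! Left multiplication `L` by imaginary octonions satisfies the Clifford relation and is
skew-adjoint, so each fibre of 𝕆M is an 8-dimensional Clifford module. A nonzero A gives an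
orthogonal basis A, e_i A, and φ_A is the 3-form of the spinor A: φ_A(u,v,w) = |A|⁻²⟨u(vA), wA⟩
(`IsAdapted.sigma_eq`), with Hodge dual `psiA` (`IsAdapted.hodge_phiA`).

Since ∇ is metric, ∇_uφ is 2 t⌟∗φ for a vector t, which is the torsion row T_u
(`IsAdapted.exists_eq_psiA`, `IsG2Structure.exists_torsion_eq`). The same 4-form measures the
non-associativity of right multiplication by t, so D_u A = ∇_u A - A T_u is a metric derivation of
the Clifford action (`IsG2Structure.octD_L`, `IsG2Structure.mvfderiv_oip`). Differentiating φ_X then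
gives T^(X)(u,v) = -|X|⁻²⟨D_u X, vX⟩ (`IsG2Structure.torsion_phiA`).

The flux enters only through c, the Clifford action of G/144, which is symmetric and satisfies ∑ e_i
c e_i = c. The algebraic Killing equation gives cX and cY; the rest of c is not determined, so only
those parts of T are computed in which c can be brought onto X or Y. Write d = ∂Δ, λe^{-Δ} = l₁ + i
l₂, m = μe^{-4Δ}, N = |X|², M = |Y|², Y = w₀X + wX, r = M/N = w₀² + |w|².

One: 14 τ₁ N = m(2N + 5M) - 5 l₂(N + M), which vanishes when μ = 0 and λ is real. If μ ≠ 0 and τ₁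
vanished identically, differentiating this relation would make d a multiple of w at the given point.

Seven: τ₇ is a combination of d and w in which d has a positive coefficient.

Fourteen: let zX be the part of w(dX) orthogonal to X, so that z is nonzero and orthogonal to d and
w. Then τ₁₄(w, z) = -(1 + r)|z|²/4.

Twenty-seven: evaluating on w and on vectors orthogonal to w shows that τ₂₇ = 0 forces r = 1 and w₀
= 0 where d and w are independent, that is, N = M and ⟨X, Y⟩ = 0. On a neighbourhood this
contradicts the scalar identity `IsKillingAt.constraint` if μ ≠ 0, and the derivative of M - N if μ
= 0.

The statements for Y follow from those for X by the symmetry Z ↦ iZ^*, which exchanges X and Y. -/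

set_option linter.unusedSectionVars false

namespace G2Flux

/-! ### Vector cross products and the Clifford action on octonions. -/

section Pointwise

variable {V : Type*} [NormedAddCommGroup V] [InnerProductSpace ℝ V] [FiniteDimensional ℝ V]

/-- The trilinear form underlying a curried trilinear map. -/
noncomputable abbrev form (φ : V →ₗ[ℝ] V →ₗ[ℝ] V →ₗ[ℝ] ℝ) : V → V → V → ℝ := fun u v w => φ u v w

lemma inner_sharp {α : V → ℝ} (hα : IsLinearMap ℝ α) (v : V) : inner ℝ (sharp α) v = α v := by
  have h : α v = hα.mk' α (∑ i, inner ℝ (onb V i) v • onb V i) := by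
    rw [(onb V).sum_repr' v]; rfl
  rw [h, map_sum, sharp, sum_inner]
  refine Finset.sum_congr rfl fun i _ => ?_
  rw [map_smul, inner_smul_left]
  simp [mul_comm]

lemma inner_cross (φ : V →ₗ[ℝ] V →ₗ[ℝ] V →ₗ[ℝ] ℝ) (u v w : V) :
    inner ℝ (cross (form φ) u v) w = φ u v w :=
  inner_sharp (φ u v).isLinear w

lemma sharp_eq {α : V → ℝ} {x : V} (h : ∀ v, α v = inner ℝ x v) : sharp α = x := by
  refine ext_inner_right ℝ fun v => ?_
  have hα : IsLinearMap ℝ α :=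
    ⟨fun a b => by simp [h, inner_add_right], fun c a => by simp [h, inner_smul_right]⟩
  rw [inner_sharp hα, h]

/-- The Euclidean inner product on octonions. -/
noncomputable def oip : Oct V →ₗ[ℝ] Oct V →ₗ[ℝ] ℝ :=
  LinearMap.mk₂ ℝ (fun A B => A.1 * B.1 + inner ℝ A.2 B.2)
    (fun A A' B => by simp [inner_add_left]; ring)
    (fun c A B => by simp [inner_smul_left]; ring)
    (fun A B B' => by simp [inner_add_right]; ring)
    (fun c A B => by simp [inner_smul_right]; ring)

lemma oip_apply (A B : Oct V) : oip A B = A.1 * B.1 + inner ℝ A.2 B.2 := rfl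

lemma oip_comm (A B : Oct V) : oip A B = oip B A := by
  rw [oip_apply, oip_apply, real_inner_comm]; ring

lemma oip_self (A : Oct V) : oip A A = normSq A := by
  rw [oip_apply, normSq, real_inner_self_eq_norm_sq]; ring

lemma normSq_pos {A : Oct V} (hA : A ≠ 0) : 0 < normSq A := by
  rcases A with ⟨a, α⟩
  by_cases ha : a = 0
  · have hα : α ≠ 0 := fun h => hA (by simp [ha, h])
    have := norm_pos_iff.mpr hα
    simp only [normSq]; positivity
  · simp only [normSq]; positivity

/-- `φ` is the 3-form of a vector cross product. -/
structure IsVectorCross (φ : V →ₗ[ℝ] V →ₗ[ℝ] V →ₗ[ℝ] ℝ) : Prop where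
  alt_left : ∀ u v, φ u u v = 0
  alt_right : ∀ u v, φ u v v = 0
  norm_cross : ∀ u v, inner ℝ (cross (form φ) u v) (cross (form φ) u v)
    = inner ℝ u u * inner ℝ v v - inner ℝ u v ^ 2

lemma cross_add_right (φ : V →ₗ[ℝ] V →ₗ[ℝ] V →ₗ[ℝ] ℝ) (u v v' : V) :
    cross (form φ) u (v + v') = cross (form φ) u v + cross (form φ) u v' :=
  ext_inner_right ℝ fun w => by simp only [inner_cross, inner_add_left, map_add, LinearMap.add_apply]

lemma cross_smul_right (φ : V →ₗ[ℝ] V →ₗ[ℝ] V →ₗ[ℝ] ℝ) (c : ℝ) (u v : V) :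
    cross (form φ) u (c • v) = c • cross (form φ) u v :=
  ext_inner_right ℝ fun w => by
    simp only [inner_cross, real_inner_smul_left, map_smul, LinearMap.smul_apply, smul_eq_mul]

lemma cross_add_left (φ : V →ₗ[ℝ] V →ₗ[ℝ] V →ₗ[ℝ] ℝ) (u u' v : V) :
    cross (form φ) (u + u') v = cross (form φ) u v + cross (form φ) u' v :=
  ext_inner_right ℝ fun w => by simp only [inner_cross, inner_add_left, map_add, LinearMap.add_apply]

lemma cross_smul_left (φ : V →ₗ[ℝ] V →ₗ[ℝ] V →ₗ[ℝ] ℝ) (c : ℝ) (u v : V) :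
    cross (form φ) (c • u) v = c • cross (form φ) u v :=
  ext_inner_right ℝ fun w => by
    simp only [inner_cross, real_inner_smul_left, map_smul, LinearMap.smul_apply, smul_eq_mul]

/-- Left multiplication by imaginary octonions. -/
noncomputable def L (φ : V →ₗ[ℝ] V →ₗ[ℝ] V →ₗ[ℝ] ℝ) : V →ₗ[ℝ] Oct V →ₗ[ℝ] Oct V :=
  LinearMap.mk₂ ℝ (fun u A => omul (form φ) (imag u) A)
    (fun u u' A => by
      ext <;> simp [omul, imag, inner_add_left, cross_add_left]
      · ring
      · abel)
    (fun c u A => by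
      ext <;> simp [omul, imag, inner_smul_left, cross_smul_left, smul_smul, mul_comm])
    (fun u A B => by
      ext <;> simp [omul, imag, inner_add_right, cross_add_right, add_smul]
      · ring
      · abel)
    (fun c u A => by
      ext <;> simp [omul, imag, inner_smul_right, cross_smul_right, smul_smul, mul_comm])

lemma L_apply (φ : V →ₗ[ℝ] V →ₗ[ℝ] V →ₗ[ℝ] ℝ) (u : V) (A : Oct V) :
    L φ u A = omul (form φ) (imag u) A := rfl

lemma L_fst (φ : V →ₗ[ℝ] V →ₗ[ℝ] V →ₗ[ℝ] ℝ) (u : V) (A : Oct V) :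
    (L φ u A).1 = -inner ℝ u A.2 := by simp [L_apply, omul, imag]

lemma L_snd (φ : V →ₗ[ℝ] V →ₗ[ℝ] V →ₗ[ℝ] ℝ) (u : V) (A : Oct V) :
    (L φ u A).2 = A.1 • u + cross (form φ) u A.2 := by simp [L_apply, omul, imag]

variable {φ : V →ₗ[ℝ] V →ₗ[ℝ] V →ₗ[ℝ] ℝ}

lemma IsVectorCross.swap_left (hφ : IsVectorCross φ) (u v w : V) : φ u v w = -φ v u w := by
  have h := hφ.alt_left (u + v) w
  simp only [map_add, LinearMap.add_apply, hφ.alt_left] at h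
  linarith

lemma IsVectorCross.swap_right (hφ : IsVectorCross φ) (u v w : V) : φ u v w = -φ u w v := by
  have h := hφ.alt_right u (v + w)
  simp only [map_add, LinearMap.add_apply, hφ.alt_right] at h
  linarith

lemma IsVectorCross.cross_swap (hφ : IsVectorCross φ) (u v : V) : cross (form φ) u v = -cross (form φ) v u :=
  ext_inner_right ℝ fun w => by rw [inner_neg_left, inner_cross, inner_cross, hφ.swap_left]

lemma IsVectorCross.inner_cross_cross (hφ : IsVectorCross φ) (u v w : V) :
    inner ℝ (cross (form φ) u v) (cross (form φ) u w)
    = inner ℝ u u * inner ℝ v w - inner ℝ u v * inner ℝ u w := by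
  have h := hφ.norm_cross u (v + w)
  rw [cross_add_right] at h
  simp only [inner_add_left, inner_add_right, hφ.norm_cross] at h
  rw [real_inner_comm (cross (form φ) u v) (cross (form φ) u w), real_inner_comm v w] at h
  linarith

lemma IsVectorCross.cross_cross (hφ : IsVectorCross φ) (u v : V) :
    cross (form φ) u (cross (form φ) u v) = inner ℝ u v • u - inner ℝ u u • v :=
  ext_inner_right ℝ fun w => by
    rw [inner_cross, hφ.swap_right, ← inner_cross, real_inner_comm, hφ.inner_cross_cross,
      inner_sub_left, real_inner_smul_left, real_inner_smul_left]
    ring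

/-- The Clifford relation comes from u × (u × v) = ⟨u,v⟩u - |u|²v. Nothing else about octonion
multiplication is needed for most of what follows. -/
lemma IsVectorCross.L_L_self (hφ : IsVectorCross φ) (u : V) (A : Oct V) : L φ u (L φ u A) = -(inner ℝ u u • A) := by
  ext1
  · rw [L_fst, L_snd, inner_add_right, inner_smul_right, real_inner_comm (cross _ _ _) u, inner_cross,
      hφ.swap_right, hφ.alt_left]
    simp [mul_comm]
  · rw [L_snd, L_fst, L_snd, cross_add_right, cross_smul_right, hφ.cross_cross]
    have : cross (form φ) u u = 0 :=
      ext_inner_right ℝ fun w => by rw [inner_cross, hφ.alt_left, inner_zero_left]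
    rw [this]
    simp only [neg_smul, smul_zero, Prod.snd_neg, Prod.smul_snd]
    abel

lemma IsVectorCross.L_L (hφ : IsVectorCross φ) (u v : V) (A : Oct V) :
    L φ u (L φ v A) = -L φ v (L φ u A) - (2 * inner ℝ u v) • A := by
  have h := hφ.L_L_self (u + v) A
  simp only [map_add, LinearMap.add_apply, inner_add_left, inner_add_right, hφ.L_L_self] at h
  rw [real_inner_comm u v] at h
  linear_combination (norm := module) h

/-- Alternation of `φ` makes left multiplication by an imaginary octonion skew-adjoint, so factors
can be moved across the inner product at the cost of a sign. -/
lemma IsVectorCross.oip_L (hφ : IsVectorCross φ) (u : V) (A B : Oct V) : oip (L φ u A) B = -oip A (L φ u B) := by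
  simp only [oip_apply, L_fst, L_snd, inner_add_left, inner_add_right, real_inner_smul_left,
    real_inner_smul_right, inner_cross]
  rw [real_inner_comm (cross (form φ) u B.2) A.2, inner_cross, hφ.swap_right u A.2 B.2,
    real_inner_comm A.2 u]
  ring

lemma IsVectorCross.oip_L_self (hφ : IsVectorCross φ) (u : V) (A : Oct V) : oip (L φ u A) A = 0 := by
  have := hφ.oip_L u A A
  rw [oip_comm A] at this
  linarith

lemma IsVectorCross.oip_self_L (hφ : IsVectorCross φ) (u : V) (A : Oct V) : oip A (L φ u A) = 0 := by
  rw [oip_comm, hφ.oip_L_self]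

lemma IsVectorCross.oip_L_L_same (hφ : IsVectorCross φ) (u : V) (A B : Oct V) :
    oip (L φ u A) (L φ u B) = inner ℝ u u * oip A B := by
  rw [hφ.oip_L, hφ.L_L_self]; simp

lemma IsVectorCross.oip_L_L (hφ : IsVectorCross φ) (u v : V) (A : Oct V) :
    oip (L φ u A) (L φ v A) = inner ℝ u v * oip A A := by
  have h := hφ.oip_L_L_same (u + v) A A
  simp only [map_add, LinearMap.add_apply, inner_add_left, inner_add_right,
    hφ.oip_L_L_same] at h
  rw [oip_comm (L φ v A) (L φ u A), real_inner_comm u v] at h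
  linarith

/-- Every octonion is `bX + vX` for a given nonzero `X`. -/
lemma IsVectorCross.exists_eq (hφ : IsVectorCross φ) {X : Oct V} (hX : X ≠ 0) (B : Oct V) :
    ∃ (b : ℝ) (v : V), B = b • X + L φ v X := by
  -- The map y ↦ y.1 X + y.2 X multiplies squared norms by |X|², hence is injective. It is an
  -- endomorphism of a finite-dimensional space, hence surjective.
  let f : (ℝ × V) →ₗ[ℝ] (ℝ × V) :=
    (LinearMap.toSpanSingleton ℝ _ X).comp (LinearMap.fst ℝ ℝ V)
      + ((L φ).flip X).comp (LinearMap.snd ℝ ℝ V)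
  have hf : ∀ y : ℝ × V, f y = y.1 • X + L φ y.2 X := fun y => rfl
  have hinj : Function.Injective f := by
    rw [injective_iff_map_eq_zero]
    intro y hy
    have h : oip (f y) (f y) = 0 := by rw [hy]; simp
    rw [hf] at h
    simp only [map_add, map_smul, LinearMap.add_apply, LinearMap.smul_apply, smul_eq_mul,
      hφ.oip_self_L, hφ.oip_L_self, hφ.oip_L_L] at h
    have h3 : normSq y * normSq X = 0 := by
      rw [← oip_self, ← oip_self, oip_apply y y]
      linarith
    by_contra hne
    exact (mul_pos (normSq_pos hne) (normSq_pos hX)).ne' h3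
  obtain ⟨y, hy⟩ := LinearMap.injective_iff_surjective.mp hinj B
  exact ⟨y.1, y.2, by rw [← hy, hf]⟩

/-- Parseval's identity for the orthogonal basis `X, e_i X`. -/
lemma IsVectorCross.sum_oip (hφ : IsVectorCross φ) {ι : Type*} [Fintype ι] (e : OrthonormalBasis ι ℝ V)
    (X B C : Oct V) :
    ∑ i, oip (L φ (e i) X) B * oip (L φ (e i) X) C
      = oip X X * oip B C - oip X B * oip X C := by
  by_cases hX : X = 0
  · simp [hX]
  obtain ⟨b, v, rfl⟩ := hφ.exists_eq hX B
  obtain ⟨c, w, rfl⟩ := hφ.exists_eq hX C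
  simp only [map_add, map_smul, LinearMap.add_apply, LinearMap.smul_apply, smul_eq_mul,
      hφ.oip_self_L, hφ.oip_L_self, hφ.oip_L_L]
  have h : ∑ i, inner ℝ (e i) v * inner ℝ (e i) w = inner ℝ v w := by
    rw [← e.sum_inner_mul_inner v w]
    exact Finset.sum_congr rfl fun i _ => by rw [real_inner_comm v]
  calc _ = oip X X ^ 2 * ∑ i, inner ℝ (e i) v * inner ℝ (e i) w := by
        rw [Finset.mul_sum]; exact Finset.sum_congr rfl fun i _ => by ring
    _ = _ := by rw [h]; ring

end Pointwise

/-! ### The 3-form and 4-form attached to an octonion, and their contractions. -/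

section Pointwise

variable {V : Type*} [NormedAddCommGroup V] [InnerProductSpace ℝ V] [FiniteDimensional ℝ V]
variable {φ : V →ₗ[ℝ] V →ₗ[ℝ] V →ₗ[ℝ] ℝ}

lemma sum_inner_smul {ι E : Type*} [Fintype ι] [AddCommGroup E] [Module ℝ E]
    (e : OrthonormalBasis ι ℝ V) (f : V →ₗ[ℝ] E) (v : V) :
    ∑ i, inner ℝ (e i) v • f (e i) = f v := by
  conv_rhs => rw [← e.sum_repr' v]
  simp

lemma IsVectorCross.sum_L_L {ι : Type*} [Fintype ι] (hφ : IsVectorCross φ)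
    (e : OrthonormalBasis ι ℝ V) (B : Oct V) :
    ∑ i, L φ (e i) (L φ (e i) B) = -(Fintype.card ι : ℝ) • B := by
  simp [hφ.L_L_self, ← Nat.cast_smul_eq_nsmul ℝ]

lemma IsVectorCross.sum_inner_L {ι : Type*} [Fintype ι]
    (e : OrthonormalBasis ι ℝ V) (v : V) (B : Oct V) :
    ∑ i, inner ℝ (e i) v • L φ (e i) B = L φ v B :=
  sum_inner_smul e ((L φ).flip B) v

/-- `∑ e_i s e_i = 5 s` in the Clifford algebra of a 7-dimensional space. -/
lemma IsVectorCross.sum_L_L_L {ι : Type*} [Fintype ι] (hφ : IsVectorCross φ)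
    (e : OrthonormalBasis ι ℝ V) (hι : Fintype.card ι = 7) (s : V) (B : Oct V) :
    ∑ i, L φ (e i) (L φ s (L φ (e i) B)) = (5 : ℝ) • L φ s B := by
  have h : ∀ i, L φ (e i) (L φ s (L φ (e i) B))
      = -L φ s (L φ (e i) (L φ (e i) B)) - (2 : ℝ) • (inner ℝ (e i) s • L φ (e i) B) := fun i => by
    rw [hφ.L_L (e i) s]; module
  simp only [h, Finset.sum_sub_distrib, Finset.sum_neg_distrib, ← map_sum, ← Finset.smul_sum,
    hφ.sum_L_L, sum_inner_L, hι, map_smul]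
  push_cast
  module

/-- `∑ e_i s v e_i = -3 s v + 4⟪s, v⟫` in the Clifford algebra of a 7-dimensional space. -/
lemma IsVectorCross.sum_L_L_L_L {ι : Type*} [Fintype ι] (hφ : IsVectorCross φ)
    (e : OrthonormalBasis ι ℝ V) (hι : Fintype.card ι = 7) (s v : V) (B : Oct V) :
    ∑ i, L φ (e i) (L φ s (L φ v (L φ (e i) B)))
      = (-3 : ℝ) • L φ s (L φ v B) + (4 * inner ℝ s v) • B := by
  have h : ∀ i, L φ (e i) (L φ s (L φ v (L φ (e i) B)))
      = -L φ s (L φ (e i) (L φ v (L φ (e i) B)))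
        - (2 : ℝ) • L φ v (inner ℝ (e i) s • L φ (e i) B) := fun i => by
    rw [hφ.L_L (e i) s, map_smul]; module
  simp only [h, Finset.sum_sub_distrib, Finset.sum_neg_distrib, ← map_sum, ← Finset.smul_sum,
    hφ.sum_L_L_L e hι, sum_inner_L]
  simp only [map_smul]
  rw [hφ.L_L v s, real_inner_comm s v]
  module

/-- The 3-form of the cross product obtained from `φ` by the octonion `A`. -/
noncomputable def phiA (φ : V →ₗ[ℝ] V →ₗ[ℝ] V →ₗ[ℝ] ℝ) (A : Oct V) (u v w : V) : ℝ :=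
  (normSq A)⁻¹ * oip (L φ u (L φ v A)) (L φ w A)

/-- The 4-form dual to `phiA`. -/
noncomputable def psiA (φ : V →ₗ[ℝ] V →ₗ[ℝ] V →ₗ[ℝ] ℝ) (A : Oct V) (s u v w : V) : ℝ :=
  (normSq A)⁻¹ * (-(1 / 2) * oip (L φ s (L φ u (L φ v A)) - L φ v (L φ u (L φ s A))) (L φ w A))

/-- In this form `psiA` is the cross term in the expansion of ⟨u(vB), wB⟩ with B = aA + sA, which is
how the coefficient -2a in `sigma` arises. -/
lemma IsVectorCross.psiA_eq (hφ : IsVectorCross φ) (A : Oct V) (s u v w : V) :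
    psiA φ A s u v w = (normSq A)⁻¹ * (-(1 / 2) *
      (oip (L φ u (L φ v (L φ s A))) (L φ w A) + oip (L φ u (L φ v A)) (L φ w (L φ s A)))) := by
  rw [psiA, hφ.L_L w s, hφ.L_L u v (L φ s A)]
  simp only [map_sub, map_neg, map_smul, LinearMap.sub_apply, LinearMap.neg_apply,
    LinearMap.smul_apply, smul_eq_mul, hφ.oip_L_L]
  rw [hφ.oip_L s, hφ.oip_L u (L φ v A) A, oip_comm (L φ v A), hφ.oip_L_L, real_inner_comm w s]
  ring

lemma IsVectorCross.phiA_one (hφ : IsVectorCross φ) (u v w : V) :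
    phiA φ ((1, 0) : Oct V) u v w = φ u v w := by
  have h0 : ∀ u, cross (form φ) u 0 = 0 := fun u => by
    simpa using cross_smul_right φ 0 u 0
  have h : ∀ u, L φ u ((1, 0) : Oct V) = (0, u) := fun u => by
    ext1
    · rw [L_fst]; exact neg_eq_zero.mpr (inner_zero_right u)
    · rw [L_snd]; simp [h0]
  rw [phiA, h, h, oip_apply, L_snd, normSq]
  simp [inner_cross]

/-- The contraction `ψ_{sijk} ψ_v^{ijk} = 24 g_{sv}`. -/
lemma IsVectorCross.sum_psiA_mul_psiA {ι : Type*} [Fintype ι] (hφ : IsVectorCross φ)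
    (e : OrthonormalBasis ι ℝ V) (hι : Fintype.card ι = 7) {A : Oct V} (hA : A ≠ 0) (s v : V) :
    ∑ i, ∑ j, ∑ k, psiA φ A s (e i) (e j) (e k) * psiA φ A v (e i) (e j) (e k)
      = 24 * inner ℝ s v := by
  set N := oip A A with hN
  have hN0 : N ≠ 0 := by rw [hN, oip_self]; exact (normSq_pos hA).ne'
  set Z : V → ι → ι → Oct V := fun s i j =>
    L φ s (L φ (e i) (L φ (e j) A)) - L φ (e j) (L φ (e i) (L φ s A)) with hZ
  -- Parseval in the basis A, e_k A performs the sum over `k`; the missing direction A gives the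
  -- subtracted product.
  have h1 : ∀ i j, ∑ k, psiA φ A s (e i) (e j) (e k) * psiA φ A v (e i) (e j) (e k)
      = (N ^ 2)⁻¹ * (1 / 4) * (N * oip (Z s i j) (Z v i j) - oip A (Z s i j) * oip A (Z v i j)) := by
    intro i j
    rw [hN, ← hφ.sum_oip e, Finset.mul_sum]
    refine Finset.sum_congr rfl fun k _ => ?_
    simp only [psiA, hZ, ← oip_self]
    rw [oip_comm (L φ (e k) A), oip_comm (L φ (e k) A)]
    field_simp
    ring
  -- All Clifford factors are moved to the right-hand entry, where the sums over `i` and `j` become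
  -- operator identities.
  have h2 : ∀ i j, oip (Z s i j) (Z v i j) = oip A (
      - L φ (e j) (L φ (e i) (L φ s (L φ v (L φ (e i) (L φ (e j) A)))))
      + L φ (e j) (L φ (e i) (L φ s (L φ (e j) (L φ (e i) (L φ v A)))))
      + L φ s (L φ (e i) (L φ (e j) (L φ v (L φ (e i) (L φ (e j) A)))))
      - L φ s (L φ (e i) (L φ (e j) (L φ (e j) (L φ (e i) (L φ v A)))))) := by
    intro i j
    simp only [hZ, map_sub, LinearMap.sub_apply, map_neg, map_add, hφ.oip_L, neg_neg]
    ring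
  have h3 : ∑ i, ∑ j, oip (Z s i j) (Z v i j) = 120 * inner ℝ s v * N := by
    have S1 : ∑ i, ∑ j, L φ (e j) (L φ (e i) (L φ s (L φ v (L φ (e i) (L φ (e j) A)))))
        = (9 : ℝ) • L φ s (L φ v A) - (40 * inner ℝ s v) • A := by
      rw [Finset.sum_comm]
      simp only [← map_sum, hφ.sum_L_L_L_L e hι, map_add, map_smul, Finset.sum_add_distrib,
        ← Finset.smul_sum, hφ.sum_L_L, hι]
      push_cast
      module
    have S2 : ∑ i, ∑ j, L φ (e j) (L φ (e i) (L φ s (L φ (e j) (L φ (e i) (L φ v A)))))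
        = (-11 : ℝ) • L φ s (L φ v A) := by
      simp only [hφ.sum_L_L_L_L e hι, Finset.sum_add_distrib, ← Finset.smul_sum, hφ.sum_L_L_L e hι,
        mul_smul, sum_inner_L]
      module
    have S3 : ∑ i, ∑ j, L φ s (L φ (e i) (L φ (e j) (L φ v (L φ (e i) (L φ (e j) A)))))
        = (-11 : ℝ) • L φ s (L φ v A) := by
      rw [Finset.sum_comm]
      simp only [← map_sum, hφ.sum_L_L_L_L e hι, Finset.sum_add_distrib, ← Finset.smul_sum,
        hφ.sum_L_L_L e hι, mul_smul, sum_inner_L]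
      simp only [map_add, map_smul]
      module
    have S4 : ∑ i, ∑ j, L φ s (L φ (e i) (L φ (e j) (L φ (e j) (L φ (e i) (L φ v A)))))
        = (49 : ℝ) • L φ s (L φ v A) := by
      simp only [← map_sum, hφ.sum_L_L, hι, map_smul, ← Finset.smul_sum]
      push_cast
      module
    have hs : oip A (L φ s (L φ v A)) = -(inner ℝ s v * N) := by
      rw [← hφ.oip_L_L, hφ.oip_L, neg_neg]
    have T1 := congrArg (oip A) S1
    have T2 := congrArg (oip A) S2
    have T3 := congrArg (oip A) S3
    have T4 := congrArg (oip A) S4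
    simp only [map_sum, map_sub, map_smul, hs, smul_eq_mul, ← hN] at T1 T2 T3 T4
    simp only [h2, map_sub, map_neg, map_add, Finset.sum_sub_distrib, Finset.sum_add_distrib,
      Finset.sum_neg_distrib, T1, T2, T3, T4]
    ring
  have h4 : ∑ i, ∑ j, oip A (Z s i j) * oip A (Z v i j) = 24 * inner ℝ s v * N ^ 2 := by
    have hZA : ∀ s i j, oip A (Z s i j) = 2 * oip (L φ (e j) A) (L φ (e i) (L φ s A)) := by
      intro s i j
      have key : ∀ x B C, oip B (L φ x C) = -oip (L φ x B) C := fun x B C => by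
        rw [hφ.oip_L, neg_neg]
      simp only [hZ, map_sub]
      rw [key s, key (e i), key (e j) A, oip_comm (L φ (e i) _)]
      ring
    have : ∀ i, ∑ j, oip A (Z s i j) * oip A (Z v i j)
        = 4 * N ^ 2 * inner ℝ s v - 4 * N ^ 2 * (inner ℝ s (e i) * inner ℝ (e i) v) := by
      intro i
      have hp : ∑ j, oip A (Z s i j) * oip A (Z v i j) = 4 * ∑ j,
          oip (L φ (e j) A) (L φ (e i) (L φ s A)) * oip (L φ (e j) A) (L φ (e i) (L φ v A)) := by
        rw [Finset.mul_sum]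
        exact Finset.sum_congr rfl fun j _ => by rw [hZA, hZA]; ring
      have hq : ∀ x, oip A (L φ (e i) (L φ x A)) = -(inner ℝ (e i) x * N) := fun x => by
        rw [← hφ.oip_L_L, hφ.oip_L, neg_neg]
      rw [hp, hφ.sum_oip e, hφ.oip_L_L_same, hφ.oip_L_L, hq, hq, real_inner_comm s (e i),
        real_inner_self_eq_norm_sq, e.norm_eq_one]
      ring
    simp only [this, Finset.sum_sub_distrib, Finset.sum_const, Finset.card_univ, hι,
      ← Finset.mul_sum, e.sum_inner_mul_inner]
    simp
    ring
  -- The total is (120 - 24)/4 = 24.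
  simp only [h1, ← Finset.mul_sum, Finset.sum_sub_distrib, h3, h4]
  field_simp
  ring

end Pointwise

/-! ### The standard 3-form and cross product in coordinates. -/

/-- The value of `dx^a ∧ dx^b ∧ dx^c` on three vectors of `ℝ⁷`. -/
def minor3 (a b c : Fin 7) (x y z : Fin 7 → ℝ) : ℝ :=
  x a * y b * z c + x c * y a * z b + x b * y c * z a
    - x a * y c * z b - x b * y a * z c - x c * y b * z a

lemma sum_wedge3 (a b c : Fin 7) (x y z : Fin 7 → ℝ) :
    ∑ i, ∑ j, ∑ k, x i * y j * z k * (wedge3 a b c i j k : ℝ) = minor3 a b c x y z := by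
  simp only [wedge3, minor3]
  push_cast
  simp only [mul_sub, mul_add, Finset.sum_add_distrib, Finset.sum_sub_distrib, mul_ite, mul_one,
    mul_zero, Finset.sum_ite_eq, Finset.mem_univ, if_true,
    Finset.sum_ite_irrel, Finset.sum_const_zero]

/-- The standard `G₂` 3-form in coordinates. -/
def stdForm (x y z : Fin 7 → ℝ) : ℝ :=
  minor3 0 1 2 x y z + minor3 0 3 4 x y z + minor3 0 5 6 x y z + minor3 1 3 5 x y z
    - minor3 1 4 6 x y z - minor3 2 3 6 x y z - minor3 2 4 5 x y z

lemma sum_phi0 (x y z : Fin 7 → ℝ) :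
    ∑ i, ∑ j, ∑ k, x i * y j * z k * (phi0 i j k : ℝ) = stdForm x y z := by
  simp only [phi0, stdForm, ← sum_wedge3]
  push_cast
  simp only [mul_sub, mul_add, Finset.sum_add_distrib, Finset.sum_sub_distrib]

/-- The standard cross product in coordinates. -/
def stdCross (x y : Fin 7 → ℝ) : Fin 7 → ℝ :=
  ![x 1 * y 2 - x 2 * y 1 + (x 3 * y 4 - x 4 * y 3) + (x 5 * y 6 - x 6 * y 5),
    x 2 * y 0 - x 0 * y 2 + (x 3 * y 5 - x 5 * y 3) - (x 4 * y 6 - x 6 * y 4),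
    x 0 * y 1 - x 1 * y 0 - (x 3 * y 6 - x 6 * y 3) - (x 4 * y 5 - x 5 * y 4),
    x 4 * y 0 - x 0 * y 4 + (x 5 * y 1 - x 1 * y 5) - (x 6 * y 2 - x 2 * y 6),
    x 0 * y 3 - x 3 * y 0 - (x 6 * y 1 - x 1 * y 6) - (x 5 * y 2 - x 2 * y 5),
    x 6 * y 0 - x 0 * y 6 + (x 1 * y 3 - x 3 * y 1) - (x 2 * y 4 - x 4 * y 2),
    x 0 * y 5 - x 5 * y 0 - (x 1 * y 4 - x 4 * y 1) - (x 2 * y 3 - x 3 * y 2)]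

lemma stdForm_eq (x y z : Fin 7 → ℝ) : stdForm x y z = ∑ k, stdCross x y k * z k := by
  simp [stdForm, minor3, Fin.sum_univ_seven, stdCross]
  ring

set_option maxRecDepth 4000 in
lemma sum_stdCross_sq (x y : Fin 7 → ℝ) :
    ∑ k, stdCross x y k * stdCross x y k
      = (∑ k, x k * x k) * (∑ k, y k * y k) - (∑ k, x k * y k) ^ 2 := by
  simp only [Fin.sum_univ_seven]
  simp only [stdCross, Matrix.cons_val]
  ring

/-! ### Adapted frames and the volume element. -/

section Pointwise

variable {V : Type*} [NormedAddCommGroup V] [InnerProductSpace ℝ V] [FiniteDimensional ℝ V]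
variable {φ : V →ₗ[ℝ] V →ₗ[ℝ] V →ₗ[ℝ] ℝ}

/-- An orthonormal frame in which `φ` is the standard 3-form. -/
def IsAdapted (φ : V →ₗ[ℝ] V →ₗ[ℝ] V →ₗ[ℝ] ℝ) (e : OrthonormalBasis (Fin 7) ℝ V) : Prop :=
  ∀ i j k, φ (e i) (e j) (e k) = (phi0 i j k : ℝ)

variable {e : OrthonormalBasis (Fin 7) ℝ V}

lemma trilinear_apply (φ : V →ₗ[ℝ] V →ₗ[ℝ] V →ₗ[ℝ] ℝ) (e : OrthonormalBasis (Fin 7) ℝ V)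
    (u v w : V) :
    φ u v w = ∑ i, ∑ j, ∑ k, inner ℝ (e i) u * inner ℝ (e j) v * inner ℝ (e k) w
      * φ (e i) (e j) (e k) := by
  have h1 := sum_inner_smul e ((φ.flip v).flip w) u
  have h2 := fun i => sum_inner_smul e ((φ (e i)).flip w) v
  have h3 := fun i j => sum_inner_smul e (φ (e i) (e j)) w
  simp only [LinearMap.flip_apply, smul_eq_mul] at h1 h2 h3
  simp only [← h1, ← h2, ← h3, Finset.mul_sum, mul_assoc]

lemma IsAdapted.apply_eq (h : IsAdapted φ e) (u v w : V) :
    φ u v w = stdForm (fun i => inner ℝ (e i) u) (fun i => inner ℝ (e i) v)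
      (fun i => inner ℝ (e i) w) := by
  rw [trilinear_apply φ e, ← sum_phi0]
  simp only [h _ _ _]

lemma inner_eq_sum (e : OrthonormalBasis (Fin 7) ℝ V) (u v : V) :
    inner ℝ u v = ∑ i, inner ℝ (e i) u * inner ℝ (e i) v := by
  rw [← e.sum_inner_mul_inner u v]
  exact Finset.sum_congr rfl fun i _ => by rw [real_inner_comm u]

lemma IsAdapted.inner_cross (h : IsAdapted φ e) (k : Fin 7) (u v : V) :
    inner ℝ (e k) (cross (form φ) u v)
      = stdCross (fun i => inner ℝ (e i) u) (fun i => inner ℝ (e i) v) k := by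
  rw [real_inner_comm, G2Flux.inner_cross, h.apply_eq, stdForm_eq]
  simp [e.inner_eq_ite]

lemma IsAdapted.isVectorCross (h : IsAdapted φ e) : IsVectorCross φ where
  alt_left u v := by rw [h.apply_eq, stdForm]; simp only [minor3]; ring
  alt_right u v := by rw [h.apply_eq, stdForm]; simp only [minor3]; ring
  norm_cross u v := by
    rw [inner_eq_sum e, inner_eq_sum e u u, inner_eq_sum e v v, inner_eq_sum e u v]
    simp only [h.inner_cross, sum_stdCross_sq]

lemma L_one (φ : V →ₗ[ℝ] V →ₗ[ℝ] V →ₗ[ℝ] ℝ) (u : V) : L φ u ((1, 0) : Oct V) = (0, u) := by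
  have h0 : cross (form φ) u 0 = 0 := by simpa using cross_smul_right φ 0 u 0
  ext1
  · rw [L_fst]; exact neg_eq_zero.mpr (inner_zero_right u)
  · rw [L_snd]; simp [h0]

/-- The product of the seven vectors of an adapted frame acts as the identity. -/
lemma IsAdapted.volume_smul (h : IsAdapted φ e) (B : Oct V) :
    L φ (e 0) (L φ (e 1) (L φ (e 2) (L φ (e 3) (L φ (e 4) (L φ (e 5) (L φ (e 6) B)))))) = B := by
  have hφ := h.isVectorCross
  have hc : ∀ i j k : Fin 7, i ≠ j → (∀ l, phi0 i j l = if k = l then 1 else 0) →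
      L φ (e i) ((0, e j) : Oct V) = (0, e k) := fun i j k hij hl => by
    ext1
    · rw [L_fst]; simp [e.inner_eq_ite, hij]
    · rw [L_snd]
      simp only [zero_smul, zero_add]
      refine InnerProductSpace.ext_inner_right_basis (𝕜 := ℝ) e.toBasis fun l => ?_
      rw [e.coe_toBasis, G2Flux.inner_cross, h, hl, e.inner_eq_ite]
      simp
  have hs : ∀ i, L φ (e i) ((0, e i) : Oct V) = -(1, 0) := fun i => by
    rw [← L_one φ, hφ.L_L_self]; simp
  set x : Fin 7 → Module.End ℝ (Oct V) := fun i => L φ (e i) with hx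
  set P := x 0 * (x 1 * (x 2 * (x 3 * (x 4 * (x 5 * x 6))))) with hP
  change P B = B
  have h1 : P (1, 0) = (1, 0) := by
    simp only [hP, hx, Module.End.mul_apply]
    rw [L_one, hc 5 6 0 (by decide) (by decide), hc 4 0 3 (by decide) (by decide), hs, map_neg,
      L_one, map_neg, hc 1 2 0 (by decide) (by decide), map_neg, hs, neg_neg]
  -- Each frame vector anticommutes with six of the factors of P and commutes with the seventh, so P
  -- is central. Being central and fixing 1, it fixes every v·1.
  have hcomm : ∀ k, x k * P = P * x k := by
    intro k
    have s : ∀ j, SemiconjBy (x k) (x j) (if j = k then x j else -x j) := by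
      intro j
      split_ifs with hj
      · subst hj; rfl
      · refine LinearMap.ext fun C => ?_
        change L φ (e k) (L φ (e j) C) = (-(L φ (e j))) (L φ (e k) C)
        rw [hφ.L_L, e.inner_eq_ite, if_neg (Ne.symm hj)]
        simp
    have := (s 0).mul_right ((s 1).mul_right ((s 2).mul_right ((s 3).mul_right
      ((s 4).mul_right ((s 5).mul_right (s 6))))))
    have h2 := this.eq
    rw [← hP] at h2
    rw [h2]
    congr 1
    fin_cases k <;> refine LinearMap.ext fun C => ?_ <;> simp [hP, Module.End.mul_apply]
  obtain ⟨b, v, rfl⟩ := hφ.exists_eq (X := ((1, 0) : Oct V)) (by simp) B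
  rw [map_add, map_smul, h1, ← e.sum_repr' v, map_sum, LinearMap.sum_apply, map_sum]
  congr 1
  refine Finset.sum_congr rfl fun k _ => ?_
  rw [map_smul, LinearMap.smul_apply, map_smul]
  have := congrArg (fun f : Module.End ℝ (Oct V) => f (1, 0)) (hcomm k)
  simp only [Module.End.mul_apply, h1] at this
  rw [← this]

end Pointwise

/-! ### Hodge duality through the Clifford volume element. -/

section Pointwise

variable {V : Type*} [NormedAddCommGroup V] [InnerProductSpace ℝ V] [FiniteDimensional ℝ V]
variable {φ : V →ₗ[ℝ] V →ₗ[ℝ] V →ₗ[ℝ] ℝ} {e : OrthonormalBasis (Fin 7) ℝ V}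

/-- The product of seven vectors in the Clifford algebra, acting on octonions. -/
noncomputable def L7 (φ : V →ₗ[ℝ] V →ₗ[ℝ] V →ₗ[ℝ] ℝ) (v : Fin 7 → V) (B : Oct V) : Oct V :=
  L φ (v 0) (L φ (v 1) (L φ (v 2) (L φ (v 3) (L φ (v 4) (L φ (v 5) (L φ (v 6) B))))))

lemma IsVectorCross.L_anticomm (hφ : IsVectorCross φ) {ι : Type*} [Fintype ι]
    (e : OrthonormalBasis ι ℝ V) {i j : ι} (hij : i ≠ j) (B : Oct V) :
    L φ (e i) (L φ (e j) B) = -L φ (e j) (L φ (e i) B) := by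
  classical
  rw [hφ.L_L, e.inner_eq_ite, if_neg hij]; simp

lemma IsVectorCross.L7_swap (hφ : IsVectorCross φ) (e : OrthonormalBasis (Fin 7) ℝ V)
    {s : Fin 7 → Fin 7} (hs : Function.Injective s) (i : Fin 6) (B : Oct V) :
    L7 φ (fun j => e (s (Equiv.swap i.castSucc i.succ j))) B = -L7 φ (fun j => e (s j)) B := by
  have h : ∀ a b : Fin 7, a ≠ b → ∀ B, L φ (e (s a)) (L φ (e (s b)) B)
      = -L φ (e (s b)) (L φ (e (s a)) B) := fun a b hab B => hφ.L_anticomm e (hs.ne hab) B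
  have key : ∀ a b : Fin 7, ∀ j, Equiv.swap a b j = if j = a then b else if j = b then a else j :=
    fun a b j => Equiv.swap_apply_def a b j
  fin_cases i <;> simp only [L7, key, Fin.reduceFinMk, Fin.reduceCastSucc, Fin.reduceSucc,
    Fin.reduceEq, if_true, if_false, Fin.zero_eta, Fin.isValue]
  · rw [h 1 0 (by decide)]
  · rw [h 2 1 (by decide)]; simp only [map_neg]
  · rw [h 3 2 (by decide)]; simp only [map_neg]
  · rw [h 4 3 (by decide)]; simp only [map_neg]
  · rw [h 5 4 (by decide)]; simp only [map_neg]
  · rw [h 6 5 (by decide)]; simp only [map_neg]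

/-- Adjacent transpositions generate the symmetric group, and each one changes the sign by
anticommutation. -/
lemma IsAdapted.L7_perm (h : IsAdapted φ e) (σ : Equiv.Perm (Fin 7)) :
    ∀ B, L7 φ (fun j => e (σ j)) B = ((Equiv.Perm.sign σ : ℤ) : ℝ) • B := by
  have hσ : σ ∈ Submonoid.closure (Set.range fun i : Fin 6 => Equiv.swap i.castSucc i.succ) := by
    rw [Equiv.Perm.mclosure_swap_castSucc_succ]; trivial
  induction hσ using Submonoid.closure_induction_right with
  | one => intro B; simpa [L7] using h.volume_smul B
  | mul_right τ _ y hy ih =>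
    obtain ⟨i, rfl⟩ := hy
    intro B
    have := h.isVectorCross.L7_swap e τ.injective i B
    simp only [Equiv.Perm.mul_apply, this, ih, Equiv.Perm.sign_mul,
      Equiv.Perm.sign_swap (Fin.castSucc_lt_succ (i := i)).ne]
    simp

variable [Fact (Module.finrank ℝ V = 7)] {o : Orientation ℝ V (Fin 7)}

lemma IsAdapted.L7_eq_volumeForm (h : IsAdapted φ e) (he : e.toBasis.orientation = o)
    {s : Fin 7 → Fin 7} (hs : Function.Injective s) (B : Oct V) :
    L7 φ (fun j => e (s j)) B = o.volumeForm (fun j => e (s j)) • B := by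
  obtain ⟨σ, rfl⟩ : ∃ σ : Equiv.Perm (Fin 7), s = σ :=
    ⟨Equiv.ofBijective s hs.bijective_of_finite, rfl⟩
  rw [h.L7_perm, o.volumeForm_robust e he]
  have h2 := e.toBasis.det.map_perm (fun j => e j) σ
  have h3 : e.toBasis.det (fun j => e j) = 1 := by
    rw [← e.coe_toBasis, e.toBasis.det_self]
  rw [h3] at h2
  change _ = e.toBasis.det ((fun j => e j) ∘ σ) • B
  rw [h2, Units.smul_def, zsmul_eq_mul, mul_one]

lemma volumeForm_eq_zero (o : Orientation ℝ V (Fin 7)) (e : OrthonormalBasis (Fin 7) ℝ V)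
    {s : Fin 7 → Fin 7} (hs : ¬ Function.Injective s) :
    o.volumeForm (fun j => e (s j)) = 0 :=
  AlternatingMap.map_eq_zero_of_not_injective _ _ fun h => hs fun _ _ hab => h (by simp [hab])

/-- Four distinct indices are completed to all seven by 3! ordered triples; this 6 cancels the 1/6
in `hodge`. -/
lemma sum_injective_eq {a b c d : Fin 7} (h : [a, b, c, d].Nodup) (x : ℝ)
    (g : Fin 7 → Fin 7 → Fin 7 → ℝ)
    (h1 : ∀ i j k, Function.Injective ![i, j, k, a, b, c, d] → g i j k = x)
    (h2 : ∀ i j k, ¬ Function.Injective ![i, j, k, a, b, c, d] → g i j k = 0) :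
    ∑ i, ∑ j, ∑ k, g i j k = 6 * x := by
  set S : Finset (Fin 7) := {a, b, c, d} with hS
  have hcard : S.card = 4 := by
    have := List.toFinset_card_of_nodup h
    simpa [hS] using this
  have hinj : ∀ i j k, Function.Injective ![i, j, k, a, b, c, d] ↔
      (k ∉ S ∧ j ∉ insert k S ∧ i ∉ insert j (insert k S)) := by
    intro i j k
    rw [← List.nodup_ofFn]
    have : List.ofFn ![i, j, k, a, b, c, d] = [i, j, k, a, b, c, d] := by simp [List.ofFn_succ]
    rw [this, List.nodup_cons, List.nodup_cons, List.nodup_cons]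
    simp only [h, and_true, hS, List.mem_cons, List.not_mem_nil, or_false, Finset.mem_insert,
      Finset.mem_singleton]
    tauto
  have hg : ∀ i j k, g i j k = if k ∉ S then (if j ∉ insert k S then
      (if i ∉ insert j (insert k S) then x else 0) else 0) else 0 := by
    intro i j k
    by_cases hi : Function.Injective ![i, j, k, a, b, c, d]
    · rw [h1 i j k hi]
      obtain ⟨ha, hb, hc⟩ := (hinj i j k).mp hi
      simp only [ha, hb, hc, not_false_eq_true, if_true]
    · rw [h2 i j k hi]
      rw [hinj] at hi
      split_ifs <;> tauto
  have hc1 : ∀ T : Finset (Fin 7), ∀ y : ℝ, ∑ i, (if i ∉ T then y else 0) = (7 - T.card : ℝ) * y := by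
    intro T y
    rw [← Finset.sum_filter, Finset.sum_const, nsmul_eq_mul]
    congr 1
    rw [Finset.filter_not, Finset.filter_mem_eq_inter, Finset.univ_inter, ← Finset.compl_eq_univ_sdiff,
      Finset.card_compl, Nat.cast_sub (by simpa using Finset.card_le_univ T)]
    simp
  have hj : ∀ k, k ∉ S → ∀ j, j ∉ insert k S → ∑ i, (if i ∉ insert j (insert k S) then x else 0) = x := by
    intro k hk j hj
    rw [hc1, Finset.card_insert_of_notMem hj, Finset.card_insert_of_notMem hk, hcard]
    norm_num
  have hk : ∀ k, k ∉ S → ∑ j, ∑ i, (if j ∉ insert k S then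
      (if i ∉ insert j (insert k S) then x else 0) else 0) = 2 * x := by
    intro k hk
    have : ∀ j, ∑ i, (if j ∉ insert k S then
      (if i ∉ insert j (insert k S) then x else 0) else 0) = if j ∉ insert k S then x else 0 := by
      intro j
      by_cases hjk : j ∉ insert k S
      · simp only [if_pos hjk]; exact hj k hk j hjk
      · simp only [if_neg hjk, Finset.sum_const_zero]
    simp only [this]
    rw [hc1, Finset.card_insert_of_notMem hk, hcard]
    norm_num
  have hfin : ∀ k, ∑ j, ∑ i, g i j k = if k ∉ S then 2 * x else 0 := by
    intro k
    simp only [hg]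
    by_cases hkS : k ∉ S
    · simp only [if_pos hkS]; exact hk k hkS
    · simp only [if_neg hkS, Finset.sum_const_zero]
  calc ∑ i, ∑ j, ∑ k, g i j k = ∑ k, ∑ j, ∑ i, g i j k := by
        rw [Finset.sum_comm]
        conv_lhs => enter [2, j]; rw [Finset.sum_comm]
        rw [Finset.sum_comm]
    _ = _ := by
        simp only [hfin]
        rw [hc1, hcard]
        norm_num
        ring

lemma IsVectorCross.psiA_of_distinct (hφ : IsVectorCross φ) (A : Oct V)
    {a b c d : Fin 7} (h : [a, b, c, d].Nodup) :
    psiA φ A (e a) (e b) (e c) (e d) = -(normSq A)⁻¹ *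
      oip A (L φ (e a) (L φ (e b) (L φ (e c) (L φ (e d) A)))) := by
  simp only [List.nodup_cons, List.mem_cons, List.not_mem_nil, not_or, or_false] at h
  obtain ⟨⟨hab, hac, had⟩, ⟨hbc, hbd⟩, hcd, -⟩ := h
  have r : ∀ {x y : Fin 7}, x ≠ y → ∀ B, L φ (e x) (L φ (e y) B) = -L φ (e y) (L φ (e x) B) :=
    fun hxy B => hφ.L_anticomm e hxy B
  rw [psiA, r (Ne.symm hbc) (L φ (e a) A), r (Ne.symm hac) A, map_neg, neg_neg,
    r (Ne.symm hab) (L φ (e c) A), sub_neg_eq_add, oip_comm, hφ.oip_L, map_add,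
    r (Ne.symm had), r (Ne.symm hbd), map_neg, neg_neg, r (Ne.symm hcd), map_neg, map_neg]
  simp only [map_neg, map_add]
  ring

/-- Seven distinct frame vectors multiply to the scalar vol = ±1. Hence the product of the last four
acting on A is determined by that of the first three, and Hodge duality becomes a Clifford identity.
-/
lemma IsVectorCross.phiA_mul_volumeForm (h : IsAdapted φ e) (he : e.toBasis.orientation = o)
    (A : Oct V) {i j k a b c d : Fin 7} (hs : Function.Injective ![i, j, k, a, b, c, d]) :
    phiA φ A (e i) (e j) (e k) * o.volumeForm ![e i, e j, e k, e a, e b, e c, e d]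
      = psiA φ A (e a) (e b) (e c) (e d) := by
  have hφ := h.isVectorCross
  have hvol := h.L7_eq_volumeForm he hs A
  have hv : (fun l => e (![i, j, k, a, b, c, d] l)) = ![e i, e j, e k, e a, e b, e c, e d] := by
    funext l; fin_cases l <;> rfl
  have hnd : [i, j, k, a, b, c, d].Nodup := by
    rw [← List.nodup_ofFn] at hs
    simpa [List.ofFn_succ] using hs
  have hnd2 : [a, b, c, d].Nodup := by
    simp only [List.nodup_cons] at hnd ⊢
    tauto
  simp only [List.nodup_cons, List.mem_cons, not_or] at hnd
  have hij : i ≠ j := hnd.1.1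
  have hik : i ≠ k := hnd.1.2.1
  have hjk : j ≠ k := hnd.2.1.1
  have r : ∀ {x y : Fin 7}, x ≠ y → ∀ B, L φ (e x) (L φ (e y) B) = -L φ (e y) (L φ (e x) B) :=
    fun hxy B => hφ.L_anticomm e hxy B
  rw [hv] at hvol
  set vol := o.volumeForm ![e i, e j, e k, e a, e b, e c, e d]
  set C := L φ (e a) (L φ (e b) (L φ (e c) (L φ (e d) A))) with hC
  have h7 : L φ (e i) (L φ (e j) (L φ (e k) C)) = vol • A := hvol
  have h8 : L φ (e k) (vol • A) = -L φ (e i) (L φ (e j) C) := by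
    rw [← h7, r (Ne.symm hik), r (Ne.symm hjk), map_neg, neg_neg, hφ.L_L_self]
    simp
  rw [hφ.psiA_of_distinct A hnd2, ← hC, phiA, mul_assoc, mul_comm _ vol, ← smul_eq_mul vol,
    ← map_smul, ← map_smul, h8, map_neg, hφ.oip_L_L_same, hφ.oip_L_L_same, e.inner_eq_ite,
    e.inner_eq_ite]
  simp

/-- `psiA` vanishes when two of its arguments coincide. -/
lemma IsVectorCross.psiA_eq_zero (hφ : IsVectorCross φ) (A : Oct V) {a b c d : V}
    (h : a = b ∨ a = c ∨ a = d ∨ b = c ∨ b = d ∨ c = d) : psiA φ A a b c d = 0 := by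
  have h1 : ∀ a b, oip (L φ a (L φ b A)) A = -(inner ℝ a b * oip A A) := fun a b => by
    rw [hφ.oip_L, oip_comm, hφ.oip_L_L, real_inner_comm]
  have h2 : ∀ a b c, oip (L φ a (L φ b (L φ c A))) (L φ b A)
      = (inner ℝ b b * inner ℝ c a - 2 * inner ℝ a b * inner ℝ b c) * oip A A := fun a b c => by
    rw [hφ.oip_L a, hφ.L_L a b A, map_sub, map_neg, map_smul, hφ.oip_L_L_same, hφ.oip_L_L, h1,
      smul_eq_mul]
    ring
  have h3 : ∀ a b c, oip (L φ c (L φ b (L φ a A))) (L φ a A)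
      = -(inner ℝ a a * inner ℝ b c * oip A A) := fun a b c => by
    rw [hφ.oip_L c, hφ.L_L c a A, map_sub, map_neg, map_smul, h1, hφ.L_L b a A]
    simp only [map_sub, map_neg, map_smul, LinearMap.sub_apply, LinearMap.neg_apply,
      LinearMap.smul_apply, smul_eq_mul, hφ.oip_L_L_same, hφ.oip_L_L]
    rw [oip_comm A (L φ a (L φ c A)), h1, real_inner_comm a b, real_inner_comm a c]
    ring
  rw [psiA]
  suffices oip (L φ a (L φ b (L φ c A)) - L φ c (L φ b (L φ a A))) (L φ d A) = 0 by
    rw [this]; simp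
  rw [map_sub, LinearMap.sub_apply]
  rcases h with rfl | rfl | rfl | rfl | rfl | rfl
  · simp [hφ.L_L_self]
  · simp
  · rw [h3, hφ.oip_L_L_same, h1]; ring
  · simp [hφ.L_L_self]
  · rw [h2, h2, real_inner_comm a b, real_inner_comm c b, real_inner_comm a c]; ring
  · rw [h3, hφ.oip_L_L_same, h1, real_inner_comm a b]; ring

lemma isLinearMap_volumeForm (o : Orientation ℝ V (Fin 7)) {m : V → Fin 7 → V} (i : Fin 7)
    (hm : ∀ x, m x = Function.update (m 0) i x) : IsLinearMap ℝ fun x => o.volumeForm (m x) := by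
  have : (fun x => o.volumeForm (m x)) =
      fun x => o.volumeForm.toMultilinearMap.toLinearMap (m 0) i x := by
    funext x
    rw [hm x]
    rfl
  rw [this]
  exact LinearMap.isLinear _

lemma isLinearMap_phiA₁ (A : Oct V) (v w : V) : IsLinearMap ℝ fun u => phiA φ A u v w :=
  ⟨fun x y => by simp [phiA, mul_add], fun c x => by simp [phiA]; ring⟩

lemma isLinearMap_phiA₂ (A : Oct V) (u w : V) : IsLinearMap ℝ fun v => phiA φ A u v w :=
  ⟨fun x y => by simp [phiA, mul_add], fun c x => by simp [phiA]; ring⟩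

lemma isLinearMap_phiA₃ (A : Oct V) (u v : V) : IsLinearMap ℝ fun w => phiA φ A u v w :=
  ⟨fun x y => by simp [phiA, mul_add], fun c x => by simp [phiA]; ring⟩

lemma isLinearMap_psiA₁ (A : Oct V) (b c d : V) : IsLinearMap ℝ fun a => psiA φ A a b c d :=
  ⟨fun x y => by simp [psiA]; ring, fun r x => by simp [psiA]; ring⟩

lemma isLinearMap_psiA₂ (A : Oct V) (a c d : V) : IsLinearMap ℝ fun b => psiA φ A a b c d :=
  ⟨fun x y => by simp [psiA]; ring, fun r x => by simp [psiA]; ring⟩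

lemma isLinearMap_psiA₃ (A : Oct V) (a b d : V) : IsLinearMap ℝ fun c => psiA φ A a b c d :=
  ⟨fun x y => by simp [psiA]; ring, fun r x => by simp [psiA]; ring⟩

lemma isLinearMap_psiA₄ (A : Oct V) (a b c : V) : IsLinearMap ℝ fun d => psiA φ A a b c d :=
  ⟨fun x y => by simp [psiA]; ring, fun r x => by simp [psiA]; ring⟩

lemma IsVectorCross.psiA_swap₂₃ (hφ : IsVectorCross φ) (A : Oct V) (a b c d : V) :
    psiA φ A a b c d = -psiA φ A a c b d := by
  have h := hφ.psiA_eq_zero A (a := a) (b := b + c) (c := b + c) (d := d) (by simp)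
  rw [(isLinearMap_psiA₂ A a (b + c) d).map_add, (isLinearMap_psiA₃ A a b d).map_add,
    (isLinearMap_psiA₃ A a c d).map_add, hφ.psiA_eq_zero A (by simp),
    hφ.psiA_eq_zero A (b := c) (c := c) (by simp)] at h
  linarith

lemma IsVectorCross.psiA_swap₃₄ (hφ : IsVectorCross φ) (A : Oct V) (a b c d : V) :
    psiA φ A a b c d = -psiA φ A a b d c := by
  have h := hφ.psiA_eq_zero A (a := a) (b := b) (c := c + d) (d := c + d) (by simp)
  rw [(isLinearMap_psiA₃ A a b (c + d)).map_add, (isLinearMap_psiA₄ A a b c).map_add,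
    (isLinearMap_psiA₄ A a b d).map_add, hφ.psiA_eq_zero A (by simp),
    hφ.psiA_eq_zero A (c := d) (d := d) (by simp)] at h
  linarith

/-- The metric contraction of a bilinear form does not depend on the orthonormal basis. -/
lemma sum_bilin_eq {ι κ : Type*} [Fintype ι] [Fintype κ] (b : OrthonormalBasis ι ℝ V)
    (e : OrthonormalBasis κ ℝ V) (F : V → V → ℝ)
    (h1 : ∀ y, IsLinearMap ℝ fun x => F x y) (h2 : ∀ x, IsLinearMap ℝ fun y => F x y) :
    ∑ i, F (b i) (b i) = ∑ j, F (e j) (e j) := by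
  have hx : ∀ i, F (b i) (b i) = ∑ j, inner ℝ (e j) (b i) * F (e j) (b i) := fun i => by
    have := sum_inner_smul e (h1 (b i)).mk' (b i)
    simpa using this.symm
  have hy : ∀ j, ∑ i, inner ℝ (e j) (b i) * F (e j) (b i) = F (e j) (e j) := fun j => by
    have := sum_inner_smul b (h2 (e j)).mk' (e j)
    rw [← show (h2 (e j)).mk' _ (e j) = F (e j) (e j) from rfl, ← this]
    refine Finset.sum_congr rfl fun i _ => ?_
    rw [real_inner_comm]; rfl
  simp only [hx]
  rw [Finset.sum_comm]
  simp only [hy]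

lemma sum_trilin_eq {ι κ : Type*} [Fintype ι] [Fintype κ] (b : OrthonormalBasis ι ℝ V)
    (e : OrthonormalBasis κ ℝ V) (F G : V → V → V → ℝ)
    (hF1 : ∀ y z, IsLinearMap ℝ fun x => F x y z) (hF2 : ∀ x z, IsLinearMap ℝ fun y => F x y z)
    (hF3 : ∀ x y, IsLinearMap ℝ fun z => F x y z)
    (hG1 : ∀ y z, IsLinearMap ℝ fun x => G x y z) (hG2 : ∀ x z, IsLinearMap ℝ fun y => G x y z)
    (hG3 : ∀ x y, IsLinearMap ℝ fun z => G x y z) :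
    ∑ i, ∑ j, ∑ k, F (b i) (b j) (b k) * G (b i) (b j) (b k)
      = ∑ i, ∑ j, ∑ k, F (e i) (e j) (e k) * G (e i) (e j) (e k) := by
  have key : ∀ f g : V → ℝ, IsLinearMap ℝ f → IsLinearMap ℝ g →
      ∑ i, f (b i) * g (b i) = ∑ i, f (e i) * g (e i) := fun f g hf hg =>
    sum_bilin_eq b e (fun x y => f x * g y)
      (fun y => ⟨fun x x' => by simp [hf.map_add, add_mul],
        fun c x => by simp [hf.map_smul, mul_assoc]⟩)
      (fun x => ⟨fun y y' => by simp [hg.map_add, mul_add],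
        fun c y => by simp [hg.map_smul, mul_left_comm]⟩)
  calc _ = ∑ i, ∑ j, ∑ k, F (b i) (b j) (e k) * G (b i) (b j) (e k) :=
        Finset.sum_congr rfl fun i _ => Finset.sum_congr rfl fun j _ =>
          key _ _ (hF3 _ _) (hG3 _ _)
    _ = ∑ i, ∑ k, ∑ j, F (b i) (b j) (e k) * G (b i) (b j) (e k) :=
        Finset.sum_congr rfl fun i _ => Finset.sum_comm
    _ = ∑ i, ∑ k, ∑ j, F (b i) (e j) (e k) * G (b i) (e j) (e k) :=
        Finset.sum_congr rfl fun i _ => Finset.sum_congr rfl fun k _ =>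
          key _ _ (hF2 _ _) (hG2 _ _)
    _ = ∑ k, ∑ j, ∑ i, F (b i) (e j) (e k) * G (b i) (e j) (e k) := by
        rw [Finset.sum_comm]
        exact Finset.sum_congr rfl fun k _ => Finset.sum_comm
    _ = ∑ k, ∑ j, ∑ i, F (e i) (e j) (e k) * G (e i) (e j) (e k) :=
        Finset.sum_congr rfl fun k _ => Finset.sum_congr rfl fun j _ =>
          key _ _ (hF1 _ _) (hG1 _ _)
    _ = _ := by
        rw [Finset.sum_comm]
        conv_lhs => enter [2, j]; rw [Finset.sum_comm]
        rw [Finset.sum_comm]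

lemma hodge_phiA_eq_sum (o : Orientation ℝ V (Fin 7)) (e : OrthonormalBasis (Fin 7) ℝ V)
    (A : Oct V) (a b c d : V) :
    hodge o (phiA φ A) a b c d = 1 / 6 * ∑ i, ∑ j, ∑ k, phiA φ A (e i) (e j) (e k) *
      o.volumeForm ![e i, e j, e k, a, b, c, d] := by
  rw [hodge]
  congr 1
  exact sum_trilin_eq (onb V) e (phiA φ A) (fun x y z => o.volumeForm ![x, y, z, a, b, c, d])
    (isLinearMap_phiA₁ A) (isLinearMap_phiA₂ A) (isLinearMap_phiA₃ A)
    (fun y z => isLinearMap_volumeForm o 0 fun x => by funext l; fin_cases l <;> rfl)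
    (fun x z => isLinearMap_volumeForm o 1 fun y => by funext l; fin_cases l <;> rfl)
    (fun x y => isLinearMap_volumeForm o 2 fun z => by funext l; fin_cases l <;> rfl)

lemma isLinearMap_hodge (o : Orientation ℝ V (Fin 7)) (Φ : V → V → V → ℝ)
    {m : V → Fin 4 → V} (i : Fin 4) (hm : ∀ x, m x = Function.update (m 0) i x) :
    IsLinearMap ℝ fun x => hodge o Φ (m x 0) (m x 1) (m x 2) (m x 3) := by
  have h : ∀ u v w : V, IsLinearMap ℝ fun x => o.volumeForm
      ![u, v, w, m x 0, m x 1, m x 2, m x 3] := fun u v w =>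
    isLinearMap_volumeForm o (Fin.natAdd 3 i) fun x => by
      funext l
      have hx : ∀ j, m x j = if j = i then x else m 0 j := fun j => by
        rw [hm x, Function.update_apply]
      rw [Function.update_apply]
      fin_cases i <;> fin_cases l <;> simp [hx]
  constructor
  · intro x y
    simp only [hodge, (h _ _ _).map_add, mul_add, Finset.sum_add_distrib]
  · intro c x
    simp only [hodge, (h _ _ _).map_smul, smul_eq_mul, Finset.mul_sum]
    refine Finset.sum_congr rfl fun i _ => Finset.sum_congr rfl fun j _ =>
      Finset.sum_congr rfl fun k _ => ?_
    ring

lemma eq_of_basis {ι : Type*} [Fintype ι] (e : OrthonormalBasis ι ℝ V) {f g : V → ℝ}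
    (hf : IsLinearMap ℝ f) (hg : IsLinearMap ℝ g) (h : ∀ i, f (e i) = g (e i)) (x : V) :
    f x = g x := by
  have := e.toBasis.ext (f₁ := hf.mk') (f₂ := hg.mk') fun i => by simpa using h i
  exact congrArg (fun F : V →ₗ[ℝ] ℝ => F x) this

/-- The Hodge dual of the 3-form `phiA`. -/
lemma IsAdapted.hodge_phiA (h : IsAdapted φ e) (he : e.toBasis.orientation = o) (A : Oct V)
    (a b c d : V) : hodge o (phiA φ A) a b c d = psiA φ A a b c d := by
  have hb : ∀ i j k l : Fin 7, hodge o (phiA φ A) (e i) (e j) (e k) (e l)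
      = psiA φ A (e i) (e j) (e k) (e l) := by
    intro a b c d
    rw [hodge_phiA_eq_sum o e]
    have hv : ∀ i j k, (fun l => e (![i, j, k, a, b, c, d] l))
        = ![e i, e j, e k, e a, e b, e c, e d] := fun i j k => by
      funext l; fin_cases l <;> rfl
    by_cases hnd : [a, b, c, d].Nodup
    · rw [sum_injective_eq hnd (psiA φ A (e a) (e b) (e c) (e d)) _
        (fun i j k hs => IsVectorCross.phiA_mul_volumeForm h he A hs)
        (fun i j k hs => by rw [← hv, volumeForm_eq_zero o e hs, mul_zero])]
      ring
    · rw [h.isVectorCross.psiA_eq_zero]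
      · rw [Finset.sum_eq_zero, mul_zero]
        refine fun i _ => Finset.sum_eq_zero fun j _ => Finset.sum_eq_zero fun k _ => ?_
        rw [← hv, volumeForm_eq_zero o e, mul_zero]
        intro hs
        rw [← List.nodup_ofFn] at hs
        have : List.ofFn ![i, j, k, a, b, c, d] = [i, j, k, a, b, c, d] := by
          simp [List.ofFn_succ]
        rw [this] at hs
        simp only [List.nodup_cons] at hs hnd
        tauto
      · simp only [e.toBasis.injective.eq_iff, ← e.coe_toBasis]
        simp only [List.nodup_cons, List.mem_cons, List.not_mem_nil, or_false, not_or,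
          List.nodup_nil, not_false_eq_true, and_true] at hnd
        tauto
  have hu : ∀ (m : V → Fin 4 → V) (i : Fin 4), (∀ x, m x = Function.update (m 0) i x) →
    IsLinearMap ℝ fun x => hodge o (phiA φ A) (m x 0) (m x 1) (m x 2) (m x 3) :=
    fun m i => isLinearMap_hodge o _ i
  refine eq_of_basis e (hu (fun x => ![x, b, c, d]) 0 ?_) (isLinearMap_psiA₁ A _ _ _) (fun i => ?_) a
  · intro x; funext l; fin_cases l <;> rfl
  refine eq_of_basis e (hu (fun x => ![e i, x, c, d]) 1 ?_) (isLinearMap_psiA₂ A _ _ _) (fun j => ?_) b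
  · intro x; funext l; fin_cases l <;> rfl
  refine eq_of_basis e (hu (fun x => ![e i, e j, x, d]) 2 ?_) (isLinearMap_psiA₃ A _ _ _) (fun k => ?_) c
  · intro x; funext l; fin_cases l <;> rfl
  refine eq_of_basis e (hu (fun x => ![e i, e j, e k, x]) 3 ?_) (isLinearMap_psiA₄ A _ _ _) (fun l => ?_) d
  · intro x; funext l; fin_cases l <;> rfl
  exact hb i j k l

/-- `sigma` is the 3-form `phiA`. -/
lemma IsAdapted.sigma_eq (h : IsAdapted φ e) (he : e.toBasis.orientation = o) (A : Oct V) :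
    sigma o (form φ) A = phiA φ A := by
  have hφ := h.isVectorCross
  funext u v w
  obtain ⟨a, α⟩ := A
  have hf : form φ = phiA φ ((1, 0) : Oct V) := by
    funext u v w; rw [hφ.phiA_one]
  have hh : hodge o (form φ) α u v w = psiA φ ((1, 0) : Oct V) α u v w := by
    rw [hf, h.hodge_phiA he]
  set I : Oct V := (1, 0) with hI
  have hA : ((a, α) : Oct V) = a • I + L φ α I := by rw [L_one]; simp [hI]
  have hN : normSq I = 1 := by simp [normSq, hI]
  have hone : ∀ u v w, oip (L φ u (L φ v I)) (L φ w I) = φ u v w := fun u v w => by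
    rw [← hφ.phiA_one, phiA, ← hI, hN]; simp
  have hII : oip I I = 1 := by rw [oip_self, hN]
  -- The two factors α are moved outwards past u, v, w; each contraction on the way yields one term
  -- of 2α ∧ (α⌟φ).
  have h4 : oip (L φ u (L φ v (L φ α I))) (L φ w (L φ α I))
      = -‖α‖ ^ 2 * φ u v w + 2 * (inner ℝ α u * φ α v w + inner ℝ α v * φ α w u
        + inner ℝ α w * φ α u v) := by
    have hcyc : φ u v α = φ α u v := by rw [hφ.swap_right, hφ.swap_left, neg_neg]
    have hα : ∀ x y, oip x (L φ α y) = -oip (L φ α x) y := fun x y => by rw [hφ.oip_L, neg_neg]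
    rw [hφ.L_L v α, hφ.L_L w α, map_sub (L φ u), map_neg (L φ u), map_smul (L φ u), hφ.L_L u α]
    simp only [map_sub, map_neg, map_smul, LinearMap.sub_apply, LinearMap.neg_apply,
      LinearMap.smul_apply, smul_eq_mul, hφ.oip_L_L_same, hone, hφ.oip_L_self, hα]
    rw [hφ.oip_L α _ I, hone, hcyc, hφ.swap_right α w u, ← real_inner_self_eq_norm_sq,
      real_inner_comm u α, real_inner_comm v α, real_inner_comm w α]
    ring
  rw [sigma, phiA, hh, hφ.psiA_eq, hN]
  congr 1
  dsimp only
  rw [hA]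
  simp only [map_add, map_smul, LinearMap.add_apply, LinearMap.smul_apply, smul_eq_mul, h4, hone]
  ring

end Pointwise

/-! ### Metric-preserving variations of a cross product. -/

section Pointwise

variable {V : Type*} [NormedAddCommGroup V] [InnerProductSpace ℝ V] [FiniteDimensional ℝ V]
variable {φ : V →ₗ[ℝ] V →ₗ[ℝ] V →ₗ[ℝ] ℝ} {e : OrthonormalBasis (Fin 7) ℝ V}
  [Fact (Module.finrank ℝ V = 7)]

/-- Writing the dual 4-form through inner and cross products alone allows it to be evaluated in
coordinates and compared with associators. -/
lemma IsVectorCross.two_mul_psiA_one (hφ : IsVectorCross φ) (t b c d : V) :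
    2 * psiA φ ((1, 0) : Oct V) t b c d = inner ℝ c t * inner ℝ b d
      + inner ℝ (cross (form φ) c t) (cross (form φ) b d) - inner ℝ b c * inner ℝ d t
      - inner ℝ (cross (form φ) b c) (cross (form φ) d t) := by
  have h1 : ∀ x y : V, L φ x ((0, y) : Oct V) = (-inner ℝ x y, cross (form φ) x y) := fun x y => by
    ext1
    · rw [L_fst]
    · rw [L_snd]; simp
  rw [hφ.psiA_eq, hφ.oip_L b]
  simp only [L_one, h1, oip_apply, normSq]
  simp
  ring

lemma _root_.IsLinearMap.const_mul {E : Type*} [AddCommGroup E] [Module ℝ E] {f : E → ℝ}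
    (hf : IsLinearMap ℝ f) (c : ℝ) : IsLinearMap ℝ fun x => c * f x :=
  ⟨fun x y => by rw [hf.map_add, mul_add], fun r x => by
    rw [hf.map_smul, smul_eq_mul, smul_eq_mul, mul_left_comm]⟩

lemma eq_zero_of_lt {g : Fin 7 → Fin 7 → Fin 7 → ℝ} (h12 : ∀ i j k, g i j k = -g j i k)
    (h23 : ∀ i j k, g i j k = -g i k j) (h : ∀ i j k, i < j → j < k → g i j k = 0)
    (i j k : Fin 7) : g i j k = 0 := by
  have h1 : ∀ i k, g i i k = 0 := fun i k => by linarith [h12 i i k]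
  have h2 : ∀ i k, g i k k = 0 := fun i k => by linarith [h23 i k k]
  have h3 : ∀ i k, g i k i = 0 := fun i k => by rw [h23, h1, neg_zero]
  rcases lt_trichotomy i j with hij | rfl | hij
  · rcases lt_trichotomy j k with hjk | rfl | hjk
    · exact h i j k hij hjk
    · exact h2 _ _
    · rcases lt_trichotomy i k with hik | rfl | hik
      · rw [h23, h i k j hik hjk, neg_zero]
      · exact h3 _ _
      · rw [h23, h12, h k i j hik hij]; simp
  · exact h1 _ _
  · rcases lt_trichotomy i k with hik | rfl | hik
    · rw [h12, h j i k hij hik, neg_zero]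
    · exact h3 _ _
    · rcases lt_trichotomy j k with hjk | rfl | hjk
      · rw [h12, h23, h j k i hjk hik]; simp
      · exact h2 _ _
      · rw [h12, h23, h12, h k j i hjk hij]; simp

set_option maxHeartbeats 4000000 in
/-- An infinitesimal variation of a vector cross product which preserves the metric is given by
the 4-form contracted with a vector. -/
lemma IsAdapted.exists_eq_psiA (h : IsAdapted φ e) (κ : V →ₗ[ℝ] V →ₗ[ℝ] V →ₗ[ℝ] ℝ)
    (h12 : ∀ u v w, κ u v w = -κ v u w) (h23 : ∀ u v w, κ u v w = -κ u w v)
    (hκ : ∀ u v, κ u v (cross (form φ) u v) = 0) :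
    ∃ t, ∀ u v w, κ u v w = 2 * psiA φ ((1, 0) : Oct V) t u v w := by
  have hφ := h.isVectorCross
  have hcr : ∀ (i j m : Fin 7) (a : ℤ), (∀ x, phi0 i j x = if x = m then a else 0) →
      cross (form φ) (e i) (e j) = (a : ℝ) • e m := fun i j m a hm => by
    refine InnerProductSpace.ext_inner_right_basis (𝕜 := ℝ) e.toBasis fun l => ?_
    rw [e.coe_toBasis, G2Flux.inner_cross, h, hm, real_inner_smul_left, e.inner_eq_ite]
    by_cases hl : l = m
    · simp [hl]
    · simp [hl, Ne.symm hl]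
  have hpol : ∀ u v w, κ u v (cross (form φ) u w) + κ u w (cross (form φ) u v) = 0 := by
    intro u v w
    have := hκ u (v + w)
    simp only [cross_add_right, map_add, LinearMap.add_apply, hκ] at this
    linarith
  have hrel : ∀ (i j l m n : Fin 7) (a b : ℤ), (∀ x, phi0 i l x = if x = m then a else 0) →
      (∀ x, phi0 i j x = if x = n then b else 0) →
      (a : ℝ) * κ (e i) (e j) (e m) + (b : ℝ) * κ (e i) (e l) (e n) = 0 := by
    intro i j l m n a b ha hb
    have := hpol (e i) (e j) (e l)
    rwa [hcr i l m a ha, hcr i j n b hb, map_smul, map_smul] at this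
  have h213 : ∀ i j k, κ (e j) (e i) (e k) = -κ (e i) (e j) (e k) := fun i j k => h12 _ _ _
  have h132 : ∀ i j k, κ (e i) (e k) (e j) = -κ (e i) (e j) (e k) := fun i j k => h23 _ _ _
  have h231 : ∀ i j k, κ (e j) (e k) (e i) = κ (e i) (e j) (e k) := fun i j k => by
    rw [h23, h12, neg_neg]
  have h312 : ∀ i j k, κ (e k) (e i) (e j) = κ (e i) (e j) (e k) := fun i j k => by
    rw [h12, h23, neg_neg]
  have h321 : ∀ i j k, κ (e k) (e j) (e i) = -κ (e i) (e j) (e k) := fun i j k => by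
    rw [h12, h231 i j k]
  -- The polarised condition on frame vectors leaves seven free components out of 35: those on the
  -- seven triples occurring in φ vanish, and each of the other 21 is ± one of the free ones.
  have k156 : κ (e 1) (e 5) (e 6) = κ (e 1) (e 3) (e 4) := by
    have r := hrel 1 3 6 4 5 (1) (1) (by decide) (by decide)
    rw [h132 1 5 6] at r
    push_cast at r
    linarith
  have k235 : κ (e 2) (e 3) (e 5) = -κ (e 2) (e 4) (e 6) := by
    have r := hrel 2 3 4 5 6 (-1) (-1) (by decide) (by decide)
    push_cast at r
    linarith
  have k234 : κ (e 2) (e 3) (e 4) = κ (e 2) (e 5) (e 6) := by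
    have r := hrel 2 3 5 4 6 (1) (-1) (by decide) (by decide)
    push_cast at r
    linarith
  have k035 : κ (e 0) (e 3) (e 5) = -κ (e 1) (e 3) (e 4) := by
    have r := hrel 3 0 1 5 4 (-1) (-1) (by decide) (by decide)
    rw [h213 0 3 5, h213 1 3 4] at r
    push_cast at r
    linarith
  have k036 : κ (e 0) (e 3) (e 6) = κ (e 2) (e 3) (e 4) := by
    have r := hrel 3 0 2 6 4 (1) (-1) (by decide) (by decide)
    rw [h213 0 3 6, h213 2 3 4] at r
    push_cast at r
    linarith
  have k013 : κ (e 0) (e 1) (e 3) = -κ (e 3) (e 4) (e 5) := by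
    have r := hrel 3 0 5 1 4 (1) (-1) (by decide) (by decide)
    rw [h312 0 1 3, h132 3 4 5] at r
    push_cast at r
    linarith
  have k023 : κ (e 0) (e 2) (e 3) = κ (e 3) (e 4) (e 6) := by
    have r := hrel 3 0 6 2 4 (-1) (-1) (by decide) (by decide)
    rw [h312 0 2 3, h132 3 4 6] at r
    push_cast at r
    linarith
  have k136 : κ (e 1) (e 3) (e 6) = κ (e 2) (e 3) (e 5) := by
    have r := hrel 3 1 2 6 5 (1) (-1) (by decide) (by decide)
    rw [h213 1 3 6, h213 2 3 5] at r
    push_cast at r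
    linarith
  have k123 : κ (e 1) (e 2) (e 3) = κ (e 3) (e 5) (e 6) := by
    have r := hrel 3 1 6 2 5 (-1) (-1) (by decide) (by decide)
    rw [h312 1 2 3, h132 3 5 6] at r
    push_cast at r
    linarith
  have k046 : κ (e 0) (e 4) (e 6) = κ (e 1) (e 3) (e 4) := by
    have r := hrel 4 0 1 6 3 (1) (1) (by decide) (by decide)
    rw [h213 0 4 6, h312 1 3 4] at r
    push_cast at r
    linarith
  have k045 : κ (e 0) (e 4) (e 5) = κ (e 2) (e 3) (e 4) := by
    have r := hrel 4 0 2 5 3 (1) (1) (by decide) (by decide)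
    rw [h213 0 4 5, h312 2 3 4] at r
    push_cast at r
    linarith
  have k024 : κ (e 0) (e 2) (e 4) = κ (e 3) (e 4) (e 5) := by
    have r := hrel 4 0 5 2 3 (-1) (1) (by decide) (by decide)
    rw [h312 0 2 4, h231 3 4 5] at r
    push_cast at r
    linarith
  have k014 : κ (e 0) (e 1) (e 4) = κ (e 3) (e 4) (e 6) := by
    have r := hrel 4 0 6 1 3 (-1) (1) (by decide) (by decide)
    rw [h312 0 1 4, h231 3 4 6] at r
    push_cast at r
    linarith
  have k145 : κ (e 1) (e 4) (e 5) = -κ (e 2) (e 4) (e 6) := by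
    have r := hrel 4 1 2 5 6 (1) (1) (by decide) (by decide)
    rw [h213 1 4 5, h213 2 4 6] at r
    push_cast at r
    linarith
  have k124 : κ (e 1) (e 2) (e 4) = κ (e 4) (e 5) (e 6) := by
    have r := hrel 4 1 5 2 6 (-1) (1) (by decide) (by decide)
    rw [h312 1 2 4] at r
    push_cast at r
    linarith
  have k015 : κ (e 0) (e 1) (e 5) = κ (e 3) (e 5) (e 6) := by
    have r := hrel 5 0 3 1 6 (-1) (-1) (by decide) (by decide)
    rw [h312 0 1 5, h213 3 5 6] at r
    push_cast at r
    linarith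
  have k025 : κ (e 0) (e 2) (e 5) = -κ (e 4) (e 5) (e 6) := by
    have r := hrel 5 0 4 2 6 (1) (-1) (by decide) (by decide)
    rw [h312 0 2 5, h213 4 5 6] at r
    push_cast at r
    linarith
  have k125 : κ (e 1) (e 2) (e 5) = κ (e 3) (e 4) (e 5) := by
    have r := hrel 5 1 4 2 3 (1) (1) (by decide) (by decide)
    rw [h312 1 2 5, h321 3 4 5] at r
    push_cast at r
    linarith
  have k026 : κ (e 0) (e 2) (e 6) = -κ (e 3) (e 5) (e 6) := by
    have r := hrel 6 0 3 2 5 (1) (1) (by decide) (by decide)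
    rw [h312 0 2 6, h312 3 5 6] at r
    push_cast at r
    linarith
  have k016 : κ (e 0) (e 1) (e 6) = -κ (e 4) (e 5) (e 6) := by
    have r := hrel 6 0 4 1 5 (1) (1) (by decide) (by decide)
    rw [h312 0 1 6, h312 4 5 6] at r
    push_cast at r
    linarith
  have k126 : κ (e 1) (e 2) (e 6) = κ (e 3) (e 4) (e 6) := by
    have r := hrel 6 1 3 2 4 (1) (-1) (by decide) (by decide)
    rw [h312 1 2 6, h312 3 4 6] at r
    push_cast at r
    linarith
  have k012 : κ (e 0) (e 1) (e 2) = 0 := by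
    have r := hrel 0 1 1 2 2 (1) (1) (by decide) (by decide)
    push_cast at r
    linarith
  have k034 : κ (e 0) (e 3) (e 4) = 0 := by
    have r := hrel 0 3 3 4 4 (1) (1) (by decide) (by decide)
    push_cast at r
    linarith
  have k056 : κ (e 0) (e 5) (e 6) = 0 := by
    have r := hrel 0 5 5 6 6 (1) (1) (by decide) (by decide)
    push_cast at r
    linarith
  have k135 : κ (e 1) (e 3) (e 5) = 0 := by
    have r := hrel 1 3 3 5 5 (1) (1) (by decide) (by decide)
    push_cast at r
    linarith
  have k146 : κ (e 1) (e 4) (e 6) = 0 := by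
    have r := hrel 1 4 4 6 6 (-1) (-1) (by decide) (by decide)
    push_cast at r
    linarith
  have k236 : κ (e 2) (e 3) (e 6) = 0 := by
    have r := hrel 2 3 3 6 6 (-1) (-1) (by decide) (by decide)
    push_cast at r
    linarith
  have k245 : κ (e 2) (e 4) (e 5) = 0 := by
    have r := hrel 2 4 4 5 5 (-1) (-1) (by decide) (by decide)
    push_cast at r
    linarith

  -- The required κ = 2 t⌟∗φ forces these coordinates: each free component of κ equals ±2 times one
  -- coordinate of t.
  set τ : Fin 7 → ℝ := ![κ (e 2) (e 4) (e 6) / 2, κ (e 2) (e 5) (e 6) / 2,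
    -κ (e 1) (e 3) (e 4) / 2, κ (e 4) (e 5) (e 6) / 2, -κ (e 3) (e 5) (e 6) / 2,
    κ (e 3) (e 4) (e 6) / 2, -κ (e 3) (e 4) (e 5) / 2] with hτ
  set t : V := ∑ i, τ i • e i with ht
  have hti : ∀ i, inner ℝ (e i) t = τ i := fun i => by
    simp [ht, inner_sum, inner_smul_right, e.inner_eq_ite]
  have hbasis : ∀ i j k, κ (e i) (e j) (e k) - 2 * psiA φ ((1, 0) : Oct V) t (e i) (e j) (e k)
      = 0 := by
    refine eq_zero_of_lt (fun i j k => ?_) (fun i j k => ?_) (fun i j k hij hjk => ?_)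
    · rw [h12, hφ.psiA_swap₂₃]; ring
    · rw [h23, hφ.psiA_swap₃₄]; ring
    · rw [hφ.two_mul_psiA_one, inner_eq_sum e (cross _ _ _), inner_eq_sum e (cross _ _ _)]
      simp only [h.inner_cross, hti, e.inner_eq_ite, Fin.sum_univ_seven]
      clear hrel hpol hcr h213 h132 h231 h312 h321 hκ h12 h23
      fin_cases i <;> fin_cases j <;> first | exact absurd hij (by decide) | skip
      all_goals fin_cases k <;> first | exact absurd hjk (by decide) | skip
      all_goals
        simp [stdCross, hτ]
        try linarith
  refine ⟨t, fun u v w => ?_⟩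
  refine eq_of_basis e (f := fun u => κ u v w) (g := fun u => 2 * psiA φ _ t u v w)
    ((κ.flip v).flip w).isLinear ((isLinearMap_psiA₂ _ t v w).const_mul 2) (fun i => ?_) u
  refine eq_of_basis e (f := fun v => κ (e i) v w) (g := fun v => 2 * psiA φ _ t (e i) v w)
    ((κ (e i)).flip w).isLinear ((isLinearMap_psiA₃ _ t (e i) w).const_mul 2) (fun j => ?_) v
  exact eq_of_basis e (f := fun w => κ (e i) (e j) w)
    (g := fun w => 2 * psiA φ _ t (e i) (e j) w) (κ (e i) (e j)).isLinear
    ((isLinearMap_psiA₄ _ t (e i) (e j)).const_mul 2) (fun k => sub_eq_zero.mp (hbasis i j k)) w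

end Pointwise

/-! ### Clifford action of the flux. -/

section Pointwise

variable {V : Type*} [NormedAddCommGroup V] [InnerProductSpace ℝ V] [FiniteDimensional ℝ V]
variable {φ : V →ₗ[ℝ] V →ₗ[ℝ] V →ₗ[ℝ] ℝ}

/-- `G_{ubcd} δ^b δ^c δ^d` acting on octonions. -/
noncomputable def flux3 (φ : V →ₗ[ℝ] V →ₗ[ℝ] V →ₗ[ℝ] ℝ) (G : V [⋀^Fin 4]→L[ℝ] ℝ) (u : V)
    (A : Oct V) : Oct V :=
  ∑ b, ∑ c, ∑ d, G ![u, onb V b, onb V c, onb V d] •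
    L φ (onb V b) (L φ (onb V c) (L φ (onb V d) A))

/-- `(1/144) G_{bcde} δ^b δ^c δ^d δ^e` acting on octonions. -/
noncomputable def flux4 (φ : V →ₗ[ℝ] V →ₗ[ℝ] V →ₗ[ℝ] ℝ) (G : V [⋀^Fin 4]→L[ℝ] ℝ)
    (A : Oct V) : Oct V :=
  (1 / 144 : ℝ) • ∑ b, L φ (onb V b) (flux3 φ G (onb V b) A)

lemma cliff3_eq (G : V [⋀^Fin 4]→L[ℝ] ℝ) (u : V) (Z : BiOct V) :
    cliff3 (form φ) G u Z = (flux3 φ G u Z.1, flux3 φ G u Z.2) := by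
  ext1
  · simp only [cliff3, flux3, Prod.fst_sum, Prod.smul_fst, lmul, L_apply]
  · simp only [cliff3, flux3, Prod.snd_sum, Prod.smul_snd, lmul, L_apply]

lemma cliff4_eq (G : V [⋀^Fin 4]→L[ℝ] ℝ) (Z : BiOct V) :
    cliff4 (form φ) G Z = ((144 : ℝ) • flux4 φ G Z.1, (144 : ℝ) • flux4 φ G Z.2) := by
  simp only [flux4, smul_smul]
  norm_num
  ext1
  · simp only [cliff4, cliff3_eq, Prod.fst_sum, lmul, L_apply]
  · simp only [cliff4, cliff3_eq, Prod.snd_sum, lmul, L_apply]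

lemma alt4_swap₁₂ (G : V [⋀^Fin 4]→L[ℝ] ℝ) (a b c d : V) : G ![b, a, c, d] = -G ![a, b, c, d] := by
  have h := G.toAlternatingMap.map_swap ![a, b, c, d] (show (0 : Fin 4) ≠ 1 by decide)
  refine Eq.trans ?_ h
  change G _ = G _
  congr 1; funext i; fin_cases i <;> rfl

lemma alt4_swap₂₃ (G : V [⋀^Fin 4]→L[ℝ] ℝ) (a b c d : V) : G ![a, c, b, d] = -G ![a, b, c, d] := by
  have h := G.toAlternatingMap.map_swap ![a, b, c, d] (show (1 : Fin 4) ≠ 2 by decide)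
  refine Eq.trans ?_ h
  change G _ = G _
  congr 1; funext i; fin_cases i <;> rfl

lemma alt4_swap₃₄ (G : V [⋀^Fin 4]→L[ℝ] ℝ) (a b c d : V) : G ![a, b, d, c] = -G ![a, b, c, d] := by
  have h := G.toAlternatingMap.map_swap ![a, b, c, d] (show (2 : Fin 4) ≠ 3 by decide)
  refine Eq.trans ?_ h
  change G _ = G _
  congr 1; funext i; fin_cases i <;> rfl

lemma sum_inner_mul_alt4 {ι : Type*} [Fintype ι] (e : OrthonormalBasis ι ℝ V)
    (G : V [⋀^Fin 4]→L[ℝ] ℝ) (u a b c : V) :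
    ∑ i, inner ℝ (e i) u * G ![e i, a, b, c] = G ![u, a, b, c] := by
  have h : ∀ x, G.toMultilinearMap.toLinearMap ![0, a, b, c] 0 x = G ![x, a, b, c] := fun x => by
    rw [MultilinearMap.toLinearMap_apply]
    change G _ = _
    congr 1; funext i; fin_cases i <;> rfl
  have := sum_inner_smul e (G.toMultilinearMap.toLinearMap ![0, a, b, c] 0) u
  simpa only [h, smul_eq_mul] using this

lemma sum_reverse₃ {ι E : Type*} [Fintype ι] [AddCommMonoid E] (f : ι → ι → ι → E) :
    ∑ a, ∑ b, ∑ c, f c b a = ∑ a, ∑ b, ∑ c, f a b c := by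
  calc _ = ∑ a, ∑ c, ∑ b, f c b a := Finset.sum_congr rfl fun a _ => Finset.sum_comm
    _ = ∑ c, ∑ a, ∑ b, f c b a := Finset.sum_comm
    _ = _ := Finset.sum_congr rfl fun a _ => Finset.sum_comm

lemma sum_reverse₄ {ι E : Type*} [Fintype ι] [AddCommMonoid E] (f : ι → ι → ι → ι → E) :
    ∑ a, ∑ b, ∑ c, ∑ d, f d c b a = ∑ a, ∑ b, ∑ c, ∑ d, f a b c d := by
  calc _ = ∑ a, ∑ d, ∑ c, ∑ b, f d c b a :=
        Finset.sum_congr rfl fun a _ => sum_reverse₃ fun d c b => f d c b a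
    _ = ∑ d, ∑ a, ∑ c, ∑ b, f d c b a := Finset.sum_comm
    _ = ∑ d, ∑ c, ∑ a, ∑ b, f d c b a := Finset.sum_congr rfl fun a _ => Finset.sum_comm
    _ = _ := Finset.sum_congr rfl fun a _ => Finset.sum_congr rfl fun _ _ => Finset.sum_comm

/-- Moving four skew-adjoint factors across costs (-1)⁴, and reversing four indices is an even
permutation, so the action is symmetric. -/
lemma IsVectorCross.oip_flux4 (hφ : IsVectorCross φ) (G : V [⋀^Fin 4]→L[ℝ] ℝ) (A B : Oct V) :
    oip (flux4 φ G A) B = oip A (flux4 φ G B) := by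
  simp only [flux4, flux3, map_smul, LinearMap.smul_apply, smul_eq_mul]
  congr 1
  simp only [map_sum, LinearMap.sum_apply, map_smul, LinearMap.smul_apply, smul_eq_mul, hφ.oip_L,
    neg_neg]
  have hrev : ∀ a b c d : V, G ![a, b, c, d] = G ![d, c, b, a] := fun a b c d => by
    rw [alt4_swap₁₂ G b a, alt4_swap₂₃ G b c a, alt4_swap₃₄ G b c d a, alt4_swap₁₂ G c b,
      alt4_swap₂₃ G c d b, alt4_swap₁₂ G d c]
    simp
  rw [← sum_reverse₄]
  exact Finset.sum_congr rfl fun b _ => Finset.sum_congr rfl fun c _ =>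
    Finset.sum_congr rfl fun d _ => Finset.sum_congr rfl fun e _ => by rw [hrev]

/-- Moving u past the four factors leaves four contractions, all equal by alternation, of total
weight 8, and 8/144 = 1/18. This expresses the cubic flux term through commutators with the quartic
one. -/
lemma IsVectorCross.L_flux4 (hφ : IsVectorCross φ) (G : V [⋀^Fin 4]→L[ℝ] ℝ) (u : V) (A : Oct V) :
    flux4 φ G (L φ u A) = L φ u (flux4 φ G A) + (1 / 18 : ℝ) • flux3 φ G u A := by
  have hw : ∀ b c d e, L φ u (L φ b (L φ c (L φ d (L φ e A)))) =
      L φ b (L φ c (L φ d (L φ e (L φ u A)))) - (2 * inner ℝ b u) • L φ c (L φ d (L φ e A))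
      + (2 * inner ℝ c u) • L φ b (L φ d (L φ e A)) - (2 * inner ℝ d u) • L φ b (L φ c (L φ e A))
      + (2 * inner ℝ e u) • L φ b (L φ c (L φ d A)) := by
    intro b c d e
    rw [hφ.L_L u b, hφ.L_L u c, hφ.L_L u d, hφ.L_L u e]
    simp only [map_sub, map_neg, map_smul, real_inner_comm u]
    module
  have h1 : ∀ f : Fin (Module.finrank ℝ V) → Fin (Module.finrank ℝ V) → Fin (Module.finrank ℝ V)
      → Oct V, ∑ b, ∑ c, ∑ d, ∑ e, (inner ℝ (onb V b) u *
        G ![onb V b, onb V c, onb V d, onb V e]) • f c d e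
      = ∑ c, ∑ d, ∑ e, G ![u, onb V c, onb V d, onb V e] • f c d e := by
    intro f
    rw [Finset.sum_comm]
    refine Finset.sum_congr rfl fun c _ => ?_
    rw [Finset.sum_comm]
    refine Finset.sum_congr rfl fun d _ => ?_
    rw [Finset.sum_comm]
    refine Finset.sum_congr rfl fun e _ => ?_
    rw [← Finset.sum_smul, sum_inner_mul_alt4]
  have h2 : ∀ f : Fin (Module.finrank ℝ V) → Fin (Module.finrank ℝ V) → Fin (Module.finrank ℝ V)
      → Oct V, ∑ b, ∑ c, ∑ d, ∑ e, (inner ℝ (onb V c) u *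
        G ![onb V b, onb V c, onb V d, onb V e]) • f b d e
      = -∑ c, ∑ d, ∑ e, G ![u, onb V c, onb V d, onb V e] • f c d e := by
    intro f
    rw [Finset.sum_comm, ← h1]
    simp only [← Finset.sum_neg_distrib]
    refine Finset.sum_congr rfl fun c _ => Finset.sum_congr rfl fun b _ =>
      Finset.sum_congr rfl fun d _ => Finset.sum_congr rfl fun e _ => ?_
    rw [alt4_swap₁₂ G (onb V c)]
    module
  have h3 : ∀ f : Fin (Module.finrank ℝ V) → Fin (Module.finrank ℝ V) → Fin (Module.finrank ℝ V)
      → Oct V, ∑ b, ∑ c, ∑ d, ∑ e, (inner ℝ (onb V d) u *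
        G ![onb V b, onb V c, onb V d, onb V e]) • f b c e
      = ∑ c, ∑ d, ∑ e, G ![u, onb V c, onb V d, onb V e] • f c d e := by
    intro f
    rw [← neg_eq_iff_eq_neg.mpr (h2 f)]
    simp only [← Finset.sum_neg_distrib]
    refine Finset.sum_congr rfl fun b _ => ?_
    rw [Finset.sum_comm]
    refine Finset.sum_congr rfl fun c _ => Finset.sum_congr rfl fun d _ =>
      Finset.sum_congr rfl fun e _ => ?_
    rw [alt4_swap₂₃ G _ (onb V c)]
    module
  have h4 : ∀ f : Fin (Module.finrank ℝ V) → Fin (Module.finrank ℝ V) → Fin (Module.finrank ℝ V)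
      → Oct V, ∑ b, ∑ c, ∑ d, ∑ e, (inner ℝ (onb V e) u *
        G ![onb V b, onb V c, onb V d, onb V e]) • f b c d
      = -∑ c, ∑ d, ∑ e, G ![u, onb V c, onb V d, onb V e] • f c d e := by
    intro f
    rw [← h3]
    simp only [← Finset.sum_neg_distrib]
    refine Finset.sum_congr rfl fun b _ => Finset.sum_congr rfl fun c _ => ?_
    rw [Finset.sum_comm]
    refine Finset.sum_congr rfl fun d _ => Finset.sum_congr rfl fun e _ => ?_
    rw [alt4_swap₃₄ G _ _ (onb V d)]
    module
  have key : L φ u (∑ b, L φ (onb V b) (flux3 φ G (onb V b) A))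
      = ∑ b, L φ (onb V b) (flux3 φ G (onb V b) (L φ u A)) - (8 : ℝ) • flux3 φ G u A := by
    simp only [flux3, map_sum, map_smul]
    simp only [hw, smul_add, smul_sub, Finset.sum_add_distrib, Finset.sum_sub_distrib]
    have g1 := h1 fun c d e => L φ (onb V c) (L φ (onb V d) (L φ (onb V e) A))
    have g2 := h2 fun c d e => L φ (onb V c) (L φ (onb V d) (L φ (onb V e) A))
    have g3 := h3 fun c d e => L φ (onb V c) (L φ (onb V d) (L φ (onb V e) A))
    have g4 := h4 fun c d e => L φ (onb V c) (L φ (onb V d) (L φ (onb V e) A))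
    have hc : ∀ (g t : ℝ) (B : Oct V), g • (2 * t) • B = (2 : ℝ) • (t * g) • B := fun g t B => by
      module
    simp only [hc, ← Finset.smul_sum, g1, g2, g3, g4]
    module
  rw [flux4, flux4, map_smul, key]
  module

lemma isLinearMap_flux4 (G : V [⋀^Fin 4]→L[ℝ] ℝ) : IsLinearMap ℝ (flux4 φ G) :=
  ⟨fun A B => by simp only [flux4, flux3, map_add, smul_add, Finset.sum_add_distrib],
    fun r A => by
      simp only [flux4, flux3, map_smul, smul_comm _ r, ← Finset.smul_sum]⟩

/-- The trace identity `∑ e_i G e_i = G` for the Clifford action of a 4-form in dimension 7. -/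
lemma IsVectorCross.sum_L_flux4_L (hφ : IsVectorCross φ) (hV : Module.finrank ℝ V = 7)
    (G : V [⋀^Fin 4]→L[ℝ] ℝ) (A : Oct V) :
    ∑ i, L φ (onb V i) (flux4 φ G (L φ (onb V i) A)) = flux4 φ G A := by
  simp only [hφ.L_flux4, map_add, map_smul, Finset.sum_add_distrib, ← Finset.smul_sum]
  rw [hφ.sum_L_L, Fintype.card_fin]
  have : ∑ b, L φ (onb V b) (flux3 φ G (onb V b) A) = (144 : ℝ) • flux4 φ G A := by
    rw [flux4, smul_smul]; norm_num
  have hV' : (Module.finrank ℝ V : ℝ) = 7 := by rw [hV]; norm_num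
  rw [this, hV']
  module

end Pointwise

/-! ### Torsion components from the pointwise Killing equations. -/

section Pointwise

variable {V : Type*} [NormedAddCommGroup V] [InnerProductSpace ℝ V] [FiniteDimensional ℝ V]
variable {φ : V →ₗ[ℝ] V →ₗ[ℝ] V →ₗ[ℝ] ℝ}

/-- The real and imaginary parts of the Killing equations at a point, for an operator `c` with the
properties of the Clifford action of `G / 144`, and `D X`, `D Y` the values of the octonion
derivatives. -/
structure IsKillingAt (φ : V →ₗ[ℝ] V →ₗ[ℝ] V →ₗ[ℝ] ℝ) (c : Oct V →ₗ[ℝ] Oct V) (l₁ l₂ m : ℝ) (d : V)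
    (X Y : Oct V) (DX DY : V → Oct V) : Prop where
  symm : ∀ A B, oip (c A) B = oip A (c B)
  trace : ∀ A, ∑ i, L φ (onb V i) (c (L φ (onb V i) A)) = c A
  extX : c X = -l₁ • X - l₂ • Y + m • Y + (1 / 2 : ℝ) • L φ d Y
  extY : c Y = l₁ • Y - l₂ • X - m • X - (1 / 2 : ℝ) • L φ d X
  intX : ∀ u, DX u = -(m / 2) • L φ u X - (1 / 2 : ℝ) • L φ u (c Y) + (3 / 2 : ℝ) • c (L φ u Y)
  intY : ∀ u, DY u = -(m / 2) • L φ u Y + (1 / 2 : ℝ) • L φ u (c X) - (3 / 2 : ℝ) • c (L φ u X)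

variable {c : Oct V →ₗ[ℝ] Oct V} {l₁ l₂ m w₀ : ℝ} {d w : V} {X Y : Oct V} {DX DY : V → Oct V}

/-- This is Z ↦ iZ^* = Y + iX, accompanied by G ↦ -G and complex conjugation of λ. -/
lemma IsKillingAt.swap (h : IsKillingAt φ c l₁ l₂ m d X Y DX DY) :
    IsKillingAt φ (-c) l₁ (-l₂) m d Y X DY DX where
  symm A B := by simp [h.symm]
  trace A := by simp [h.trace]
  extX := by rw [LinearMap.neg_apply, h.extY]; module
  extY := by rw [LinearMap.neg_apply, h.extX]; module
  intX u := by rw [h.intY]; simp only [LinearMap.neg_apply, map_neg]; module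
  intY u := by rw [h.intX]; simp only [LinearMap.neg_apply, map_neg]; module

/-- The torsion of `phiA φ A`, in terms of the octonion derivative of `A`. -/
noncomputable def torA (φ : V →ₗ[ℝ] V →ₗ[ℝ] V →ₗ[ℝ] ℝ) (A : Oct V) (DA : V → Oct V) (u v : V) : ℝ :=
  -((normSq A)⁻¹ * oip (DA u) (L φ v A))

/-- Compare ⟨cX, Y⟩ with ⟨X, cY⟩, both known from the algebraic equations; the terms in d drop out
by skew-adjointness. -/
lemma IsKillingAt.constraint (hφ : IsVectorCross φ) (h : IsKillingAt φ c l₁ l₂ m d X Y DX DY) :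
    2 * l₁ * oip X Y + l₂ * (oip Y Y - oip X X) = m * (oip X X + oip Y Y) := by
  have := h.symm X Y
  rw [h.extX, h.extY] at this
  simp only [map_add, map_sub, map_smul, LinearMap.add_apply, LinearMap.sub_apply,
    LinearMap.smul_apply, smul_eq_mul, hφ.oip_L_self, hφ.oip_self_L] at this
  linarith

lemma IsKillingAt.oip_L_cY (hφ : IsVectorCross φ) (h : IsKillingAt φ c l₁ l₂ m d X Y DX DY) (u : V) :
    oip (L φ u X) (c Y) = l₁ * oip (L φ u X) Y - 1 / 2 * inner ℝ d u * oip X X := by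
  rw [h.extY]
  simp only [map_sub, map_smul, smul_eq_mul, hφ.oip_L_self, hφ.oip_L_L, real_inner_comm d u]
  ring

lemma IsKillingAt.oip_L_cX (hφ : IsVectorCross φ) (h : IsKillingAt φ c l₁ l₂ m d X Y DX DY) (u : V) :
    oip (L φ u Y) (c X) = l₁ * oip (L φ u X) Y + 1 / 2 * inner ℝ d u * oip Y Y := by
  have : oip (L φ u Y) X = -oip (L φ u X) Y := by rw [hφ.oip_L, oip_comm]
  rw [h.extX]
  simp only [map_sub, map_add, map_smul, smul_eq_mul, hφ.oip_L_self, hφ.oip_L_L, this,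
    real_inner_comm d u]
  ring

/-- Pairing with X moves c from uY onto X, so everything is known. As D is metric, this is half the
derivative of |X|². -/
lemma IsKillingAt.oip_DX (hφ : IsVectorCross φ) (h : IsKillingAt φ c l₁ l₂ m d X Y DX DY) (u : V) :
    oip (DX u) X = 2 * l₁ * oip (L φ u X) Y
      + (3 / 4 * oip Y Y - 1 / 4 * oip X X) * inner ℝ d u := by
  have h1 := h.oip_L_cY hφ u
  have h2 := h.oip_L_cX hφ u
  rw [h.intX]
  simp only [map_sub, map_add, map_smul, LinearMap.add_apply, LinearMap.sub_apply,
    LinearMap.smul_apply, smul_eq_mul, hφ.oip_L_self, h.symm]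
  rw [hφ.oip_L u (c Y), oip_comm (c Y), h1, h2]
  ring

/-- The trace identity for c reduces the trace of the torsion to ⟨cY, X⟩; `constraint` then removes
⟨X, Y⟩. -/
lemma IsKillingAt.tau1_eq (hφ : IsVectorCross φ) (hV : Module.finrank ℝ V = 7)
    (h : IsKillingAt φ c l₁ l₂ m d X Y DX DY) (hX : X ≠ 0) :
    14 * tau1 (torA φ X DX) * oip X X
      = m * (2 * oip X X + 5 * oip Y Y) - 5 * l₂ * (oip X X + oip Y Y) := by
  have hN : oip X X ≠ 0 := by rw [oip_self]; exact (normSq_pos hX).ne'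
  have h1 : ∀ u, oip (DX u) (L φ u X) = -(m / 2) * oip X X * inner ℝ u u
      - 1 / 2 * inner ℝ u u * oip (c Y) X - 3 / 2 * oip (L φ u (c (L φ u Y))) X := by
    intro u
    rw [h.intX]
    simp only [map_sub, map_add, map_smul, LinearMap.add_apply, LinearMap.sub_apply,
      LinearMap.smul_apply, smul_eq_mul, hφ.oip_L_L_same]
    rw [hφ.oip_L u (c _)]
    ring
  have h2 : oip (c Y) X = l₁ * oip X Y - l₂ * oip X X - m * oip X X := by
    rw [h.extY]
    simp only [map_sub, map_smul, LinearMap.sub_apply,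
      LinearMap.smul_apply, smul_eq_mul, hφ.oip_L_self]
    rw [oip_comm Y X]; ring
  -- The coefficient of ⟨cY, X⟩ is -7/2 from the seven terms |e_i|² and -3/2 from the trace
  -- identity.
  have h3 : ∑ i, oip (DX (onb V i)) (L φ (onb V i) X)
      = -(7 / 2) * m * oip X X - 5 * oip (c Y) X := by
    have h4 := congrArg (fun B => oip B X) (h.trace Y)
    simp only [map_sum, LinearMap.sum_apply] at h4
    simp only [h1, Finset.sum_sub_distrib, ← Finset.mul_sum, h4,
      real_inner_self_eq_norm_sq, (onb V).norm_eq_one]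
    simp [hV]
    ring
  simp only [tau1, torA, ← oip_self, Finset.sum_neg_distrib, ← Finset.mul_sum, h3, h2]
  have h5 := h.constraint hφ
  field_simp
  linarith

/-- Parseval turns the contraction with the 3-form into Clifford products. The trace identity and
the symmetry of c then leave only ⟨uX, cY⟩ and ⟨uY, cX⟩, which the algebraic equations evaluate. -/
lemma IsKillingAt.tau7_eq (hφ : IsVectorCross φ) (hV : Module.finrank ℝ V = 7)
    (h : IsKillingAt φ c l₁ l₂ m d X Y DX DY) (hX : X ≠ 0) (hY : Y = w₀ • X + L φ w X) :
    tau7 (phiA φ X) (torA φ X DX) =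
      (6 * oip X X)⁻¹ • ((9 / 4 * oip X X + 3 / 4 * oip Y Y) • d - (3 * l₁ * oip X X) • w) := by
  have hN : oip X X ≠ 0 := by rw [oip_self]; exact (normSq_pos hX).ne'
  refine sharp_eq fun u => ?_
  have hom : oip (L φ u X) Y = inner ℝ w u * oip X X := by
    rw [hY, map_add, map_smul, hφ.oip_L_self, hφ.oip_L_L, real_inner_comm]; simp
  have hXu : ∀ v, oip X (L φ u (L φ v X)) = -(inner ℝ u v * oip X X) := fun v => by
    rw [← hφ.oip_L_L, hφ.oip_L, neg_neg]
  have hDsum : ∑ i, inner ℝ (onb V i) u * oip X (DX (onb V i)) = oip X (DX u) := by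
    let D : V →ₗ[ℝ] Oct V := -(m / 2) • (L φ).flip X - (1 / 2 : ℝ) • (L φ).flip (c Y)
      + (3 / 2 : ℝ) • c.comp ((L φ).flip Y)
    have hD : ∀ v, DX v = D v := fun v => by rw [h.intX]; rfl
    have := sum_inner_smul (onb V) ((oip X).comp D) u
    simpa only [LinearMap.comp_apply, ← hD, smul_eq_mul] using this
  -- Parseval in the basis X, e_j X; the last term is the correction for the direction X.
  have h1 : ∀ i, ∑ j, phiA φ X u (onb V i) (onb V j) * torA φ X DX (onb V i) (onb V j)
      = -((oip X X)⁻¹ * (oip (L φ u (L φ (onb V i) X)) (DX (onb V i))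
        + inner ℝ (onb V i) u * oip X (DX (onb V i)))) := by
    intro i
    have := hφ.sum_oip (onb V) X (L φ u (L φ (onb V i) X)) (DX (onb V i))
    rw [hXu, real_inner_comm] at this
    calc _ = -((oip X X)⁻¹ ^ 2 * ∑ j, oip (L φ (onb V j) X) (L φ u (L φ (onb V i) X))
          * oip (L φ (onb V j) X) (DX (onb V i))) := by
          rw [Finset.mul_sum, ← Finset.sum_neg_distrib]
          refine Finset.sum_congr rfl fun j _ => ?_
          rw [phiA, torA, ← oip_self, oip_comm (L φ u _), oip_comm (DX _)]
          ring
      _ = _ := by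
          rw [this]
          field_simp
          ring
  have h2 : ∀ v, oip (L φ u (L φ v X)) (DX v) = -(m / 2) * oip (L φ u (L φ v X)) (L φ v X)
      + 1 / 2 * (inner ℝ v v * oip (L φ u X) (c Y)) + inner ℝ v u * oip X (L φ v (c Y))
      + 3 / 2 * oip (L φ u X) (L φ v (c (L φ v Y))) - 3 * (inner ℝ v u * oip (L φ v Y) (c X)) := by
    intro v
    rw [h.intX]
    simp only [map_sub, map_add, map_smul, smul_eq_mul]
    rw [hφ.L_L u v X]
    simp only [map_sub, map_neg, map_smul, LinearMap.sub_apply, LinearMap.neg_apply,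
      LinearMap.smul_apply, smul_eq_mul, hφ.oip_L_L_same]
    rw [hφ.oip_L v (L φ u X) (c _), ← h.symm X, oip_comm (c X), real_inner_comm v u]
    ring
  have h3 : ∑ i, oip (L φ u (L φ (onb V i) X)) (DX (onb V i))
      = 4 * oip (L φ u X) (c Y) - 3 * oip (L φ u Y) (c X) := by
    have h4 := congrArg (fun B => oip (L φ u X) B) (h.trace Y)
    simp only [map_sum] at h4
    have h5 : ∑ i, inner ℝ (onb V i) u * oip X (L φ (onb V i) (c Y)) = oip X (L φ u (c Y)) :=
      sum_inner_smul (onb V) ((oip X).comp ((L φ).flip (c Y))) u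
    have h6 : ∑ i, inner ℝ (onb V i) u * oip (L φ (onb V i) Y) (c X) = oip (L φ u Y) (c X) :=
      sum_inner_smul (onb V) ((oip.flip (c X)).comp ((L φ).flip Y)) u
    simp only [h2, Finset.sum_sub_distrib, Finset.sum_add_distrib, ← Finset.mul_sum, h4, h5, h6,
      hφ.oip_L_self, real_inner_self_eq_norm_sq, (onb V).norm_eq_one]
    have h7 : oip X (L φ u (c Y)) = -oip (L φ u X) (c Y) := by rw [hφ.oip_L, neg_neg]
    rw [h7]
    simp [hV]
    ring
  simp only [h1, Finset.sum_neg_distrib, ← Finset.mul_sum, Finset.sum_add_distrib, hDsum, h3]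
  rw [oip_comm X (DX u), h.oip_DX hφ, h.oip_L_cX hφ, h.oip_L_cY hφ, hom]
  simp only [inner_sub_left, real_inner_smul_left]
  field_simp
  ring

lemma IsKillingAt.tau7_ne_zero (hφ : IsVectorCross φ) (hV : Module.finrank ℝ V = 7)
    (h : IsKillingAt φ c l₁ l₂ m d X Y DX DY) (hX : X ≠ 0) (hY : Y = w₀ • X + L φ w X)
    (hdw : LinearIndependent ℝ ![d, w]) : tau7 (phiA φ X) (torA φ X DX) ≠ 0 := by
  have hN : 0 < oip X X := by rw [oip_self]; exact normSq_pos hX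
  have hM : 0 ≤ oip Y Y := by rw [oip_self, normSq]; positivity
  rw [h.tau7_eq hφ hV hX hY]
  refine smul_ne_zero (by positivity) fun h0 => ?_
  have := (LinearIndependent.pair_iff.mp hdw (9 / 4 * oip X X + 3 / 4 * oip Y Y)
    (-(3 * l₁ * oip X X)) (by rw [neg_smul, ← sub_eq_add_neg, h0])).1
  nlinarith

lemma IsVectorCross.L_L_of_inner_eq_zero (hφ : IsVectorCross φ) {v w : V} (hwv : inner ℝ w v = 0) (A : Oct V) :
    L φ v (L φ w A) = -L φ w (L φ v A) := by
  rw [hφ.L_L v w, real_inner_comm, hwv]; simp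

/-- With w in the first slot c is computable, because wY is a combination of X and Y. -/
lemma IsKillingAt.torA_left (hφ : IsVectorCross φ)
    (h : IsKillingAt φ c l₁ l₂ m d X Y DX DY) (hX : X ≠ 0) (hY : Y = w₀ • X + L φ w X)
    {v : V} (hwv : inner ℝ w v = 0) :
    oip X X * torA φ X DX w v = 3 / 4 * w₀ * (1 + (w₀ ^ 2 + inner ℝ w w)) * oip X X * inner ℝ d v
      - (1 / 4 + 3 / 4 * (w₀ ^ 2 + inner ℝ w w)) * oip (L φ w (L φ d X)) (L φ v X) := by
  have hN : oip X X ≠ 0 := by rw [oip_self]; exact (normSq_pos hX).ne'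
  have hwY : L φ w Y = w₀ • Y - (w₀ ^ 2 + inner ℝ w w) • X := by
    rw [hY, map_add, map_smul, hφ.L_L_self]; module
  rw [torA, ← oip_self, mul_neg, mul_inv_cancel_left₀ hN, h.intX, hwY]
  simp only [map_sub, map_smul]
  rw [h.extX, h.extY, hY]
  simp only [map_sub, map_add, map_smul, hφ.L_L_self, hφ.L_L d w]
  simp only [map_smul, map_neg, LinearMap.add_apply, LinearMap.sub_apply,
    LinearMap.smul_apply, LinearMap.neg_apply, smul_eq_mul, hφ.oip_self_L, hφ.oip_L_L, hwv]
  ring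

/-- With w in the second slot c is moved by symmetry onto wX = Y - w₀X, where it is known. -/
lemma IsKillingAt.torA_right (hφ : IsVectorCross φ)
    (h : IsKillingAt φ c l₁ l₂ m d X Y DX DY) (hX : X ≠ 0) (hY : Y = w₀ • X + L φ w X)
    {v : V} (hwv : inner ℝ w v = 0) :
    oip X X * torA φ X DX v w = 3 / 4 * w₀ * (1 + (w₀ ^ 2 + inner ℝ w w)) * oip X X * inner ℝ d v
      + oip (L φ w (L φ d X)) (L φ v X) := by
  have hN : oip X X ≠ 0 := by rw [oip_self]; exact (normSq_pos hX).ne'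
  have hvw : inner ℝ v w = 0 := by rw [real_inner_comm, hwv]
  have hwX : L φ w X = Y - w₀ • X := by rw [hY]; abel
  have hcw : c (L φ w X) = c Y - w₀ • c X := by rw [hwX, map_sub, map_smul]
  rw [torA, ← oip_self, mul_neg, mul_inv_cancel_left₀ hN, h.intX]
  simp only [map_sub, map_add, map_smul, LinearMap.add_apply, LinearMap.sub_apply,
    LinearMap.smul_apply, h.symm, hcw]
  rw [h.extX, h.extY, hY]
  have e1 : oip (L φ v (L φ w X)) X = 0 := by
    rw [hφ.oip_L, oip_comm, hφ.oip_L_L, hvw]; simp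
  have e2 : oip (L φ v (L φ w X)) (L φ d X) = oip (L φ w (L φ d X)) (L φ v X) := by
    rw [hφ.L_L_of_inner_eq_zero hwv, map_neg, LinearMap.neg_apply, hφ.oip_L w, neg_neg, oip_comm]
  have e3 : oip (L φ v (L φ w X)) (L φ w (L φ d X)) = -(inner ℝ w w * (inner ℝ d v * oip X X)) := by
    rw [hφ.L_L_of_inner_eq_zero hwv, map_neg, LinearMap.neg_apply, hφ.oip_L_L_same, hφ.oip_L_L,
      real_inner_comm v]
  have e5 : oip (L φ v (L φ d X)) (L φ w X) = -oip (L φ w (L φ d X)) (L φ v X) := by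
    rw [hφ.oip_L, oip_comm, e2]
  have e6 : oip (L φ v X) (L φ w (L φ d X)) = oip (L φ w (L φ d X)) (L φ v X) := oip_comm _ _
  simp only [map_sub, map_add, map_smul, hφ.L_L d w]
  simp only [map_neg, LinearMap.add_apply, LinearMap.sub_apply,
    LinearMap.smul_apply, smul_eq_mul, hφ.oip_L_self, hφ.oip_L_L, hvw,
    e1, e2, e3, e5, e6, real_inner_comm d v]
  ring

/-- For independent `d`, `w` the component of `w (d X)` orthogonal to `X` is a nonzero `z X` with
`z` orthogonal to `d` and `w`. -/
lemma exists_L_L_eq (hφ : IsVectorCross φ) (hX : X ≠ 0) (hdw : LinearIndependent ℝ ![d, w]) :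
    ∃ z : V, z ≠ 0 ∧ inner ℝ w z = 0 ∧ inner ℝ d z = 0 ∧
      ∀ v, oip (L φ w (L φ d X)) (L φ v X) = inner ℝ z v * oip X X := by
  have hN : oip X X ≠ 0 := by rw [oip_self]; exact (normSq_pos hX).ne'
  obtain ⟨ρ, z, hz⟩ := hφ.exists_eq hX (L φ w (L φ d X))
  have hv : ∀ v, oip (L φ w (L φ d X)) (L φ v X) = inner ℝ z v * oip X X := fun v => by
    rw [hz]; simp [hφ.oip_self_L, hφ.oip_L_L]
  refine ⟨z, ?_, ?_, ?_, hv⟩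
  · rintro rfl
    -- If z = 0 then w(dX) = ρX; applying w gives (|w|²d + ρw)X = 0, against independence.
    have h1 : L φ w (L φ w (L φ d X)) = ρ • L φ w X := by
      rw [hz]; simp
    rw [hφ.L_L_self] at h1
    have h2 : L φ (inner ℝ w w • d + ρ • w) X = 0 := by
      rw [map_add, LinearMap.add_apply, map_smul, map_smul, LinearMap.smul_apply,
        LinearMap.smul_apply, ← h1]
      abel
    have h3 : inner ℝ w w • d + ρ • w = 0 := by
      rw [← inner_self_eq_zero (𝕜 := ℝ)]
      have := hφ.oip_L_L (inner ℝ w w • d + ρ • w) (inner ℝ w w • d + ρ • w) X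
      rw [h2, map_zero] at this
      simpa [hN] using this.symm
    have h4 := (LinearIndependent.pair_iff.mp hdw _ _ h3).1
    rw [inner_self_eq_zero] at h4
    exact hdw.ne_zero 1 (by simpa using h4)
  · have := hv w
    rw [hφ.oip_L_L_same, hφ.oip_L_self, mul_zero] at this
    rw [real_inner_comm]
    exact (mul_eq_zero.mp this.symm).resolve_right hN
  · have := hv d
    rw [hφ.oip_L_self] at this
    rw [real_inner_comm]
    exact (mul_eq_zero.mp this.symm).resolve_right hN

lemma IsKillingAt.tau14_ne_zero (hφ : IsVectorCross φ) (hV : Module.finrank ℝ V = 7)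
    (h : IsKillingAt φ c l₁ l₂ m d X Y DX DY) (hX : X ≠ 0) (hY : Y = w₀ • X + L φ w X)
    (hdw : LinearIndependent ℝ ![d, w]) : tau14 (phiA φ X) (torA φ X DX) ≠ 0 := by
  have hN : 0 < oip X X := by rw [oip_self]; exact normSq_pos hX
  obtain ⟨z, hz0, hwz, hdz, hz⟩ := exists_L_L_eq hφ hX hdw
  intro h0
  have h1 := congrFun (congrFun h0 w) z
  have hM : oip Y Y = (w₀ ^ 2 + inner ℝ w w) * oip X X := by
    rw [hY]
    simp only [map_add, map_smul, LinearMap.add_apply, LinearMap.smul_apply, smul_eq_mul,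
      hφ.oip_self_L, hφ.oip_L_self, hφ.oip_L_L]
    ring
  have t1 := h.torA_left hφ hX hY hwz
  have t2 := h.torA_right hφ hX hY hwz
  rw [hdz, hz] at t1 t2
  have hφw : phiA φ X (tau7 (phiA φ X) (torA φ X DX)) w z
      = -((6 * oip X X)⁻¹ * ((9 / 4 * oip X X + 3 / 4 * oip Y Y) * inner ℝ z z)) := by
    have e1 : oip (L φ d (L φ w X)) (L φ z X) = -(inner ℝ z z * oip X X) := by
      rw [hφ.L_L d w, ← hz]
      simp [hφ.oip_self_L]
    rw [h.tau7_eq hφ hV hX hY, phiA, ← oip_self]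
    simp only [map_smul, map_sub, LinearMap.smul_apply, LinearMap.sub_apply, e1, smul_eq_mul,
      hφ.L_L_self, map_neg, LinearMap.neg_apply, hφ.oip_self_L]
    field_simp
    ring
  have hzz : 0 < inner ℝ z z := by
    rw [real_inner_self_eq_norm_sq]; have := norm_pos_iff.mpr hz0; positivity
  rw [tau14, hφw, hM] at h1
  have hww : 0 ≤ inner ℝ w w := real_inner_self_nonneg
  have t1' : torA φ X DX w z = -(1 / 4 + 3 / 4 * (w₀ ^ 2 + inner ℝ w w)) * inner ℝ z z := by
    refine mul_left_cancel₀ hN.ne' ?_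
    rw [t1]; ring
  have t2' : torA φ X DX z w = inner ℝ z z := by
    refine mul_left_cancel₀ hN.ne' ?_
    rw [t2]; ring
  rw [t1', t2'] at h1
  change _ = (0 : ℝ) at h1
  -- The skew part of T contributes -(5 + 3r)/8 and τ₇⌟φ contributes -(3 + r)/8; their difference is
  -- -(1 + r)/4, in units of |z|².
  have h2 : (1 / 4 + 1 / 4 * (w₀ ^ 2 + inner ℝ w w)) * inner ℝ z z = 0 := by
    field_simp at h1
    linarith
  have : 0 < (1 / 4 + 1 / 4 * (w₀ ^ 2 + inner ℝ w w)) * inner ℝ z z := by positivity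
  linarith

/-- On w and v ⊥ w the metric term disappears, and the symmetric part of T is a combination of ⟨d,v⟩
and ⟨z,v⟩ with coefficients proportional to w₀(1 + r) and 1 - r; two choices of v isolate them. -/
lemma IsKillingAt.of_tau27_eq_zero (hφ : IsVectorCross φ)
    (h : IsKillingAt φ c l₁ l₂ m d X Y DX DY) (hX : X ≠ 0) (hY : Y = w₀ • X + L φ w X)
    (hdw : LinearIndependent ℝ ![d, w]) (h0 : tau27 (torA φ X DX) = 0) :
    oip X Y = 0 ∧ oip Y Y = oip X X := by
  have hN : 0 < oip X X := by rw [oip_self]; exact normSq_pos hX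
  obtain ⟨z, hz0, hwz, hdz, hz⟩ := exists_L_L_eq hφ hX hdw
  have hP : oip X Y = w₀ * oip X X := by
    rw [hY, map_add, map_smul, hφ.oip_self_L]; simp
  have hM : oip Y Y = (w₀ ^ 2 + inner ℝ w w) * oip X X := by
    rw [hY]
    simp only [map_add, map_smul, LinearMap.add_apply, LinearMap.smul_apply, smul_eq_mul,
      hφ.oip_self_L, hφ.oip_L_self, hφ.oip_L_L]
    ring
  have key : ∀ v, inner ℝ w v = 0 →
      3 / 2 * w₀ * (1 + (w₀ ^ 2 + inner ℝ w w)) * inner ℝ d v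
        + 3 / 4 * (1 - (w₀ ^ 2 + inner ℝ w w)) * inner ℝ z v = 0 := by
    intro v hv
    have h1 := congrFun (congrFun h0 w) v
    change _ = (0 : ℝ) at h1
    have t1 := h.torA_left hφ hX hY hv
    have t2 := h.torA_right hφ hX hY hv
    rw [hz] at t1 t2
    rw [tau27, hv] at h1
    refine mul_left_cancel₀ hN.ne' ?_
    have h2 : torA φ X DX w v + torA φ X DX v w = 0 := by linarith
    have h3 : oip X X * torA φ X DX w v + oip X X * torA φ X DX v w = 0 := by rw [← mul_add, h2, mul_zero]
    rw [t1, t2] at h3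
    linarith
  have hzz : inner ℝ z z ≠ 0 := inner_self_ne_zero.mpr hz0
  have hw0 : w ≠ 0 := by simpa using hdw.ne_zero 1
  have hww : inner ℝ w w ≠ 0 := inner_self_ne_zero.mpr hw0
  -- Taking v = z, which is orthogonal to d, isolates 1 - r.
  have hr : 1 - (w₀ ^ 2 + inner ℝ w w) = 0 := by
    have := key z hwz
    rw [hdz, mul_zero, zero_add] at this
    have := (mul_eq_zero.mp this).resolve_right hzz
    linarith
  constructor
  -- A multiple of the part of d orthogonal to w; with r = 1 it isolates w₀.
  · set v := inner ℝ w w • d - inner ℝ w d • w with hv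
    have hwv : inner ℝ w v = 0 := by
      rw [hv, inner_sub_right, real_inner_smul_right, real_inner_smul_right]; ring
    have hdv : inner ℝ d v ≠ 0 := by
      intro h0
      have h1 : inner ℝ v v = 0 := by
        conv_lhs => rw [hv]
        rw [inner_sub_left, real_inner_smul_left, real_inner_smul_left, h0, hwv]; ring
      rw [inner_self_eq_zero] at h1
      exact hww (LinearIndependent.pair_iff.mp hdw (inner ℝ w w) (-inner ℝ w d)
        (by rw [neg_smul, ← sub_eq_add_neg, ← hv, h1])).1
    have h1 := key v hwv
    rw [hr, mul_zero, zero_mul, add_zero] at h1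
    have h2 := (mul_eq_zero.mp h1).resolve_right hdv
    have h3 : w₀ = 0 := by
      rw [show 1 + (w₀ ^ 2 + inner ℝ w w) = 2 by linarith] at h2
      linarith
    rw [hP, h3, zero_mul]
  · rw [hM, show w₀ ^ 2 + inner ℝ w w = 1 by linarith, one_mul]

/-- The imaginary part `w` of `Y X⁻¹` satisfies `Y = w₀ X + w X`. -/
lemma exists_eq_of_oinv (hφ : IsVectorCross φ) (hX : X ≠ 0)
    (hw : w = (omul (form φ) Y (oinv X)).2) : ∃ w₀ : ℝ, Y = w₀ • X + L φ w X := by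
  have hN : normSq X ≠ 0 := (normSq_pos hX).ne'
  obtain ⟨b, v, hv⟩ := hφ.exists_eq hX Y
  refine ⟨b, ?_⟩
  suffices w = v by rw [this, ← hv]
  refine ext_inner_right ℝ fun u => ?_
  have h1 : oip (L φ u X) Y = inner ℝ v u * normSq X := by
    rw [hv, map_add, map_smul, hφ.oip_L_self, hφ.oip_L_L, real_inner_comm, oip_self]; simp
  have h2 : inner ℝ w u = (normSq X)⁻¹ * oip (L φ u X) Y := by
    have e1 : cross (form φ) Y.2 (oinv X).2 = -(normSq X)⁻¹ • cross (form φ) Y.2 X.2 := by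
      simp only [oinv, Prod.smul_snd, smul_neg, ← neg_smul, cross_smul_right]
    rw [hw, omul]
    simp only [e1, inner_add_left, real_inner_smul_left, inner_cross]
    simp only [oinv, Prod.smul_fst, Prod.smul_snd, smul_eq_mul, real_inner_smul_left,
      inner_neg_left, oip_apply, L_fst, L_snd, inner_add_left, inner_cross]
    rw [hφ.swap_left Y.2 X.2 u, hφ.swap_right X.2 Y.2 u, hφ.swap_left X.2 u, real_inner_comm u Y.2,
      real_inner_comm u X.2]
    ring
  rw [h2, h1]
  field_simp

end Pointwise

/-! ### Differentiability of vector fields on a Riemannian manifold. -/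

section Calculus

variable {M : Type*} [TopologicalSpace M] [ChartedSpace (EuclideanSpace ℝ (Fin 7)) M]
  [IsManifold (𝓡 7) ∞ M]

/-- Differentiability at a point of a vector field. -/
abbrev DiffVF (s : ∀ q : M, T7 q) (p : M) : Prop :=
  MDifferentiableAt (𝓡 7) ((𝓡 7).prod 𝓘(ℝ, EuclideanSpace ℝ (Fin 7)))
    (fun q => (TotalSpace.mk' (EuclideanSpace ℝ (Fin 7)) q (s q) :
      TotalSpace (EuclideanSpace ℝ (Fin 7)) (fun q : M => T7 q))) p

/-- Differentiability at a point of a real function. -/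
abbrev DiffFun (f : M → ℝ) (p : M) : Prop := MDifferentiableAt (𝓡 7) 𝓘(ℝ, ℝ) f p

/-- A vector field extending a tangent vector. -/
noncomputable abbrev extVF {p : M} (v : T7 p) : ∀ q : M, T7 q :=
  FiberBundle.extend (EuclideanSpace ℝ (Fin 7)) v

set_option synthInstance.maxHeartbeats 200000 in
instance instContMDiffVectorBundleT7 :
    ContMDiffVectorBundle 1 (EuclideanSpace ℝ (Fin 7)) (fun p : M => T7 p) (𝓡 7) :=
  inferInstance

lemma diffVF_extVF {p : M} (v : T7 p) : DiffVF (extVF v) p :=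
  FiberBundle.mdifferentiableAt_extend (𝓡 7) (EuclideanSpace ℝ (Fin 7)) v

lemma DiffVF.add {s t : ∀ q : M, T7 q} {p : M} (hs : DiffVF s p) (ht : DiffVF t p) :
    DiffVF (fun q => s q + t q) p :=
  mdifferentiableAt_add_section hs ht

lemma DiffVF.smul {f : M → ℝ} {t : ∀ q : M, T7 q} {p : M} (hf : DiffFun f p) (ht : DiffVF t p) :
    DiffVF (fun q => f q • t q) p :=
  hf.smul_section ht

variable [RiemannianBundle (fun p : M => T7 p)]
  [IsContMDiffRiemannianBundle (𝓡 7) ∞ (EuclideanSpace ℝ (Fin 7)) (fun p : M => T7 p)]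

set_option synthInstance.maxHeartbeats 400000 in
instance instIsContMDiffRiemannianBundleT7 :
    IsContMDiffRiemannianBundle (𝓡 7) 1 (EuclideanSpace ℝ (Fin 7)) (fun p : M => T7 p) :=
  inferInstance

lemma DiffVF.inner {s t : ∀ q : M, T7 q} {p : M} (hs : DiffVF s p) (ht : DiffVF t p) :
    DiffFun (fun q => inner ℝ (s q) (t q)) p :=
  MDifferentiableAt.inner_bundle hs ht

lemma DiffFun.sum {ι : Type} {f : ι → M → ℝ} {t : Finset ι} {p : M}
    (h : ∀ i ∈ t, DiffFun (f i) p) : DiffFun (fun q => ∑ i ∈ t, f i q) p := by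
  have : DiffFun (∑ i ∈ t, f i) p := MDifferentiableAt.sum h
  convert this using 1
  funext q
  simp

lemma DiffFun.prod {ι : Type} {f : ι → M → ℝ} {t : Finset ι} {p : M}
    (h : ∀ i ∈ t, DiffFun (f i) p) : DiffFun (fun q => ∏ i ∈ t, f i q) p := by
  have : DiffFun (∏ i ∈ t, f i) p := MDifferentiableAt.prod h
  convert this using 1
  funext q
  simp

lemma DiffFun.det {n : Type} [Fintype n] [DecidableEq n] {A : M → Matrix n n ℝ} {p : M}
    (h : ∀ i j, DiffFun (fun q => A q i j) p) : DiffFun (fun q => (A q).det) p := by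
  simp only [Matrix.det_apply, Units.smul_def, zsmul_eq_mul]
  exact DiffFun.sum fun σ _ => (mdifferentiableAt_const).mul (DiffFun.prod fun i _ => h _ _)

/-- Near each point there is a frame of fields differentiable there. -/
lemma exists_frame (p : M) : ∃ E : Fin 7 → ∀ q : M, T7 q, (∀ i, DiffVF (E i) p) ∧
    ∃ c : Fin 7 → ∀ q : M, T7 q →ₗ[ℝ] ℝ,
      (∀ s, DiffVF s p → ∀ i, DiffFun (fun q => c i q (s q)) p) ∧
      (∀ s, (∀ i, DiffFun (fun q => c i q (s q)) p) → DiffVF s p) ∧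
      ∀ᶠ q in nhds p, LinearIndependent ℝ (fun i => E i q) ∧ ∀ v, v = ∑ i, c i q v • E i q := by
  let t := trivializationAt (EuclideanSpace ℝ (Fin 7)) (fun p : M => T7 p) p
  have hp : p ∈ t.baseSet := FiberBundle.mem_baseSet_trivializationAt _ _ p
  let b := (EuclideanSpace.basisFun (Fin 7) ℝ).toBasis
  have hfr := t.isLocalFrameOn_localFrame_baseSet (𝓡 7) 1 b
  refine ⟨t.localFrame b, fun i => (contMDiffAt_localFrame_of_mem 1 _ b i hp).mdifferentiableAt
    (by simp), t.localFrameCoeff (𝓡 7) b,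
    fun s hs i => mdifferentiableAt_localFrameCoeff b hp hs i,
    fun s hs => (mdifferentiableAt_iff_localFrameCoeff b hp).mpr hs, ?_⟩
  filter_upwards [t.open_baseSet.mem_nhds hp] with q hq
  refine ⟨hfr.linearIndependent hq, fun v => ?_⟩
  have := t.eq_sum_localFrameCoeff_smul (I := 𝓡 7) (b := b) (s := extVF v) hq
  rwa [extVF, FiberBundle.extend_apply_self] at this

/-- A field whose inner products with differentiable fields are differentiable is differentiable. -/
lemma diffVF_of_inner {s : ∀ q : M, T7 q} {p : M}
    (h : ∀ E : ∀ q : M, T7 q, DiffVF E p → DiffFun (fun q => inner ℝ (s q) (E q)) p) :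
    DiffVF s p := by
  obtain ⟨E, hE, c, -, hc, hfr⟩ := exists_frame p
  refine hc s fun j => ?_
  -- The frame is not orthonormal, so the coefficients of s solve a linear system with the Gram
  -- matrix; Cramer's rule shows that they are differentiable.
  let g : M → Matrix (Fin 7) (Fin 7) ℝ := fun q => .of fun i k => inner ℝ (E k q) (E i q)
  let r : M → Fin 7 → ℝ := fun q i => inner ℝ (s q) (E i q)
  have hg : ∀ i k, DiffFun (fun q => g q i k) p := fun i k => (hE k).inner (hE i)
  have hdet : (g p).det ≠ 0 := by
    intro h0
    obtain ⟨v, hv0, hv⟩ := Matrix.exists_mulVec_eq_zero_iff.mpr h0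
    have hli := hfr.self_of_nhds.1
    have h1 : ∑ k, v k • E k p = 0 := by
      rw [← inner_self_eq_zero (𝕜 := ℝ)]
      conv_lhs => rw [inner_sum]
      refine Finset.sum_eq_zero fun i _ => ?_
      have := congrFun hv i
      simp only [Matrix.mulVec, dotProduct, g, Matrix.of_apply, Pi.zero_apply] at this
      rw [real_inner_smul_right, sum_inner]
      simp only [real_inner_smul_left]
      rw [← mul_zero (v i), ← this]
      congr 1
      exact Finset.sum_congr rfl fun k _ => mul_comm _ _
    exact hv0 (funext fun k => Fintype.linearIndependent_iff.mp hli v h1 k)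
  have hcr : DiffFun (fun q => (g q).cramer (r q) j) p := by
    simp only [Matrix.cramer_apply]
    refine DiffFun.det fun i k => ?_
    by_cases hk : k = j
    · subst hk
      simpa only [Matrix.updateCol_self] using h (E i) (hE i)
    · simpa only [Matrix.updateCol_ne hk] using hg i k
  have hq : DiffFun (fun q => (g q).cramer (r q) j * ((g q).det)⁻¹) p :=
    hcr.mul ((DiffFun.det hg).inv hdet)
  refine hq.congr_of_eventuallyEq ?_
  have hdet' : ∀ᶠ q in nhds p, (g q).det ≠ 0 :=
    (DiffFun.det hg).continuousAt.eventually_ne hdet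
  filter_upwards [hfr, hdet'] with q hq hd
  have h1 : (g q).mulVec (fun k => c k q (s q)) = r q := by
    funext i
    simp only [Matrix.mulVec, dotProduct, g, r, Matrix.of_apply]
    conv_rhs => rw [hq.2 (s q), sum_inner]
    exact Finset.sum_congr rfl fun k _ => by rw [real_inner_smul_left, mul_comm]
  rw [← h1, Matrix.cramer_eq_adjugate_mulVec, Matrix.mulVec_mulVec, Matrix.adjugate_mul]
  simp only [Matrix.smul_mulVec, Matrix.one_mulVec, Pi.smul_apply, smul_eq_mul]
  field_simp

end Calculus

/-! ### The covariant derivative of a G₂-structure. -/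

section Pointwise

variable {V : Type*} [NormedAddCommGroup V] [InnerProductSpace ℝ V]

/-- The trilinear map underlying a continuous one. -/
noncomputable def tri (f : V →L[ℝ] V →L[ℝ] V →L[ℝ] ℝ) : V →ₗ[ℝ] V →ₗ[ℝ] V →ₗ[ℝ] ℝ where
  toFun u :=
    { toFun := fun v => (f u v).toLinearMap
      map_add' := fun v v' => by ext w; simp
      map_smul' := fun c v => by ext w; simp }
  map_add' u u' := by ext v w; change f (u + u') v w = _; rw [f.map_add]; rfl
  map_smul' c u := by ext v w; change f (c • u) v w = _; rw [f.map_smul]; rfl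

lemma exists_trilinear {f : V → V → V → ℝ} (h₁ : ∀ v w, IsLinearMap ℝ fun u => f u v w)
    (h₂ : ∀ u w, IsLinearMap ℝ fun v => f u v w) (h₃ : ∀ u v, IsLinearMap ℝ fun w => f u v w) :
    ∃ κ : V →ₗ[ℝ] V →ₗ[ℝ] V →ₗ[ℝ] ℝ, ∀ u v w, κ u v w = f u v w :=
  ⟨{ toFun := fun u =>
      { toFun := fun v => (h₃ u v).mk'
        map_add' := fun v v' => by ext w; exact (h₂ u w).map_add v v'
        map_smul' := fun c v => by ext w; exact (h₂ u w).map_smul c v }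
     map_add' := fun u u' => by ext v w; exact (h₁ v w).map_add u u'
     map_smul' := fun c u => by ext v w; exact (h₁ v w).map_smul c u }, fun _ _ _ => rfl⟩

lemma IsVectorCross.inner_cross_cross_right [FiniteDimensional ℝ V]
    {φ : V →ₗ[ℝ] V →ₗ[ℝ] V →ₗ[ℝ] ℝ} (hφ : IsVectorCross φ) (u v w : V) :
    inner ℝ (cross (form φ) u w) (cross (form φ) v w)
    = inner ℝ u v * inner ℝ w w - inner ℝ u w * inner ℝ v w := by
  rw [hφ.cross_swap u w, hφ.cross_swap v w, inner_neg_neg, hφ.inner_cross_cross,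
    real_inner_comm u w, real_inner_comm v w]
  ring

end Pointwise

section Calculus

variable {M : Type*} [TopologicalSpace M] [ChartedSpace (EuclideanSpace ℝ (Fin 7)) M]
  [IsManifold (𝓡 7) ∞ M] [RiemannianBundle (fun p : M => T7 p)]
  [IsContMDiffRiemannianBundle (𝓡 7) ∞ (EuclideanSpace ℝ (Fin 7)) (fun p : M => T7 p)]
  {o : ∀ p : M, Orientation ℝ (T7 p) (Fin 7)}
  {φ : ∀ p : M, T7 p →L[ℝ] T7 p →L[ℝ] T7 p →L[ℝ] ℝ}
  {nabla : CovariantDerivative (𝓡 7) (EuclideanSpace ℝ (Fin 7)) (fun p : M => T7 p)}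

lemma IsG2Structure.exists_adapted (hφ : IsG2Structure o φ) (p : M) :
    ∃ e : OrthonormalBasis (Fin 7) ℝ (T7 p), e.toBasis.orientation = o p ∧ IsAdapted (tri (φ p)) e :=
  hφ.adapted p

lemma IsG2Structure.isVectorCross (hφ : IsG2Structure o φ) (p : M) : IsVectorCross (tri (φ p)) := by
  obtain ⟨e, -, he⟩ := hφ.exists_adapted p
  exact he.isVectorCross

/-- The smoothness hypothesis concerns smooth fields only. Expanding in a smooth local frame extends
it to fields that are merely differentiable at p. -/
lemma IsG2Structure.diff (hφ : IsG2Structure o φ) {p : M} {a b c : ∀ q : M, T7 q}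
    (ha : DiffVF a p) (hb : DiffVF b p) (hc : DiffVF c p) :
    DiffFun (fun q => tri (φ q) (a q) (b q) (c q)) p := by
  let t := trivializationAt (EuclideanSpace ℝ (Fin 7)) (fun p : M => T7 p) p
  have hp : p ∈ t.baseSet := FiberBundle.mem_baseSet_trivializationAt _ _ p
  let β := (EuclideanSpace.basisFun (Fin 7) ℝ).toBasis
  let E := t.localFrame β
  let k := t.localFrameCoeff (𝓡 7) β
  have hE : ∀ i, ContMDiffAt (𝓡 7) (𝓡 7).tangent ∞
      (fun q => (⟨q, E i q⟩ : TangentBundle (𝓡 7) M)) p := fun i =>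
    contMDiffAt_localFrame_of_mem ∞ _ β i hp
  have hk : ∀ s : ∀ q : M, T7 q, DiffVF s p → ∀ i, DiffFun (fun q => k i q (s q)) p := fun s hs i =>
    mdifferentiableAt_localFrameCoeff β hp hs i
  have hE3 : ∀ i j l, DiffFun (fun q => φ q (E i q) (E j q) (E l q)) p := fun i j l =>
    (hφ.smooth p _ _ _ (hE i) (hE j) (hE l)).mdifferentiableAt (by simp)
  have hsum : DiffFun (fun q => ∑ i, ∑ j, ∑ l, k i q (a q) * (k j q (b q) * (k l q (c q)
      * φ q (E i q) (E j q) (E l q)))) p :=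
    DiffFun.sum fun i _ => DiffFun.sum fun j _ => DiffFun.sum fun l _ =>
      (hk a ha i).mul ((hk b hb j).mul ((hk c hc l).mul (hE3 i j l)))
  refine hsum.congr_of_eventuallyEq ?_
  filter_upwards [t.open_baseSet.mem_nhds hp] with q hq
  have hs : ∀ s : ∀ q : M, T7 q, s q = ∑ i, k i q (s q) • E i q := fun s =>
    t.eq_sum_localFrameCoeff_smul (I := 𝓡 7) (b := β) (s := s) hq
  change tri (φ q) (a q) (b q) (c q) = ∑ i, ∑ j, ∑ l, k i q (a q) * (k j q (b q) * (k l q (c q)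
      * tri (φ q) (E i q) (E j q) (E l q)))
  conv_lhs => rw [hs a, hs b, hs c]
  simp only [map_sum, map_smul, LinearMap.sum_apply, LinearMap.smul_apply, smul_eq_mul,
    Finset.mul_sum]
  rw [← sum_reverse₃]
  exact Finset.sum_congr rfl fun i _ => Finset.sum_congr rfl fun j _ =>
    Finset.sum_congr rfl fun l _ => by ring

/-- The cross product of the `G₂`-structure at a point. -/
noncomputable abbrev crossAt (φ : ∀ p : M, T7 p →L[ℝ] T7 p →L[ℝ] T7 p →L[ℝ] ℝ) {p : M}
    (u v : T7 p) : T7 p := cross (form (tri (φ p))) u v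

lemma IsG2Structure.diff_cross (hφ : IsG2Structure o φ) {p : M} {a b : ∀ q : M, T7 q}
    (ha : DiffVF a p) (hb : DiffVF b p) : DiffVF (fun q => crossAt φ (a q) (b q)) p :=
  diffVF_of_inner fun E hE => by
    simpa only [crossAt, inner_cross] using hφ.diff ha hb hE

lemma DiffFun.mul' {f g : M → ℝ} {p : M} (hf : DiffFun f p) (hg : DiffFun g p) :
    DiffFun (fun q => f q * g q) p := MDifferentiableAt.mul hf hg

lemma DiffFun.add' {f g : M → ℝ} {p : M} (hf : DiffFun f p) (hg : DiffFun g p) :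
    DiffFun (fun q => f q + g q) p := MDifferentiableAt.add hf hg

lemma DiffFun.neg' {f : M → ℝ} {p : M} (hf : DiffFun f p) :
    DiffFun (fun q => -f q) p := MDifferentiableAt.neg hf

lemma mvfderiv_inner_vf (hm : nabla.IsMetricCompatible) {p : M} {s t : ∀ q : M, T7 q}
    (hs : DiffVF s p) (ht : DiffVF t p) (u : T7 p) :
    mvfderiv (𝓡 7) (fun q => inner ℝ (s q) (t q)) p u
      = inner ℝ (nabla s p u) (t p) + inner ℝ (s p) (nabla t p u) := by
  have := hm.mvfderiv_inner_eq (extVF u) hs ht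
  simpa only [extVF, FiberBundle.extend_apply_self] using this

lemma nabla_add {p : M} {s t : ∀ q : M, T7 q} (hs : DiffVF s p) (ht : DiffVF t p) (u : T7 p) :
    nabla (s + t) p u = nabla s p u + nabla t p u := by
  rw [nabla.isCovariantDerivativeOn.add hs ht]; rfl

lemma nabla_smul {p : M} {f : M → ℝ} {s : ∀ q : M, T7 q} (hf : DiffFun f p) (hs : DiffVF s p)
    (u : T7 p) :
    nabla (f • s) p u = f p • nabla s p u + mvfderiv (𝓡 7) f p u • s p := by
  rw [nabla.isCovariantDerivativeOn.leibniz hs hf]; rfl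

lemma mvfderiv_add_apply {p : M} {f g : M → ℝ} (hf : DiffFun f p) (hg : DiffFun g p) (u : T7 p) :
    mvfderiv (𝓡 7) (fun q => f q + g q) p u = mvfderiv (𝓡 7) f p u + mvfderiv (𝓡 7) g p u := by
  rw [mvfderiv_fun_add hf hg]; rfl

lemma mvfderiv_mul_apply {p : M} {f g : M → ℝ} (hf : DiffFun f p) (hg : DiffFun g p) (u : T7 p) :
    mvfderiv (𝓡 7) (fun q => f q * g q) p u
      = f p * mvfderiv (𝓡 7) g p u + g p * mvfderiv (𝓡 7) f p u := by
  rw [mvfderiv_fun_mul hf hg]; rfl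

lemma mvfderiv_neg_apply {p : M} {f : M → ℝ} (u : T7 p) :
    mvfderiv (𝓡 7) (fun q => -f q) p u = -mvfderiv (𝓡 7) f p u := by
  rw [mvfderiv_fun_neg]; rfl

/-- The covariant derivative of `φ` evaluated on vector fields. -/
noncomputable def fieldDeriv
    (nabla : CovariantDerivative (𝓡 7) (EuclideanSpace ℝ (Fin 7)) (fun p : M => T7 p))
    (φ : ∀ p : M, T7 p →L[ℝ] T7 p →L[ℝ] T7 p →L[ℝ] ℝ) (p : M) (u : T7 p)
    (a b c : ∀ q : M, T7 q) : ℝ :=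
  mvfderiv (𝓡 7) (fun q => tri (φ q) (a q) (b q) (c q)) p u
    - tri (φ p) (nabla a p u) (b p) (c p) - tri (φ p) (a p) (nabla b p u) (c p)
    - tri (φ p) (a p) (b p) (nabla c p u)

/-- The derivative of f from the Leibniz rule of the function cancels that of the connection.
Alternation transfers this to the other slots. -/
lemma IsG2Structure.tensorial₁ (hφ : IsG2Structure o φ) {p : M} (u : T7 p) {b c : ∀ q : M, T7 q}
    (hb : DiffVF b p) (hc : DiffVF c p) :
    TensorialAt (𝓡 7) (EuclideanSpace ℝ (Fin 7)) (fun a => fieldDeriv nabla φ p u a b c) p where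
  smul {f σ} hf hσ := by
    simp only [fieldDeriv, Pi.smul_apply', map_smul, LinearMap.smul_apply, smul_eq_mul]
    rw [mvfderiv_mul_apply hf (hφ.diff hσ hb hc), nabla_smul hf hσ]
    simp only [map_add, map_smul, LinearMap.add_apply, LinearMap.smul_apply, smul_eq_mul]
    ring
  add {σ σ'} hσ hσ' := by
    simp only [fieldDeriv, Pi.add_apply, map_add, LinearMap.add_apply]
    rw [mvfderiv_add_apply (hφ.diff hσ hb hc) (hφ.diff hσ' hb hc), nabla_add hσ hσ']
    simp only [map_add, LinearMap.add_apply]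
    ring

lemma IsG2Structure.fieldDeriv_swap₁₂ (hφ : IsG2Structure o φ) (p : M) (u : T7 p)
    (a b c : ∀ q : M, T7 q) : fieldDeriv nabla φ p u a b c = -fieldDeriv nabla φ p u b a c := by
  have h := fun q => (hφ.isVectorCross q).swap_left
  simp only [fieldDeriv, h _ (a _), h p (nabla a p u), mvfderiv_neg_apply]
  ring

lemma IsG2Structure.fieldDeriv_swap₂₃ (hφ : IsG2Structure o φ) (p : M) (u : T7 p)
    (a b c : ∀ q : M, T7 q) : fieldDeriv nabla φ p u a b c = -fieldDeriv nabla φ p u a c b := by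
  have h := fun q => (hφ.isVectorCross q).swap_right
  simp only [fieldDeriv, h _ _ (b _), h p _ (nabla b p u), mvfderiv_neg_apply]
  ring

lemma IsG2Structure.tensorial₂ (hφ : IsG2Structure o φ) {p : M} (u : T7 p) {a c : ∀ q : M, T7 q}
    (ha : DiffVF a p) (hc : DiffVF c p) :
    TensorialAt (𝓡 7) (EuclideanSpace ℝ (Fin 7)) (fun b => fieldDeriv nabla φ p u a b c) p where
  smul hf hσ := by
    rw [hφ.fieldDeriv_swap₁₂, (hφ.tensorial₁ u ha hc).smul hf hσ, hφ.fieldDeriv_swap₁₂ p u a,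
      smul_neg]
  add hσ hσ' := by
    rw [hφ.fieldDeriv_swap₁₂, (hφ.tensorial₁ u ha hc).add hσ hσ', hφ.fieldDeriv_swap₁₂ p u a,
      hφ.fieldDeriv_swap₁₂ p u a, neg_add]

lemma IsG2Structure.tensorial₃ (hφ : IsG2Structure o φ) {p : M} (u : T7 p) {a b : ∀ q : M, T7 q}
    (ha : DiffVF a p) (hb : DiffVF b p) :
    TensorialAt (𝓡 7) (EuclideanSpace ℝ (Fin 7)) (fun c => fieldDeriv nabla φ p u a b c) p where
  smul hf hσ := by
    rw [hφ.fieldDeriv_swap₂₃, (hφ.tensorial₂ u ha hb).smul hf hσ, hφ.fieldDeriv_swap₂₃ p u a b,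
      smul_neg]
  add hσ hσ' := by
    rw [hφ.fieldDeriv_swap₂₃, (hφ.tensorial₂ u ha hb).add hσ hσ', hφ.fieldDeriv_swap₂₃ p u a b,
      hφ.fieldDeriv_swap₂₃ p u a b, neg_add]

lemma formDeriv_eq (p : M) (u a b c : T7 p) :
    formDeriv nabla (fun p u v w => φ p u v w) p u a b c
      = fieldDeriv nabla φ p u (extVF a) (extVF b) (extVF c) := by
  simp only [formDeriv, fieldDeriv, extVF, FiberBundle.extend_apply_self]
  rfl

/-- Tensoriality frees the derivative from the particular extensions in `formDeriv`, so that fields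
such as b × c can be inserted. -/
lemma IsG2Structure.fieldDeriv_eq (hφ : IsG2Structure o φ) {p : M} (u : T7 p)
    {a b c : ∀ q : M, T7 q} (ha : DiffVF a p) (hb : DiffVF b p) (hc : DiffVF c p) :
    fieldDeriv nabla φ p u a b c
      = formDeriv nabla (fun p u v w => φ p u v w) p u (a p) (b p) (c p) := by
  have he : ∀ a : ∀ q : M, T7 q, a p = extVF (a p) p := fun a => by
    rw [extVF, FiberBundle.extend_apply_self]
  rw [formDeriv_eq, (hφ.tensorial₁ u hb hc).pointwise ha (diffVF_extVF (a p)) (he a),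
    (hφ.tensorial₂ u (diffVF_extVF (a p)) hc).pointwise hb (diffVF_extVF (b p)) (he b),
    (hφ.tensorial₃ u (diffVF_extVF (a p)) (diffVF_extVF (b p))).pointwise hc
      (diffVF_extVF (c p)) (he c)]

lemma TensorialAt.isLinearMap_extVF {p : M} {Φ : (∀ q : M, T7 q) → ℝ}
    (h : TensorialAt (𝓡 7) (EuclideanSpace ℝ (Fin 7)) Φ p) :
    IsLinearMap ℝ fun v : T7 p => Φ (extVF v) :=
  ⟨fun v w => (TensorialAt.mkHom Φ p h).map_add v w,
    fun c v => (TensorialAt.mkHom Φ p h).map_smul c v⟩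

/-- The covariant derivative of a `G₂`-structure for a metric connection is a contraction of the
dual 4-form. -/
lemma IsG2Structure.exists_formDeriv_eq (hφ : IsG2Structure o φ) (hm : nabla.IsMetricCompatible)
    (p : M) (u : T7 p) : ∃ t : T7 p, ∀ a b c,
      formDeriv nabla (fun p u v w => φ p u v w) p u a b c
        = 2 * psiA (tri (φ p)) ((1, 0) : Oct (T7 p)) t a b c := by
  have hE := fun v : T7 p => diffVF_extVF v
  have hEp : ∀ v : T7 p, extVF v p = v := fun v => FiberBundle.extend_apply_self _ v
  obtain ⟨κ, hκ⟩ := exists_trilinear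
    (f := fun a b c : T7 p => fieldDeriv nabla φ p u (extVF a) (extVF b) (extVF c))
    (fun b c => TensorialAt.isLinearMap_extVF (hφ.tensorial₁ u (hE b) (hE c)))
    (fun a c => TensorialAt.isLinearMap_extVF (hφ.tensorial₂ u (hE a) (hE c)))
    (fun a b => TensorialAt.isLinearMap_extVF (hφ.tensorial₃ u (hE a) (hE b)))
  have h0 : ∀ b c, κ b c (cross (form (tri (φ p))) b c) = 0 := by
    intro b c
    have hφp := hφ.isVectorCross p
    have hB := hE b
    have hC := hE c
    have hBC : DiffVF (fun q => crossAt φ (extVF b q) (extVF c q)) p := hφ.diff_cross hB hC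
    have hbc : crossAt φ (extVF b p) (extVF c p) = cross (form (tri (φ p))) b c := by rw [hEp, hEp]
    have e1 : κ b c (cross (form (tri (φ p))) b c)
        = fieldDeriv nabla φ p u (extVF b) (extVF c) (fun q => crossAt φ (extVF b q) (extVF c q)) := by
      rw [hκ, hφ.fieldDeriv_eq u hB hC (hE _), hφ.fieldDeriv_eq u hB hC hBC, hbc, hEp, hEp, hEp]
    -- Differentiating |b × c|² = |b|²|c|² - ⟨b,c⟩² on both sides gives κ(b, c, b × c) = 0, the
    -- condition of `exists_eq_psiA`.
    have e2 := mvfderiv_inner_vf hm hBC hBC u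
    have hfun : (fun q => inner ℝ (crossAt φ (extVF b q) (extVF c q))
        (crossAt φ (extVF b q) (extVF c q))) = fun q => inner ℝ (extVF b q) (extVF b q)
          * inner ℝ (extVF c q) (extVF c q)
          + -(inner ℝ (extVF b q) (extVF c q) * inner ℝ (extVF b q) (extVF c q)) := by
      funext q
      rw [crossAt, (hφ.isVectorCross q).norm_cross]; ring
    have e3 := e2
    rw [hfun, mvfderiv_add_apply ((hB.inner hB).mul' (hC.inner hC))
      ((hB.inner hC).mul' (hB.inner hC)).neg', mvfderiv_neg_apply,
      mvfderiv_mul_apply (hB.inner hB) (hC.inner hC), mvfderiv_mul_apply (hB.inner hC) (hB.inner hC),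
      mvfderiv_inner_vf hm hB hB, mvfderiv_inner_vf hm hC hC, mvfderiv_inner_vf hm hB hC] at e3
    rw [e1, fieldDeriv]
    have hf2 : (fun q => tri (φ q) (extVF b q) (extVF c q) (crossAt φ (extVF b q) (extVF c q)))
        = fun q => inner ℝ (crossAt φ (extVF b q) (extVF c q))
            (crossAt φ (extVF b q) (extVF c q)) := by
      funext q
      rw [crossAt, inner_cross]
    rw [hf2, e2]
    set B' := nabla (extVF b) p u
    set C' := nabla (extVF c) p u
    set K' := nabla (fun q => crossAt φ (extVF b q) (extVF c q)) p u
    simp only [crossAt, hEp] at e3 ⊢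
    have q1 := inner_cross (tri (φ p)) B' c (cross (form (tri (φ p))) b c)
    have q2 := inner_cross (tri (φ p)) b C' (cross (form (tri (φ p))) b c)
    rw [hφp.inner_cross_cross_right] at q1
    rw [hφp.inner_cross_cross] at q2
    rw [← q1, ← q2, ← inner_cross (tri (φ p)) b c K', real_inner_comm K']
    rw [real_inner_comm K'] at e3
    simp only [real_inner_comm B' b, real_inner_comm C' c, real_inner_comm C' b] at e3 ⊢
    linear_combination (-1 / 2) * e3
  obtain ⟨e, -, he⟩ := hφ.exists_adapted p
  obtain ⟨t, ht⟩ := he.exists_eq_psiA κ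
    (fun a b c => by rw [hκ, hκ, hφ.fieldDeriv_swap₁₂])
    (fun a b c => by rw [hκ, hκ, hφ.fieldDeriv_swap₂₃]) h0
  exact ⟨t, fun a b c => by rw [formDeriv_eq, ← hκ, ht]⟩

end Calculus

/-! ### Right multiplication, associators and the variation of `phiA`. -/

section Pointwise

variable {V : Type*} [NormedAddCommGroup V] [InnerProductSpace ℝ V] [FiniteDimensional ℝ V]
variable {φ : V →ₗ[ℝ] V →ₗ[ℝ] V →ₗ[ℝ] ℝ}

lemma omul_imag (A : Oct V) (t : V) :
    omul (form φ) A (imag t) = (-inner ℝ A.2 t, A.1 • t + cross (form φ) A.2 t) := by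
  simp [omul, imag]

/-- The associator of left and right multiplications by imaginary octonions is given by the
dual 4-form. -/
lemma IsVectorCross.omul_L [Fact (Module.finrank ℝ V = 7)] (hφ : IsVectorCross φ) {b t k : V} {A : Oct V}
    (hk : ∀ d, inner ℝ k d = 2 * psiA φ ((1, 0) : Oct V) t b A.2 d) :
    omul (form φ) (L φ b A) (imag t) = L φ b (omul (form φ) A (imag t)) + (0, k) := by
  ext1
  · rw [Prod.fst_add, L_fst, omul_imag, omul_imag]
    simp only [L_snd, inner_add_left, inner_add_right, real_inner_smul_left, real_inner_smul_right]
    rw [inner_cross, real_inner_comm (cross (form φ) A.2 t) b, inner_cross, hφ.swap_right A.2 t b,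
      hφ.swap_left A.2 b t]
    ring
  · refine ext_inner_right ℝ fun d => ?_
    rw [Prod.snd_add, L_snd, omul_imag, omul_imag, inner_add_left _ k, hk, hφ.two_mul_psiA_one]
    simp only [L_snd, L_fst, cross_add_left, cross_add_right, cross_smul_left, cross_smul_right,
      inner_add_left, real_inner_smul_left]
    rw [inner_cross φ (cross (form φ) b A.2), inner_cross φ b (cross (form φ) A.2 t),
      hφ.swap_right b _ d, ← inner_cross φ b d, hφ.swap_left _ t d, hφ.swap_right t _ d,
      ← inner_cross φ t d, hφ.cross_swap t d, inner_neg_left, real_inner_comm _ (cross _ b d),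
      real_inner_comm _ (cross _ d t), real_inner_comm d t]
    ring

lemma IsVectorCross.oip_omul_imag (hφ : IsVectorCross φ) (A B : Oct V) (t : V) :
    oip (omul (form φ) A (imag t)) B + oip A (omul (form φ) B (imag t)) = 0 := by
  rw [omul_imag, omul_imag, oip_apply, oip_apply]
  simp only [inner_add_left, inner_add_right, real_inner_smul_left, real_inner_smul_right]
  rw [inner_cross, real_inner_comm (cross (form φ) B.2 t) A.2, inner_cross,
    hφ.swap_left B.2 t, hφ.swap_right t B.2, hφ.swap_left t A.2, real_inner_comm t B.2]
  ring

/-- In DX = αX + sX the part αX only rescales X and cancels against the normalisation by |X|²; the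
part sX produces the dual 4-form contracted with -s. -/
lemma IsVectorCross.deriv_phiA (hφ : IsVectorCross φ) {X : Oct V} (hX : X ≠ 0)
    {a b c a' b' c' s : V} {α D : ℝ}
    (h : oip (L φ a' (L φ b X) + L φ a (L φ b' X + L φ b (α • X + L φ s X))) (L φ c X)
        + oip (L φ a (L φ b X)) (L φ c' X + L φ c (α • X + L φ s X))
      = oip X X * D + phiA φ X a b c * (oip (α • X + L φ s X) X + oip X (α • X + L φ s X))) :
    D - phiA φ X a' b c - phiA φ X a b' c - phiA φ X a b c' = 2 * psiA φ X (-s) a b c := by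
  have hN : oip X X ≠ 0 := by rw [oip_self]; exact (normSq_pos hX).ne'
  rw [hφ.psiA_eq]
  simp only [phiA, ← oip_self, map_add, map_smul, map_neg, LinearMap.add_apply,
    LinearMap.smul_apply, LinearMap.neg_apply, smul_eq_mul, hφ.oip_L_self, hφ.oip_self_L] at h ⊢
  have hN1 : (oip X X)⁻¹ * oip X X = 1 := inv_mul_cancel₀ hN
  field_simp
  linear_combination -h - 2 * α * oip (L φ a (L φ b X)) (L φ c X) * hN1

variable [Fact (Module.finrank ℝ V = 7)] {o : Orientation ℝ V (Fin 7)}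
  {e : OrthonormalBasis (Fin 7) ℝ V}

end Pointwise

/-! ### The octonion derivative and the torsion of the transformed structure. -/

section Calculus

variable {M : Type*} [TopologicalSpace M] [ChartedSpace (EuclideanSpace ℝ (Fin 7)) M]
  [IsManifold (𝓡 7) ∞ M] [RiemannianBundle (fun p : M => T7 p)]
  [IsContMDiffRiemannianBundle (𝓡 7) ∞ (EuclideanSpace ℝ (Fin 7)) (fun p : M => T7 p)]
  {o : ∀ p : M, Orientation ℝ (T7 p) (Fin 7)}
  {φ : ∀ p : M, T7 p →L[ℝ] T7 p →L[ℝ] T7 p →L[ℝ] ℝ}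
  {nabla : CovariantDerivative (𝓡 7) (EuclideanSpace ℝ (Fin 7)) (fun p : M => T7 p)}

/-- The octonion derivative of the `G₂`-structure `φ`. -/
noncomputable abbrev octD
    (nabla : CovariantDerivative (𝓡 7) (EuclideanSpace ℝ (Fin 7)) (fun p : M => T7 p))
    (o : ∀ p : M, Orientation ℝ (T7 p) (Fin 7))
    (φ : ∀ p : M, T7 p →L[ℝ] T7 p →L[ℝ] T7 p →L[ℝ] ℝ) (A : ∀ p : M, Oct (T7 p)) (p : M) (u : T7 p) :
    Oct (T7 p) := octDeriv nabla o (fun p u v w => φ p u v w) A p u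

/-- Differentiability of an octonion field at a point. -/
structure DiffOct (A : ∀ p : M, Oct (T7 p)) (p : M) : Prop where
  fst : DiffFun (fun q => (A q).1) p
  snd : DiffVF (fun q => (A q).2) p

/-- The contraction of a multiple of the dual 4-form recovering its vector. -/
lemma sum_psiA_mul_hodge {V : Type*} [NormedAddCommGroup V] [InnerProductSpace ℝ V]
    [FiniteDimensional ℝ V] [hV : Fact (Module.finrank ℝ V = 7)] {o : Orientation ℝ V (Fin 7)}
    {φ : V →ₗ[ℝ] V →ₗ[ℝ] V →ₗ[ℝ] ℝ} {e : OrthonormalBasis (Fin 7) ℝ V}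
    (h : IsAdapted φ e) (he : e.toBasis.orientation = o) {A : Oct V} (hA : A ≠ 0) (t v : V)
    {f : V → V → V → ℝ} (hf : ∀ a b c, f a b c = 2 * psiA φ A t a b c) :
    1 / 48 * ∑ i, ∑ j, ∑ k, f (onb V i) (onb V j) (onb V k) *
      hodge o (phiA φ A) v (onb V i) (onb V j) (onb V k) = inner ℝ t v := by
  have := h.isVectorCross.sum_psiA_mul_psiA (onb V) (by simp [hV.out]) hA t v
  simp only [hf, h.hodge_phiA he, mul_assoc, ← Finset.mul_sum, this]
  ring

/-- The contraction ψψ = 24g makes the factor 1/48 in `torsion` return exactly the vector t with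
∇_uφ = 2 t⌟∗φ. -/
lemma IsG2Structure.exists_torsion_eq (hφ : IsG2Structure o φ) (hm : nabla.IsMetricCompatible)
    (p : M) (u : T7 p) : ∃ t : T7 p,
      (∀ A : Oct (T7 p), omul (fun u v w => φ p u v w) A
          (imag (sharp (torsion nabla o (fun p u v w => φ p u v w) p u)))
        = omul (form (tri (φ p))) A (imag t)) ∧
      ∀ a b c, formDeriv nabla (fun p u v w => φ p u v w) p u a b c
        = 2 * psiA (tri (φ p)) ((1, 0) : Oct (T7 p)) t a b c := by
  obtain ⟨t, ht⟩ := hφ.exists_formDeriv_eq hm p u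
  obtain ⟨e, heo, he⟩ := hφ.exists_adapted p
  refine ⟨t, fun A => ?_, ht⟩
  have : sharp (torsion nabla o (fun p u v w => φ p u v w) p u) = t := by
    refine sharp_eq fun v => ?_
    rw [← sum_psiA_mul_hodge he heo (by simp : ((1, 0) : Oct (T7 p)) ≠ 0) t v ht]
    have h1 : phiA (tri (φ p)) (1, 0) = fun u v w => φ p u v w := by
      funext u v w
      exact he.isVectorCross.phiA_one u v w
    rw [h1]
    rfl
  rw [this]
  rfl

lemma DiffOct.L (hφ : IsG2Structure o φ) {p : M} {b : ∀ q : M, T7 q} {A : ∀ q : M, Oct (T7 q)}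
    (hb : DiffVF b p) (hA : DiffOct A p) : DiffOct (fun q => L (tri (φ q)) (b q) (A q)) p where
  fst := by
    simp only [L_fst]
    exact (hb.inner hA.snd).neg'
  snd := by
    simp only [L_snd]
    exact (DiffVF.smul hA.fst hb).add (hφ.diff_cross hb hA.snd)

lemma DiffOct.oip {p : M} {A B : ∀ q : M, Oct (T7 q)} (hA : DiffOct A p) (hB : DiffOct B p) :
    DiffFun (fun q => oip (A q) (B q)) p := by
  simp only [oip_apply]
  exact (hA.fst.mul' hB.fst).add' (hA.snd.inner hB.snd)

lemma IsG2Structure.inner_nabla_cross (hφ : IsG2Structure o φ) (hm : nabla.IsMetricCompatible)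
    {p : M} {a b : ∀ q : M, T7 q} (ha : DiffVF a p) (hb : DiffVF b p) (u d : T7 p) :
    inner ℝ (nabla (fun q => crossAt φ (a q) (b q)) p u) d
      = formDeriv nabla (fun p u v w => φ p u v w) p u (a p) (b p) d
        + tri (φ p) (nabla a p u) (b p) d + tri (φ p) (a p) (nabla b p u) d := by
  have hd := diffVF_extVF d
  have hdp : extVF d p = d := FiberBundle.extend_apply_self _ d
  have e1 := mvfderiv_inner_vf hm (hφ.diff_cross ha hb) hd u
  have e2 := hφ.fieldDeriv_eq (nabla := nabla) u ha hb hd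
  rw [fieldDeriv] at e2
  simp only [crossAt, inner_cross, hdp] at e1 e2 ⊢
  linarith

/-- The Leibniz rule fails for ∇ by ∇_uφ, which is 2 t⌟∗φ; right multiplication by t fails to
commute with left multiplication by the same 4-form. In D the two defects cancel. -/
lemma IsG2Structure.octD_L (hφ : IsG2Structure o φ) (hm : nabla.IsMetricCompatible) {p : M}
    {b : ∀ q : M, T7 q} {A : ∀ q : M, Oct (T7 q)} (hb : DiffVF b p) (hA : DiffOct A p) (u : T7 p) :
    octD nabla o φ (fun q => L (tri (φ q)) (b q) (A q)) p u
      = L (tri (φ p)) (nabla b p u) (A p) + L (tri (φ p)) (b p) (octD nabla o φ A p u) := by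
  obtain ⟨t, ht, hκ⟩ := hφ.exists_torsion_eq (nabla := nabla) hm p u
  set k : T7 p := nabla (fun q => crossAt φ (b q) (A q).2) p u
    - cross (form (tri (φ p))) (nabla b p u) (A p).2
    - cross (form (tri (φ p))) (b p) (nabla (fun q => (A q).2) p u) with hk
  have hk' : ∀ d, inner ℝ k d = 2 * psiA (tri (φ p)) ((1, 0) : Oct (T7 p)) t (b p) (A p).2 d := by
    intro d
    rw [hk, inner_sub_left, inner_sub_left, hφ.inner_nabla_cross hm hb hA.snd, inner_cross,
      inner_cross, hκ]
    ring
  have hL := (hφ.isVectorCross p).omul_L hk'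
  have h1 : mvfderiv (𝓡 7) (fun q => (L (tri (φ q)) (b q) (A q)).1) p u
      = -(inner ℝ (nabla b p u) (A p).2 + inner ℝ (b p) (nabla (fun q => (A q).2) p u)) := by
    simp only [L_fst]
    rw [mvfderiv_neg_apply, mvfderiv_inner_vf hm hb hA.snd]
  have h2 : nabla (fun q => (L (tri (φ q)) (b q) (A q)).2) p u
      = (A p).1 • nabla b p u + mvfderiv (𝓡 7) (fun q => (A q).1) p u • b p
        + (cross (form (tri (φ p))) (nabla b p u) (A p).2
          + cross (form (tri (φ p))) (b p) (nabla (fun q => (A q).2) p u) + k) := by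
    have := nabla_add (nabla := nabla) (DiffVF.smul hA.fst hb) (hφ.diff_cross hb hA.snd) u
    simp only [L_snd]
    refine this.trans ?_
    have h3 := nabla_smul (nabla := nabla) hA.fst hb u
    rw [hk]
    refine (congrArg (· + _) h3).trans ?_
    abel
  rw [octD, octDeriv, h1, h2, ht, hL, octD, octDeriv, ht, map_sub]
  ext1
  · simp only [Prod.fst_sub, Prod.fst_add, L_fst]
    ring
  · simp only [Prod.snd_sub, Prod.snd_add, L_snd]
    abel

/-- ∇ is metric and right multiplication by an imaginary octonion is skew-adjoint, so D is metric.
-/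
lemma IsG2Structure.mvfderiv_oip (hφ : IsG2Structure o φ) (hm : nabla.IsMetricCompatible) {p : M}
    {A B : ∀ q : M, Oct (T7 q)} (hA : DiffOct A p) (hB : DiffOct B p) (u : T7 p) :
    mvfderiv (𝓡 7) (fun q => oip (A q) (B q)) p u
      = oip (octD nabla o φ A p u) (B p) + oip (A p) (octD nabla o φ B p u) := by
  obtain ⟨t, ht, -⟩ := hφ.exists_torsion_eq (nabla := nabla) hm p u
  have h0 := (hφ.isVectorCross p).oip_omul_imag (A p) (B p) t
  rw [octD, octD, octDeriv, octDeriv, ht, ht, map_sub, map_sub, LinearMap.sub_apply]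
  simp only [oip_apply (A _) (B _)]
  rw [mvfderiv_add_apply (hA.fst.mul' hB.fst) (hA.snd.inner hB.snd),
    mvfderiv_mul_apply hA.fst hB.fst, mvfderiv_inner_vf hm hA.snd hB.snd]
  rw [oip_apply (_, _) (B p), oip_apply (A p) (_, _)]
  linear_combination h0

lemma IsG2Structure.torsion_phiA (hφ : IsG2Structure o φ) (hm : nabla.IsMetricCompatible)
    {X : ∀ q : M, Oct (T7 q)} (hX : ∀ p, DiffOct X p) (hX0 : ∀ p, X p ≠ 0) (p : M) :
    torsion nabla o (fun q => phiA (tri (φ q)) (X q)) p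
      = torA (tri (φ p)) (X p) (octD nabla o φ X p) := by
  have hφp := hφ.isVectorCross p
  obtain ⟨e, heo, he⟩ := hφ.exists_adapted p
  have hN := fun q => (normSq_pos (hX0 q)).ne'
  funext u v
  obtain ⟨α, s, hs⟩ := hφp.exists_eq (hX0 p) (octD nabla o φ X p u)
  have hE := fun v : T7 p => diffVF_extVF v
  have hEp : ∀ v : T7 p, extVF v p = v := fun v => FiberBundle.extend_apply_self _ v
  have hf : ∀ a b c, formDeriv nabla (fun q => phiA (tri (φ q)) (X q)) p u a b c
      = 2 * psiA (tri (φ p)) (X p) (-s) a b c := by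
    intro a b c
    have hcX := DiffOct.L hφ (hE c) (hX p)
    have hbX := DiffOct.L hφ (hE b) (hX p)
    have habX := DiffOct.L hφ (hE a) hbX
    have hNd := (hX p).oip (hX p)
    have hg := habX.oip hcX
    have hNi : DiffFun (fun q => (normSq (X q))⁻¹) p := by
      simp only [← oip_self]
      exact hNd.inv (by rw [oip_self]; exact hN p)
    have hfd : DiffFun (fun q => phiA (tri (φ q)) (X q) (extVF a q) (extVF b q) (extVF c q)) p :=
      hNi.mul' hg
    -- Clearing |X|² leaves ⟨a(bX), cX⟩, to which the Leibniz and metric rules for D apply directly.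
    have hfg : (fun q => oip (X q) (X q)
        * phiA (tri (φ q)) (X q) (extVF a q) (extVF b q) (extVF c q))
        = fun q => oip (L (tri (φ q)) (extVF a q) (L (tri (φ q)) (extVF b q) (X q)))
            (L (tri (φ q)) (extVF c q) (X q)) := by
      funext q
      rw [phiA, oip_self, mul_inv_cancel_left₀ (hN q)]
    have d1 := mvfderiv_mul_apply hNd hfd u
    rw [hfg, hφ.mvfderiv_oip (nabla := nabla) hm habX hcX, hφ.octD_L hm (hE a) hbX,
      hφ.octD_L hm (hE b) (hX p), hφ.octD_L hm (hE c) (hX p), hφ.mvfderiv_oip (nabla := nabla) hm (hX p) (hX p),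
      hs] at d1
    simp only [hEp] at d1
    have := hφp.deriv_phiA (hX0 p) d1
    simp only [formDeriv]
    simpa only [extVF, FiberBundle.extend_apply_self] using this
  rw [torsion, sum_psiA_mul_hodge he heo (hX0 p) (-s) v hf, torA, hs]
  simp only [map_add, map_smul, LinearMap.add_apply, LinearMap.smul_apply, hφp.oip_self_L,
    hφp.oip_L_L, inner_neg_left, oip_self]
  field_simp [hN p]
  simp

end Calculus

/-! ### From the bioctonion equations to real octonions. -/

section Pointwise

variable {V : Type*} [NormedAddCommGroup V] [InnerProductSpace ℝ V] [FiniteDimensional ℝ V]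
variable {φ : V →ₗ[ℝ] V →ₗ[ℝ] V →ₗ[ℝ] ℝ}

lemma omul_eq (a : ℝ) (v : V) (A : Oct V) : omul (form φ) (a, v) A = a • A + L φ v A := by
  ext1
  · simp [omul, L_fst, sub_eq_add_neg]
  · simp [omul, L_snd, add_assoc]

/-- The pointwise Killing equations in terms of real octonions. -/
lemma IsVectorCross.isKillingAt (hφ : IsVectorCross φ) (hV : Module.finrank ℝ V = 7)
    {G : V [⋀^Fin 4]→L[ℝ] ℝ} {lam : ℂ} {E m : ℝ} {d : V} {X Y : Oct V} {DX DY : V → Oct V}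
    (hext : (0 : BiOct V) = csmul (lam * (E : ℝ)) (cconj (X, Y))
      + csmul Complex.I (lmul (form φ) (m, (1 / 2 : ℝ) • d) (X, Y))
      + (1 / 144 : ℝ) • cliff4 (form φ) G (X, Y))
    (hint : ∀ u, ((DX u, DY u) : BiOct V) = -(1 / 2 * m) • lmul (form φ) (imag u) (X, Y)
      - csmul (Complex.I / 144) (lmul (form φ) (imag u) (cliff4 (form φ) G (X, Y)))
      - csmul (Complex.I / 12) (cliff3 (form φ) G u (X, Y))) :
    IsKillingAt φ (isLinearMap_flux4 (φ := φ) G).mk' (lam.re * E) (lam.im * E) m d X Y DX DY := by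
  -- Since 18/12 = 3/2, the flux terms become 3/2 c(uY) and (1 - 3/2) u(cY) for X, with opposite
  -- signs and X in place of Y for Y.
  have h3 : ∀ u A, flux3 φ G u A = (18 : ℝ) • (flux4 φ G (L φ u A) - L φ u (flux4 φ G A)) :=
    fun u A => by rw [hφ.L_flux4]; module
  have hre : (lam * (E : ℂ)).re = lam.re * E := by simp
  have him : (lam * (E : ℂ)).im = lam.im * E := by simp
  have i1 : (Complex.I / 144).re = 0 := by simp
  have i2 : (Complex.I / 144).im = 1 / 144 := by simp
  have i3 : (Complex.I / 12).re = 0 := by simp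
  have i4 : (Complex.I / 12).im = 1 / 12 := by simp
  rw [cliff4_eq] at hext
  simp only [cliff4_eq, cliff3_eq] at hint
  simp only [csmul, hre, him, cconj, lmul, omul_eq, Complex.I_re, Complex.I_im, map_smul] at hext
  simp only [csmul, lmul, i1, i2, i3, i4, ← L_apply, h3, map_smul] at hint
  have hX := congrArg Prod.fst hext
  have hY := congrArg Prod.snd hext
  simp only [Prod.fst_add, Prod.snd_add, Prod.smul_fst, Prod.smul_snd, Prod.fst_zero,
    Prod.snd_zero, LinearMap.smul_apply] at hX hY
  refine ⟨hφ.oip_flux4 G, hφ.sum_L_flux4_L hV G, ?_, ?_, fun u => ?_, fun u => ?_⟩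
  · change flux4 φ G X = _
    linear_combination (norm := module) (-1 : ℝ) • hX
  · change flux4 φ G Y = _
    linear_combination (norm := module) (-1 : ℝ) • hY
  · have := congrArg Prod.fst (hint u)
    change DX u = _ at this
    change DX u = _ • _ - _ • L φ u (flux4 φ G Y) + _ • flux4 φ G (L φ u Y)
    rw [this]
    simp only [Prod.fst_sub, Prod.smul_fst]
    module
  · have := congrArg Prod.snd (hint u)
    change DY u = _ at this
    change DY u = _ • _ + _ • L φ u (flux4 φ G X) - _ • flux4 φ G (L φ u X)
    rw [this]
    simp only [Prod.snd_sub, Prod.smul_snd]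
    module

/-- The imaginary part for the exchanged pair is -w/r, parallel to w, so independence from d
persists. -/
lemma exists_swap (hφ : IsVectorCross φ) {X Y : Oct V} {d w : V} {w₀ : ℝ}
    (hY : Y = w₀ • X + L φ w X) (hdw : LinearIndependent ℝ ![d, w]) :
    ∃ (v₀ : ℝ) (v : V), X = v₀ • Y + L φ v Y ∧ LinearIndependent ℝ ![d, v] := by
  have hw : w ≠ 0 := by simpa using hdw.ne_zero 1
  have hr : w₀ ^ 2 + inner ℝ w w ≠ 0 := by
    have : 0 < inner ℝ w w := by
      rw [real_inner_self_eq_norm_sq]; have := norm_pos_iff.mpr hw; positivity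
    positivity
  set r := w₀ ^ 2 + inner ℝ w w with hrd
  refine ⟨w₀ / r, (-r⁻¹) • w, ?_, ?_⟩
  · have hwY : L φ w Y = w₀ • Y - r • X := by
      rw [hY, map_add, map_smul, hφ.L_L_self, hrd]; module
    rw [map_smul, LinearMap.smul_apply, hwY, smul_sub, smul_smul, smul_smul]
    rw [show -r⁻¹ * r = -1 by field_simp]
    rw [show -r⁻¹ * w₀ = -(w₀ / r) by ring]
    module
  · rw [LinearIndependent.pair_iff] at hdw ⊢
    intro s t hst
    obtain ⟨h1, h2⟩ := hdw s (t * -r⁻¹) (by rw [← hst, smul_smul])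
    exact ⟨h1, (mul_eq_zero.mp h2).resolve_right (neg_ne_zero.mpr (inv_ne_zero hr))⟩

end Pointwise

/-! ### First derivatives of the norms along the manifold. -/

section Calculus

variable {M : Type*} [TopologicalSpace M] [ChartedSpace (EuclideanSpace ℝ (Fin 7)) M]
  [IsManifold (𝓡 7) ∞ M] [RiemannianBundle (fun p : M => T7 p)]
  [IsContMDiffRiemannianBundle (𝓡 7) ∞ (EuclideanSpace ℝ (Fin 7)) (fun p : M => T7 p)]
  {o : ∀ p : M, Orientation ℝ (T7 p) (Fin 7)}
  {φ : ∀ p : M, T7 p →L[ℝ] T7 p →L[ℝ] T7 p →L[ℝ] ℝ}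
  {nabla : CovariantDerivative (𝓡 7) (EuclideanSpace ℝ (Fin 7)) (fun p : M => T7 p)}

lemma inner_grad (Δ : M → ℝ) (p : M) (u : T7 p) :
    inner ℝ (grad Δ p) u = mvfderiv (𝓡 7) Δ p u :=
  inner_sharp (mvfderiv (𝓡 7) Δ p).toLinearMap.isLinear u

lemma continuousAt_mvfderiv {Δ : M → ℝ} (hΔ : ContMDiff (𝓡 7) 𝓘(ℝ, ℝ) ∞ Δ) {p : M}
    {s : ∀ q : M, T7 q} (hs : DiffVF s p) :
    ContinuousAt (fun q => mvfderiv (𝓡 7) Δ q (s q)) p := by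
  have h1 := hΔ.continuous_tangentMap (by simp)
  have h2 := (tangentBundleModelSpaceHomeomorph 𝓘(ℝ, ℝ)).continuous.comp h1
  have h3 : ContinuousAt (fun q => (⟨q, s q⟩ : TangentBundle (𝓡 7) M)) p := hs.continuousAt
  have h4 := ContinuousAt.comp (f := fun q => (⟨q, s q⟩ : TangentBundle (𝓡 7) M))
    h2.continuousAt h3
  exact continuous_snd.continuousAt.comp h4

lemma mvfderiv_exp_mul {Δ : M → ℝ} (c : ℝ) {p : M} (hΔ : DiffFun Δ p) (u : T7 p) :
    DiffFun (fun q => Real.exp (c * Δ q)) p ∧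
    mvfderiv (𝓡 7) (fun q => Real.exp (c * Δ q)) p u
      = c * Real.exp (c * Δ p) * mvfderiv (𝓡 7) Δ p u := by
  have h0 : HasDerivAt (fun x => Real.exp (c * x)) (c * Real.exp (c * Δ p)) (Δ p) := by
    have := ((hasDerivAt_id (Δ p)).const_mul c).exp
    simpa [mul_comm] using this
  have h1 := h0.hasFDerivAt.hasMFDerivAt.comp p hΔ.hasMFDerivAt
  refine ⟨h1.mdifferentiableAt, ?_⟩
  have h2 : mfderiv (𝓡 7) 𝓘(ℝ, ℝ) (fun q => Real.exp (c * Δ q)) p = _ := h1.mfderiv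
  change mfderiv (𝓡 7) 𝓘(ℝ, ℝ) (fun q => Real.exp (c * Δ q)) p u = _
  rw [h2]
  exact mul_comm (mvfderiv (𝓡 7) Δ p u) _

lemma mvfderiv_eq_zero_of_eventually {f : M → ℝ} {p : M} (h : ∀ᶠ q in nhds p, f q = 0) (u : T7 p) :
    mvfderiv (𝓡 7) f p u = 0 := by
  have h1 : f =ᶠ[nhds p] fun _ => (0 : ℝ) := h
  have h2 : mvfderiv (𝓡 7) f p = mvfderiv (𝓡 7) (fun _ : M => (0 : ℝ)) p := by
    simp only [mvfderiv]
    rw [h1.mfderiv_eq, h1.self_of_nhds]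
  rw [h2, mvfderiv_const]
  rfl

lemma SmoothOct.diffOct {X : ∀ p : M, Oct (T7 p)} (hX : SmoothOct X) (p : M) : DiffOct X p :=
  ⟨(hX.1 p).mdifferentiableAt (by simp), (hX.2 p).mdifferentiableAt (by simp)⟩

/-- A solution of the Killing equations on `M`, in terms of real octonions. -/
structure IsRealKilling
    (nabla : CovariantDerivative (𝓡 7) (EuclideanSpace ℝ (Fin 7)) (fun p : M => T7 p))
    (o : ∀ p : M, Orientation ℝ (T7 p) (Fin 7))
    (φ : ∀ p : M, T7 p →L[ℝ] T7 p →L[ℝ] T7 p →L[ℝ] ℝ) (Δ : M → ℝ)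
    (c : ∀ p : M, Oct (T7 p) →ₗ[ℝ] Oct (T7 p)) (r₁ r₂ mu : ℝ) (X Y : ∀ p : M, Oct (T7 p)) : Prop where
  g2 : IsG2Structure o φ
  metric : nabla.IsMetricCompatible
  smooth : ContMDiff (𝓡 7) 𝓘(ℝ, ℝ) ∞ Δ
  diffX : ∀ p, DiffOct X p
  diffY : ∀ p, DiffOct Y p
  X_ne : ∀ p, X p ≠ 0
  Y_ne : ∀ p, Y p ≠ 0
  killing : ∀ p, IsKillingAt (tri (φ p)) (c p) (r₁ * Real.exp (-Δ p)) (r₂ * Real.exp (-Δ p))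
    (mu * Real.exp (-4 * Δ p)) (grad Δ p) (X p) (Y p) (octD nabla o φ X p) (octD nabla o φ Y p)

variable {Δ : M → ℝ} {c : ∀ p : M, Oct (T7 p) →ₗ[ℝ] Oct (T7 p)} {r₁ r₂ mu : ℝ}
  {X Y : ∀ p : M, Oct (T7 p)}

lemma IsRealKilling.swap (h : IsRealKilling nabla o φ Δ c r₁ r₂ mu X Y) :
    IsRealKilling nabla o φ Δ (fun p => -c p) r₁ (-r₂) mu Y X where
  g2 := h.g2
  metric := h.metric
  smooth := h.smooth
  diffX := h.diffY
  diffY := h.diffX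
  X_ne := h.Y_ne
  Y_ne := h.X_ne
  killing p := by rw [neg_mul]; exact (h.killing p).swap

/-- Together with `mvfderiv_normY` this gives d(N + M) = (N + M) dΔ, as the terms in l₁ cancel. -/
lemma IsRealKilling.mvfderiv_normX (h : IsRealKilling nabla o φ Δ c r₁ r₂ mu X Y) (p : M)
    (u : T7 p) : mvfderiv (𝓡 7) (fun q => oip (X q) (X q)) p u
      = 4 * (r₁ * Real.exp (-Δ p)) * oip (L (tri (φ p)) u (X p)) (Y p)
        + (3 / 2 * oip (Y p) (Y p) - 1 / 2 * oip (X p) (X p)) * mvfderiv (𝓡 7) Δ p u := by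
  rw [h.g2.mvfderiv_oip h.metric (h.diffX p) (h.diffX p), oip_comm (X p),
    (h.killing p).oip_DX (h.g2.isVectorCross p), inner_grad]
  ring

lemma IsRealKilling.mvfderiv_normY (h : IsRealKilling nabla o φ Δ c r₁ r₂ mu X Y) (p : M)
    (u : T7 p) : mvfderiv (𝓡 7) (fun q => oip (Y q) (Y q)) p u
      = -(4 * (r₁ * Real.exp (-Δ p)) * oip (L (tri (φ p)) u (X p)) (Y p))
        + (3 / 2 * oip (X p) (X p) - 1 / 2 * oip (Y p) (Y p)) * mvfderiv (𝓡 7) Δ p u := by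
  rw [h.swap.mvfderiv_normX, (h.g2.isVectorCross p).oip_L, oip_comm]
  ring

end Calculus

/-! ### Non-vanishing on M and the torsion type. -/

section Calculus

variable {M : Type*} [TopologicalSpace M] [ChartedSpace (EuclideanSpace ℝ (Fin 7)) M]
  [IsManifold (𝓡 7) ∞ M] [RiemannianBundle (fun p : M => T7 p)]
  [IsContMDiffRiemannianBundle (𝓡 7) ∞ (EuclideanSpace ℝ (Fin 7)) (fun p : M => T7 p)]
  {o : ∀ p : M, Orientation ℝ (T7 p) (Fin 7)}
  {φ : ∀ p : M, T7 p →L[ℝ] T7 p →L[ℝ] T7 p →L[ℝ] ℝ}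
  {nabla : CovariantDerivative (𝓡 7) (EuclideanSpace ℝ (Fin 7)) (fun p : M => T7 p)}
  {Δ : M → ℝ} {c : ∀ p : M, Oct (T7 p) →ₗ[ℝ] Oct (T7 p)} {r₁ r₂ mu : ℝ}
  {X Y : ∀ p : M, Oct (T7 p)}

/-- The torsion of the `G₂`-structure obtained from `φ` by `X`, at a point. -/
noncomputable abbrev torX
    (nabla : CovariantDerivative (𝓡 7) (EuclideanSpace ℝ (Fin 7)) (fun p : M => T7 p))
    (o : ∀ p : M, Orientation ℝ (T7 p) (Fin 7))
    (φ : ∀ p : M, T7 p →L[ℝ] T7 p →L[ℝ] T7 p →L[ℝ] ℝ) (X : ∀ p : M, Oct (T7 p)) (p : M) :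
    T7 p → T7 p → ℝ := torA (tri (φ p)) (X p) (octD nabla o φ X p)

lemma finrank_T7 (p : M) : Module.finrank ℝ (T7 p) = 7 := (instFactFinrankT7 p).out

lemma oip_self_pos {V : Type*} [NormedAddCommGroup V] [InnerProductSpace ℝ V]
    [FiniteDimensional ℝ V] {A : Oct V} (hA : A ≠ 0) : 0 < oip A A := by rw [oip_self]; exact normSq_pos hA

lemma IsRealKilling.tau1_eq_zero (h : IsRealKilling nabla o φ Δ c r₁ r₂ mu X Y) (hmu : mu = 0)
    (hr : r₂ = 0) (p : M) : tau1 (torX nabla o φ X p) = 0 := by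
  have h1 := (h.killing p).tau1_eq (h.g2.isVectorCross p) (finrank_T7 p) (h.X_ne p)
  rw [hmu, hr] at h1
  simpa [(oip_self_pos (h.X_ne p)).ne'] using h1

lemma oip_L_eq {V : Type*} [NormedAddCommGroup V] [InnerProductSpace ℝ V] [FiniteDimensional ℝ V]
    {φ : V →ₗ[ℝ] V →ₗ[ℝ] V →ₗ[ℝ] ℝ} (hφ : IsVectorCross φ) {X Y : Oct V} {w : V} {w₀ : ℝ}
    (hY : Y = w₀ • X + L φ w X) (u : V) : oip (L φ u X) Y = inner ℝ w u * oip X X := by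
  rw [hY, map_add, map_smul, hφ.oip_L_self, hφ.oip_L_L, real_inner_comm]; simp

/-- If τ₁ vanished, 5 (Im λ) e^{3Δ}(N + M) = μ(2N + 5M) would hold on all of M. Its derivative at p
is a linear relation between ∂Δ and w in which ∂Δ has a positive coefficient. -/
lemma IsRealKilling.exists_tau1_ne_zero (h : IsRealKilling nabla o φ Δ c r₁ r₂ mu X Y)
    (hmu : mu ≠ 0) {p : M} {w₀ : ℝ} {w : T7 p} (hY : Y p = w₀ • X p + L (tri (φ p)) w (X p))
    (hdw : LinearIndependent ℝ ![grad Δ p, w]) : ∃ q, tau1 (torX nabla o φ X q) ≠ 0 := by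
  by_contra! h0
  have hΔ : DiffFun Δ p := (h.smooth p).mdifferentiableAt (by simp)
  have hN := (h.diffX p).oip (h.diffX p)
  have hM := (h.diffY p).oip (h.diffY p)
  have hE := fun u : T7 p => mvfderiv_exp_mul 3 hΔ u
  have hq : ∀ q, 5 * r₂ * (Real.exp (3 * Δ q) * (oip (X q) (X q) + oip (Y q) (Y q)))
      + -mu * (2 * oip (X q) (X q) + 5 * oip (Y q) (Y q)) = 0 := by
    intro q
    have h1 := (h.killing q).tau1_eq (h.g2.isVectorCross q) (finrank_T7 q) (h.X_ne q)
    rw [h0 q] at h1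
    -- Factoring out e^{-4Δ} leaves a single exponential to differentiate.
    have e1 : Real.exp (-Δ q) = Real.exp (3 * Δ q) * Real.exp (-4 * Δ q) := by
      rw [← Real.exp_add]; ring_nf
    rw [e1] at h1
    have e2 := (Real.exp_pos (-4 * Δ q)).ne'
    refine (mul_eq_zero.mp (?_ : Real.exp (-4 * Δ q) * _ = 0)).resolve_left e2
    linear_combination h1
  have key : ∀ u, (3 / 2 * oip (X p) (X p) + 39 / 2 * oip (Y p) (Y p)) * mvfderiv (𝓡 7) Δ p u
      + 12 * (r₁ * Real.exp (-Δ p)) * oip (X p) (X p) * inner ℝ w u = 0 := by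
    intro u
    have c0 : ∀ r : ℝ, DiffFun (fun _ : M => r) p := fun r => mdifferentiableAt_const
    have cm : ∀ (r : ℝ) (f : M → ℝ), DiffFun f p →
        mvfderiv (𝓡 7) (fun q => r * f q) p u = r * mvfderiv (𝓡 7) f p u := fun r f hf => by
      rw [mvfderiv_mul_apply (c0 r) hf, mvfderiv_const]; simp
    have hQ := hN.add' hM
    have hR := ((c0 2).mul' hN).add' ((c0 5).mul' hM)
    have hEQ := (hE u).1.mul' hQ
    have d0 := mvfderiv_eq_zero_of_eventually (Filter.Eventually.of_forall hq) u (p := p)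
    rw [mvfderiv_add_apply ((c0 _).mul' hEQ) ((c0 _).mul' hR), cm _ _ hEQ, cm _ _ hR,
      mvfderiv_mul_apply (hE u).1 hQ, (hE u).2, mvfderiv_add_apply hN hM,
      mvfderiv_add_apply ((c0 _).mul' hN) ((c0 _).mul' hM), cm _ _ hN, cm _ _ hM,
      h.mvfderiv_normX, h.mvfderiv_normY, oip_L_eq (h.g2.isVectorCross p) hY] at d0
    have hp := hq p
    refine (mul_eq_zero.mp (?_ : mu * _ = 0)).resolve_left hmu
    -- By d(N + M) = (N + M) dΔ the term e^{3Δ}(N + M) has derivative 4 e^{3Δ}(N + M) dΔ, so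
    -- subtracting 4 dΔ times the relation removes Im λ.
    linear_combination d0 - 4 * mvfderiv (𝓡 7) Δ p u * hp
  have h1 : (3 / 2 * oip (X p) (X p) + 39 / 2 * oip (Y p) (Y p)) • grad Δ p
      + (12 * (r₁ * Real.exp (-Δ p)) * oip (X p) (X p)) • w = 0 :=
    ext_inner_right ℝ fun u => by
      rw [inner_add_left, real_inner_smul_left, real_inner_smul_left, inner_grad, key,
        inner_zero_left]
  have h2 := (LinearIndependent.pair_iff.mp hdw _ _ h1).1
  have := oip_self_pos (h.X_ne p)
  have := oip_self_pos (h.Y_ne p)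
  linarith

lemma gram_pos {V : Type*} [NormedAddCommGroup V] [InnerProductSpace ℝ V] {d w : V}
    (hdw : LinearIndependent ℝ ![d, w]) :
    inner ℝ d d * inner ℝ w w - inner ℝ d w * inner ℝ d w ≠ 0 := by
  intro h
  have hd : d ≠ 0 := by simpa using hdw.ne_zero 0
  have hdd : inner ℝ d d ≠ 0 := inner_self_ne_zero.mpr hd
  have h1 : inner ℝ d w • d + (-inner ℝ d d) • w = 0 := by
    rw [← inner_self_eq_zero (𝕜 := ℝ)]
    simp only [inner_add_left, inner_add_right, real_inner_smul_left, real_inner_smul_right,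
      real_inner_comm d w]
    linear_combination (inner ℝ d d) * h
  exact hdd (neg_eq_zero.mp (LinearIndependent.pair_iff.mp hdw _ _ h1).2)

/-- Independence of `∂Δ` and of the imaginary part of `Y X⁻¹` is an open condition. -/
lemma IsRealKilling.eventually_independent (h : IsRealKilling nabla o φ Δ c r₁ r₂ mu X Y)
    {p : M} {w₀ : ℝ} {w : T7 p} (hY : Y p = w₀ • X p + L (tri (φ p)) w (X p))
    (hdw : LinearIndependent ℝ ![grad Δ p, w]) :
    ∀ᶠ q in nhds p, ∃ (v₀ : ℝ) (v : T7 q), Y q = v₀ • X q + L (tri (φ q)) v (X q) ∧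
      LinearIndependent ℝ ![grad Δ q, v] := by
  set A : ∀ q : M, T7 q := extVF (grad Δ p)
  set B : ∀ q : M, T7 q := extVF w
  have hA : DiffVF A p := diffVF_extVF _
  have hB : DiffVF B p := diffVF_extVF _
  have hAp : A p = grad Δ p := FiberBundle.extend_apply_self _ _
  have hBp : B p = w := FiberBundle.extend_apply_self _ _
  -- The determinant of the 1-forms dΔ and N w♭ on two fixed fields: it is continuous at p, equals N
  -- times the Gram determinant there, and where it is nonzero the two vectors are independent.
  let D : M → ℝ := fun q => mvfderiv (𝓡 7) Δ q (A q) * oip (L (tri (φ q)) (B q) (X q)) (Y q)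
    - mvfderiv (𝓡 7) Δ q (B q) * oip (L (tri (φ q)) (A q) (X q)) (Y q)
  have hD : ContinuousAt D p :=
    ((continuousAt_mvfderiv h.smooth hA).mul
      ((DiffOct.L h.g2 hB (h.diffX p)).oip (h.diffY p)).continuousAt).sub
    ((continuousAt_mvfderiv h.smooth hB).mul
      ((DiffOct.L h.g2 hA (h.diffX p)).oip (h.diffY p)).continuousAt)
  have hDp : D p ≠ 0 := by
    simp only [D, hAp, hBp, ← inner_grad, oip_L_eq (h.g2.isVectorCross p) hY,
      real_inner_comm (grad Δ p) w]
    intro h0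
    refine mul_ne_zero (gram_pos hdw) (oip_self_pos (h.X_ne p)).ne' ?_
    linear_combination h0
  filter_upwards [hD.eventually_ne hDp] with q hq
  obtain ⟨v₀, v, hv⟩ := (h.g2.isVectorCross q).exists_eq (h.X_ne q) (Y q)
  refine ⟨v₀, v, hv, LinearIndependent.pair_iff.mpr fun s t hst => ?_⟩
  have hu : ∀ u, s * inner ℝ (grad Δ q) u + t * inner ℝ v u = 0 := fun u => by
    rw [← real_inner_smul_left, ← real_inner_smul_left, ← inner_add_left, hst, inner_zero_left]
  simp only [D, ← inner_grad, oip_L_eq (h.g2.isVectorCross q) hv] at hq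
  have hAq := hu (A q)
  have hBq := hu (B q)
  constructor
  · by_contra hs
    refine hq ((mul_eq_zero.mp (?_ : s * _ = 0)).resolve_left hs)
    linear_combination oip (X q) (X q) * inner ℝ v (B q) * hAq
      - oip (X q) (X q) * inner ℝ v (A q) * hBq
  · by_contra ht
    refine hq ((mul_eq_zero.mp (?_ : t * _ = 0)).resolve_left ht)
    linear_combination oip (X q) (X q) * inner ℝ (grad Δ q) (A q) * hBq
      - oip (X q) (X q) * inner ℝ (grad Δ q) (B q) * hAq

/-- Otherwise N = M and ⟨X,Y⟩ = 0 near p. For μ ≠ 0 the scalar constraint becomes 2mN = 0. For μ = 0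
the derivative of M - N along w is -8 l₁|w|²N, which is nonzero. -/
lemma IsRealKilling.exists_tau27_ne_zero (h : IsRealKilling nabla o φ Δ c r₁ r₂ mu X Y)
    (hr : mu = 0 → r₁ ≠ 0) {p : M} {w₀ : ℝ} {w : T7 p}
    (hY : Y p = w₀ • X p + L (tri (φ p)) w (X p))
    (hdw : LinearIndependent ℝ ![grad Δ p, w]) : ∃ q, tau27 (torX nabla o φ X q) ≠ 0 := by
  by_contra! h0
  have hfar : ∀ᶠ q in nhds p, oip (X q) (Y q) = 0 ∧ oip (Y q) (Y q) = oip (X q) (X q) := by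
    filter_upwards [h.eventually_independent hY hdw] with q ⟨v₀, v, hv, hdv⟩
    exact (h.killing q).of_tau27_eq_zero (h.g2.isVectorCross q) (h.X_ne q) hv hdv (h0 q)
  obtain ⟨hP, hNM⟩ := hfar.self_of_nhds
  have hN0 := oip_self_pos (h.X_ne p)
  by_cases hmu : mu = 0
  · have d0 := mvfderiv_eq_zero_of_eventually
      (f := fun q => oip (Y q) (Y q) + -oip (X q) (X q))
      (hfar.mono fun q hq => by rw [hq.2]; ring) w
    rw [mvfderiv_add_apply ((h.diffY p).oip (h.diffY p)) ((h.diffX p).oip (h.diffX p)).neg',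
      mvfderiv_neg_apply, h.mvfderiv_normX, h.mvfderiv_normY,
      oip_L_eq (h.g2.isVectorCross p) hY, hNM] at d0
    have hw : w ≠ 0 := by simpa using hdw.ne_zero 1
    have h1 : r₁ * Real.exp (-Δ p) * inner ℝ w w * oip (X p) (X p) = 0 := by linarith
    exact mul_ne_zero (mul_ne_zero (mul_ne_zero (hr hmu) (Real.exp_pos _).ne')
      (inner_self_ne_zero.mpr hw)) hN0.ne' h1
  · have h1 := (h.killing p).constraint (h.g2.isVectorCross p)
    rw [hP, hNM] at h1
    have h2 : mu * Real.exp (-4 * Δ p) * oip (X p) (X p) = 0 := by linarith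
    exact mul_ne_zero (mul_ne_zero hmu (Real.exp_pos _).ne') hN0.ne' h2

lemma IsRealKilling.torsionType_eq (h : IsRealKilling nabla o φ Δ c r₁ r₂ mu X Y)
    {p : M} {w₀ : ℝ} {w : T7 p} (hY : Y p = w₀ • X p + L (tri (φ p)) w (X p))
    (hdw : LinearIndependent ℝ ![grad Δ p, w]) {φX : ∀ p : M, T7 p → T7 p → T7 p → ℝ}
    (hφX : ∀ p, φX p = sigma (o p) (fun u v w => φ p u v w) (X p)) :
    (mu = 0 → r₂ = 0 → r₁ ≠ 0 →
      torsionType φX (torsion nabla o φX) = {.seven, .fourteen, .twentySeven}) ∧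
    (mu ≠ 0 → torsionType φX (torsion nabla o φX) = {.one, .seven, .fourteen, .twentySeven}) := by
  obtain rfl : φX = fun q => phiA (tri (φ q)) (X q) := by
    funext q
    obtain ⟨e, heo, he⟩ := h.g2.exists_adapted q
    rw [hφX, ← he.sigma_eq heo]
    rfl
  have hT : torsion nabla o (fun q => phiA (tri (φ q)) (X q)) = fun q => torX nabla o φ X q :=
    funext fun q => h.g2.torsion_phiA h.metric h.diffX h.X_ne q
  rw [hT]
  have h7 : tau7 (phiA (tri (φ p)) (X p)) (torX nabla o φ X p) ≠ 0 :=
    (h.killing p).tau7_ne_zero (h.g2.isVectorCross p) (finrank_T7 p) (h.X_ne p) hY hdw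
  have h14 : tau14 (phiA (tri (φ p)) (X p)) (torX nabla o φ X p) ≠ 0 :=
    (h.killing p).tau14_ne_zero (h.g2.isVectorCross p) (finrank_T7 p) (h.X_ne p) hY hdw
  constructor
  · intro hmu hr2 hr1
    have h27 := h.exists_tau27_ne_zero (fun _ => hr1) hY hdw
    have h1 := h.tau1_eq_zero hmu hr2
    ext (_ | _ | _ | _)
    · simpa [torsionType] using h1
    · simpa [torsionType] using ⟨p, h7⟩
    · simpa [torsionType] using ⟨p, h14⟩
    · simpa [torsionType] using h27
  · intro hmu
    have h27 := h.exists_tau27_ne_zero (fun h0 => absurd h0 hmu) hY hdw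
    have h1 := h.exists_tau1_ne_zero hmu hY hdw
    ext (_ | _ | _ | _)
    · simpa [torsionType] using h1
    · simpa [torsionType] using ⟨p, h7⟩
    · simpa [torsionType] using ⟨p, h14⟩
    · simpa [torsionType] using h27

end Calculus

end G2Flux

/-! ### The theorem. -/

theorem mainTheorem4 {M : Type*} [TopologicalSpace M]
    [ChartedSpace (EuclideanSpace ℝ (Fin 7)) M] [IsManifold (𝓡 7) ∞ M]
    [RiemannianBundle (fun p : M => G2Flux.T7 p)]
    [IsContMDiffRiemannianBundle (𝓡 7) ∞ (EuclideanSpace ℝ (Fin 7)) (fun p : M => G2Flux.T7 p)]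
    (nabla : CovariantDerivative (𝓡 7) (EuclideanSpace ℝ (Fin 7)) (fun p : M => G2Flux.T7 p))
    (hnabla : G2Flux.IsLeviCivita nabla)
    (o : ∀ p : M, Orientation ℝ (G2Flux.T7 p) (Fin 7))
    (φ : ∀ p : M, G2Flux.T7 p →L[ℝ] G2Flux.T7 p →L[ℝ] G2Flux.T7 p →L[ℝ] ℝ)
    (hφ : G2Flux.IsG2Structure o φ)
    (Δ : M → ℝ) (hΔ : ContMDiff (𝓡 7) 𝓘(ℝ, ℝ) ∞ Δ)
    (G : ∀ p : M, G2Flux.T7 p [⋀^Fin 4]→L[ℝ] ℝ)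
    (lam : ℂ) (hlam : lam ≠ 0) (mu : ℝ)
    (X Y : ∀ p : M, G2Flux.Oct (G2Flux.T7 p))
    (hX : G2Flux.SmoothOct X) (hY : G2Flux.SmoothOct Y)
    (hX0 : ∀ p, X p ≠ 0) (hY0 : ∀ p, Y p ≠ 0)
    (hZ : G2Flux.IsKilling nabla o (fun p u v w => φ p u v w) Δ G lam mu X Y)
    (w : ∀ p : M, G2Flux.T7 p)
    (hw : ∀ p, w p = (G2Flux.omul (fun u v w => φ p u v w) (Y p) (G2Flux.oinv (X p))).2)
    (hind : ∃ p, LinearIndependent ℝ ![G2Flux.grad Δ p, w p])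
    (φX φY : ∀ p : M, G2Flux.T7 p → G2Flux.T7 p → G2Flux.T7 p → ℝ)
    (hφX : ∀ p, φX p = G2Flux.sigma (o p) (fun u v w => φ p u v w) (X p))
    (hφY : ∀ p, φY p = G2Flux.sigma (o p) (fun u v w => φ p u v w) (Y p)) :
    (mu = 0 → lam.im = 0 →
      G2Flux.torsionType φX (G2Flux.torsion nabla o φX) = {.seven, .fourteen, .twentySeven} ∧
      G2Flux.torsionType φY (G2Flux.torsion nabla o φY) = {.seven, .fourteen, .twentySeven}) ∧
    (mu ≠ 0 →
      G2Flux.torsionType φX (G2Flux.torsion nabla o φX) =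
        {.one, .seven, .fourteen, .twentySeven} ∧
      G2Flux.torsionType φY (G2Flux.torsion nabla o φY) =
        {.one, .seven, .fourteen, .twentySeven}) := by
  obtain ⟨p, hp⟩ := hind
  have hK : G2Flux.IsRealKilling nabla o φ Δ
      (fun q => (G2Flux.isLinearMap_flux4 (φ := G2Flux.tri (φ q)) (G q)).mk') lam.re lam.im mu X Y :=
    { g2 := hφ
      metric := hnabla.2
      smooth := hΔ
      diffX := hX.diffOct
      diffY := hY.diffOct
      X_ne := hX0
      Y_ne := hY0
      killing := fun q => (hφ.isVectorCross q).isKillingAt (G2Flux.finrank_T7 q) (hZ.ext q)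
        fun u => by rw [← mul_assoc]; exact hZ.int q u }
  have hcross := hφ.isVectorCross p
  obtain ⟨w₀, hw₀⟩ := G2Flux.exists_eq_of_oinv hcross (hX0 p) (hw p)
  obtain ⟨v₀, v, hv₀, hv⟩ := G2Flux.exists_swap hcross hw₀ hp
  have hre : lam.im = 0 → lam.re ≠ 0 := fun him hre => hlam (Complex.ext hre him)
  have h1 := hK.torsionType_eq hw₀ hp hφX
  -- The exchange replaces λ by its conjugate, which preserves both the reality of λ and the value
  -- of μ.
  have h2 := hK.swap.torsionType_eq hv₀ hv hφY
  exact ⟨fun hmu him => ⟨h1.1 hmu him (hre him), h2.1 hmu (neg_eq_zero.mpr him) (hre him)⟩,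
    fun hmu => ⟨h1.2 hmu, h2.2 hmu⟩⟩
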